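/- Let $n\ge 0$ and $\hbar>0$. For multiindices $R,S\in\mathbb N^n$ write $|R|=\sum_k r_k$, $R!=\prod_k r_k!$, $\binom RI=\prod_k\binom{r_k}{i_k}$, and $I\le R$ for the componentwise order; $\partial_{z}^{R}\partial_{\bar z}^{S}$ denotes the iterated Wirtinger derivatives on $\mathbb C^n$. For $p\in\mathbb C^n$ and $f\in C^\infty(\mathbb C^n)$ define recursively for $m\in\mathbb N$ and $0\le\ell\le 2^m-1$ the quantities $h^{p}_{m,\ell,R,S}(f)\in[0,\infty]$ by $$h^{p}_{0,0,R,S}(f)=\sum_{N\in\mathbb N^n}\frac{(2\hbar)^{|R|+|S|+|N|}}{N!}\left|\partial_z^R\partial_{\bar z}^{N+S}f(p)\right|^2,$$ $$h^{p}_{m,\ell,R,S}(f)=\sum_{N\in\mathbb N^n}\frac1{N!}\Bigl(\sum_{I\le R}\sum_{J\le N+S}\binom RI\binom{N+S}J\,h^p_{m-1,\ell/2,I,J}(f)\Bigr)^2\quad(\ell\text{ even},\ m\ge1),$$ $$h^{p}_{m,\ell,R,S}(f)=\sum_{N\in\mathbb N^n}\frac1{N!}\Bigl(\sum_{I\le R}\sum_{J\le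 N+S}\binom RI\binom{N+S}J\,h^p_{m-1,(\ell-1)/2,J,I}(f)\Bigr)^2\quad(\ell\text{ odd},\ m\ge1),$$ and put $\|f\|^{p}_{m,\ell,R,S}=h^p_{m,\ell,R,S}(f)^{1/2^{m+1}}$. Let $\tilde{\mathcal A}_{p,\hbar}$ be the space of all $f\in C^\infty(\mathbb C^n)$ with $\|f\|^p_{m,\ell,R,S}<\infty$ for all $m,\ell,R,S$, with the locally convex topology of these seminorms, and let $\mathcal A_{p,\hbar}$ be its quotient by the functions whose $\infty$-jet at $p$ vanishes, with the quotient topology. **Theorem.** 1. For every $p\in\mathbb C^n$, each class in $\mathcal A_{p,\hbar}$ has exactly one real-analytic representative on $\mathbb C^n$. This identifies $\mathcal A_{p,\hbar}$, also topologically, with the space of real-analytic functions in $\tilde{\mathcal A}_{p,\hbar}$ equipped with the seminorms $\|\cdot\|^p_{m,\ell,R,S}$; this identification is used below. 2. For every $p$, and for $f,g\in\mathcal A_{p,\hbar}$, the Wick star product $$f\star g=\sum_{N\in\mathbb N^n}\frac{(2\hbar)^{|N|}}{N!}\,\frac{\partial^{|N|}f}{\partial z^N}\,\frac{\partial^{|N|}g}{\partial\bar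 z^N}$$ has all its terms in $\mathcal A_{p,\hbar}$ and converges absolutely in the topology of $\mathcal A_{p,\hbar}$. With this product and the pointwise complex conjugation as involution, $\mathcal A_{p,\hbar}$ is a Fréchet $^*$-algebra (a complete, metrizable, locally convex space with a jointly continuous associative bilinear product and a continuous antilinear involution that reverses products). 3. For any two points $p,p'\in\mathbb C^n$, $\mathcal A_{p,\hbar}=\mathcal A_{p',\hbar}$ as Fréchet $^*$-algebras: they are the same space of functions, the topologies defined by the seminorms at $p$ and at $p'$ coincide, and so do the products and the involutions. -/

import Mathlib

open scoped ContDiff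

noncomputable section

namespace Wick

/-- Multiindices. -/
abbrev MI (n : ℕ) : Type := Fin n → ℕ

variable {n : ℕ}

/-! ### Multiindex notation -/

/-- `|R| = r₁ + ⋯ + rₙ`. -/
def deg (R : MI n) : ℕ := ∑ k, R k

/-- `R! = r₁! ⋯ rₙ!`. -/
def fact (R : MI n) : ℕ := ∏ k, (R k).factorial

/-- The product of the componentwise binomial coefficients. -/
def binom (R I : MI n) : ℕ := ∏ k, (R k).choose (I k)

/-! ### Wirtinger derivatives on `ℂⁿ` -/

/-- `∂f/∂zᵏ = (∂f/∂xᵏ - i ∂f/∂yᵏ) / 2`. -/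
def dz (k : Fin n) (f : (Fin n → ℂ) → ℂ) : (Fin n → ℂ) → ℂ := fun z =>
  (1 / 2 : ℂ) * (fderiv ℝ f z (Pi.single k 1) - Complex.I * fderiv ℝ f z (Pi.single k Complex.I))

/-- `∂f/∂z̄ᵏ = (∂f/∂xᵏ + i ∂f/∂yᵏ) / 2`. -/
def dzbar (k : Fin n) (f : (Fin n → ℂ) → ℂ) : (Fin n → ℂ) → ℂ := fun z =>
  (1 / 2 : ℂ) * (fderiv ℝ f z (Pi.single k 1) + Complex.I * fderiv ℝ f z (Pi.single k Complex.I))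

/-- `∂^{|R|} f / ∂z^R`. -/
def dzPow (R : MI n) (f : (Fin n → ℂ) → ℂ) : (Fin n → ℂ) → ℂ :=
  (List.finRange n).foldr (fun k g => (dz k)^[R k] g) f

/-- `∂^{|S|} f / ∂z̄^S`. -/
def dzbarPow (S : MI n) (f : (Fin n → ℂ) → ℂ) : (Fin n → ℂ) → ℂ :=
  (List.finRange n).foldr (fun k g => (dzbar k)^[S k] g) f

/-- `∂^{|R| + |S|} f / ∂z^R ∂z̄^S`. -/
def wirt (R S : MI n) (f : (Fin n → ℂ) → ℂ) : (Fin n → ℂ) → ℂ := dzPow R (dzbarPow S f)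

/-! ### The recursive system of seminorms -/

/-- The quantity `h_{m,ℓ,R,S}^{p,ħ}(f) ∈ [0, ∞]` (meant for `0 ≤ ℓ < 2 ^ m`). -/
def hph (p : Fin n → ℂ) (ħ : ℝ) (f : (Fin n → ℂ) → ℂ) :
    ℕ → ℕ → MI n → MI n → ENNReal
  | 0, _, R, S =>
      ∑' N : MI n, ENNReal.ofReal ((2 * ħ) ^ (deg R + deg S + deg N) / (fact N : ℝ))
        * ‖wirt R (N + S) f p‖ₑ ^ 2
  | m + 1, ℓ, R, S =>
      if Even ℓ then
        ∑' N : MI n, (fact N : ENNReal)⁻¹ *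
          (∑ I ∈ Finset.Iic R, ∑ J ∈ Finset.Iic (N + S),
            (binom R I : ENNReal) * (binom (N + S) J : ENNReal) * hph p ħ f m (ℓ / 2) I J) ^ 2
      else
        ∑' N : MI n, (fact N : ENNReal)⁻¹ *
          (∑ I ∈ Finset.Iic R, ∑ J ∈ Finset.Iic (N + S),
            (binom R I : ENNReal) * (binom (N + S) J : ENNReal)
              * hph p ħ f m ((ℓ - 1) / 2) J I) ^ 2

/-- `‖f‖_{m,ℓ,R,S}^{p,ħ}`, the `2 ^ (m + 1)`-th root of `h_{m,ℓ,R,S}^{p,ħ}(f)`. -/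
def normph (p : Fin n → ℂ) (ħ : ℝ) (m ℓ : ℕ) (R S : MI n) (f : (Fin n → ℂ) → ℂ) : ENNReal :=
  hph p ħ f m ℓ R S ^ ((1 : ℝ) / 2 ^ (m + 1))

/-! ### Auxiliary facts: the `normph` are seminorms on smooth functions -/

theorem dz_add (k : Fin n) {f g : (Fin n → ℂ) → ℂ} (hf : ContDiff ℝ ∞ f) (hg : ContDiff ℝ ∞ g) :
    dz k (f + g) = dz k f + dz k g := by
  funext z
  have h := fderiv_add (𝕜 := ℝ) (hf.contDiffAt (x := z) |>.differentiableAt (by simp))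
    (hg.contDiffAt (x := z) |>.differentiableAt (by simp))
  simp only [dz, h, Pi.add_apply, add_apply]
  ring

theorem dzbar_add (k : Fin n) {f g : (Fin n → ℂ) → ℂ} (hf : ContDiff ℝ ∞ f)
    (hg : ContDiff ℝ ∞ g) : dzbar k (f + g) = dzbar k f + dzbar k g := by
  funext z
  have h := fderiv_add (𝕜 := ℝ) (hf.contDiffAt (x := z) |>.differentiableAt (by simp))
    (hg.contDiffAt (x := z) |>.differentiableAt (by simp))
  simp only [dzbar, h, Pi.add_apply, add_apply]
  ring

theorem dz_smul (k : Fin n) (a : ℂ) {f : (Fin n → ℂ) → ℂ} (hf : ContDiff ℝ ∞ f) :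
    dz k (a • f) = a • dz k f := by
  funext z
  have h := fderiv_const_smul (𝕜 := ℝ) (hf.contDiffAt (x := z) |>.differentiableAt (by simp)) a
  simp only [dz, h, Pi.smul_apply, smul_apply, smul_eq_mul]
  ring

theorem dzbar_smul (k : Fin n) (a : ℂ) {f : (Fin n → ℂ) → ℂ} (hf : ContDiff ℝ ∞ f) :
    dzbar k (a • f) = a • dzbar k f := by
  funext z
  have h := fderiv_const_smul (𝕜 := ℝ) (hf.contDiffAt (x := z) |>.differentiableAt (by simp)) a
  simp only [dzbar, h, Pi.smul_apply, smul_apply, smul_eq_mul]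
  ring

theorem dz_smooth (k : Fin n) {f : (Fin n → ℂ) → ℂ} (hf : ContDiff ℝ ∞ f) :
    ContDiff ℝ ∞ (dz k f) := by
  have h : ∀ v : Fin n → ℂ, ContDiff ℝ ∞ (fun z => fderiv ℝ f z v) := fun v =>
    (hf.fderiv_right (m := ∞) (by simp)).clm_apply contDiff_const
  exact contDiff_const.mul ((h _).sub (contDiff_const.mul (h _)))

theorem dzbar_smooth (k : Fin n) {f : (Fin n → ℂ) → ℂ} (hf : ContDiff ℝ ∞ f) :
    ContDiff ℝ ∞ (dzbar k f) := by
  have h : ∀ v : Fin n → ℂ, ContDiff ℝ ∞ (fun z => fderiv ℝ f z v) := fun v =>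
    (hf.fderiv_right (m := ∞) (by simp)).clm_apply contDiff_const
  exact contDiff_const.mul ((h _).add (contDiff_const.mul (h _)))

/-- An operator on functions which is linear on, and preserves, smooth functions. -/
structure SmoothLin (D : ((Fin n → ℂ) → ℂ) → ((Fin n → ℂ) → ℂ)) : Prop where
  smooth : ∀ f, ContDiff ℝ ∞ f → ContDiff ℝ ∞ (D f)
  add : ∀ f g, ContDiff ℝ ∞ f → ContDiff ℝ ∞ g → D (f + g) = D f + D g
  smul : ∀ (a : ℂ) f, ContDiff ℝ ∞ f → D (a • f) = a • D f

theorem SmoothLin.comp {D E : ((Fin n → ℂ) → ℂ) → ((Fin n → ℂ) → ℂ)}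
    (hD : SmoothLin D) (hE : SmoothLin E) : SmoothLin (fun f => D (E f)) where
  smooth f hf := hD.smooth _ (hE.smooth _ hf)
  add f g hf hg := by
    rw [hE.add f g hf hg, hD.add _ _ (hE.smooth _ hf) (hE.smooth _ hg)]
  smul a f hf := by rw [hE.smul a f hf, hD.smul _ _ (hE.smooth _ hf)]

theorem SmoothLin.iterate {D : ((Fin n → ℂ) → ℂ) → ((Fin n → ℂ) → ℂ)} (hD : SmoothLin D)
    (r : ℕ) : SmoothLin (D^[r]) := by
  induction r with
  | zero => exact ⟨fun _ h => h, fun _ _ _ _ => rfl, fun _ _ _ => rfl⟩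
  | succ r ih => exact ih.comp hD

theorem SmoothLin.foldr {D : Fin n → ((Fin n → ℂ) → ℂ) → ((Fin n → ℂ) → ℂ)}
    (hD : ∀ k, SmoothLin (D k)) (R : MI n) (l : List (Fin n)) :
    SmoothLin (fun f => l.foldr (fun k g => (D k)^[R k] g) f) := by
  induction l with
  | nil => exact ⟨fun _ h => h, fun _ _ _ _ => rfl, fun _ _ _ => rfl⟩
  | cons k l ih => exact ((hD k).iterate (R k)).comp ih

theorem wirt_smoothLin (R S : MI n) : SmoothLin (wirt R S) :=
  (SmoothLin.foldr (fun k => ⟨fun _ h => dz_smooth k h, fun _ _ h h' => dz_add k h h',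
    fun a _ h => dz_smul k a h⟩) R (List.finRange n)).comp
  (SmoothLin.foldr (fun k => ⟨fun _ h => dzbar_smooth k h, fun _ _ h h' => dzbar_add k h h',
    fun a _ h => dzbar_smul k a h⟩) S (List.finRange n))

theorem minkowski_sum {ι : Type*} (s : Finset ι) (c a b : ι → ENNReal) {q : ℝ} (hq : 1 ≤ q) :
    (∑ i ∈ s, c i * (a i + b i) ^ q) ^ (1 / q) ≤
      (∑ i ∈ s, c i * a i ^ q) ^ (1 / q) + (∑ i ∈ s, c i * b i ^ q) ^ (1 / q) := by
  have hq0 : 0 ≤ q := by linarith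
  have hq1 : q ≠ 0 := by linarith
  have key : ∀ d : ι → ENNReal, ∀ i, c i * d i ^ q = (c i ^ (1 / q) * d i) ^ q := fun d i => by
    rw [ENNReal.mul_rpow_of_nonneg _ _ hq0, ← ENNReal.rpow_mul, one_div_mul_cancel hq1,
      ENNReal.rpow_one]
  have h := ENNReal.Lp_add_le s (fun i => c i ^ (1 / q) * a i) (fun i => c i ^ (1 / q) * b i) hq
  simp only [key a, key b, key (fun i => a i + b i), mul_add]
  exact h

theorem minkowski_tsum {ι : Type*} (c a b : ι → ENNReal) {q : ℝ} (hq : 1 ≤ q) :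
    (∑' i, c i * (a i + b i) ^ q) ^ (1 / q) ≤
      (∑' i, c i * a i ^ q) ^ (1 / q) + (∑' i, c i * b i ^ q) ^ (1 / q) := by
  have hq0 : 0 < q := by linarith
  rw [one_div, ENNReal.rpow_inv_le_iff hq0, ENNReal.tsum_eq_iSup_sum]
  refine iSup_le fun s => ?_
  rw [← ENNReal.rpow_inv_le_iff hq0, ← one_div]
  refine (minkowski_sum s c a b hq).trans ?_
  gcongr <;> exact ENNReal.sum_le_tsum s

theorem minkowski_mixed {ι κ : Type*} (w : ι → ENNReal) (s : ι → Finset κ)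
    (c : ι → κ → ENNReal) (t a b : κ → ENNReal) {q : ℝ} (hq : 1 ≤ q)
    (ht : ∀ k, t k ≤ a k + b k) :
    (∑' i, w i * (∑ k ∈ s i, c i k * t k ^ q) ^ 2) ^ (1 / (2 * q)) ≤
      (∑' i, w i * (∑ k ∈ s i, c i k * a k ^ q) ^ 2) ^ (1 / (2 * q)) +
      (∑' i, w i * (∑ k ∈ s i, c i k * b k ^ q) ^ 2) ^ (1 / (2 * q)) := by
  have hq0 : 0 < q := by linarith
  have key : ∀ x : ENNReal, x ^ 2 = (x ^ (1 / q)) ^ (2 * q) := fun x => by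
    rw [← ENNReal.rpow_mul, ← ENNReal.rpow_natCast]
    congr 1
    field_simp
    norm_num
  simp only [key]
  refine le_trans ?_ (minkowski_tsum w _ _ (q := 2 * q) (by linarith))
  gcongr with i
  refine le_trans ?_ (minkowski_sum (s i) (c i) a b hq)
  gcongr with k
  exact ht k

theorem normph_zero_eq (p : Fin n → ℂ) (ħ : ℝ) (ℓ : ℕ) (R S : MI n) (f : (Fin n → ℂ) → ℂ) :
    normph p ħ 0 ℓ R S f = (∑' N : MI n,
      ENNReal.ofReal ((2 * ħ) ^ (deg R + deg S + deg N) / (fact N : ℝ))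
        * ‖wirt R (N + S) f p‖ₑ ^ (2 : ℝ)) ^ ((1 : ℝ) / 2) := by
  simp [normph, hph]

theorem hph_eq_normph (p : Fin n → ℂ) (ħ : ℝ) (m ℓ : ℕ) (R S : MI n) (f : (Fin n → ℂ) → ℂ) :
    hph p ħ f m ℓ R S = (normph p ħ m ℓ R S f ^ (2 : ℝ) ^ (m + 1)) := by
  rw [normph, ← ENNReal.rpow_mul, one_div_mul_cancel (by positivity), ENNReal.rpow_one]

/-- A uniform description of the recursion step. -/
theorem normph_succ_eq (p : Fin n → ℂ) (ħ : ℝ) (m ℓ : ℕ) (R S : MI n) :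
    ∃ (σ : MI n × MI n → MI n × MI n) (ℓ' : ℕ), ∀ f : (Fin n → ℂ) → ℂ,
      normph p ħ (m + 1) ℓ R S f = (∑' N : MI n, (fact N : ENNReal)⁻¹ *
        (∑ K ∈ Finset.Iic R ×ˢ Finset.Iic (N + S),
          ((binom R K.1 : ENNReal) * (binom (N + S) K.2 : ENNReal)) *
            normph p ħ m ℓ' (σ K).1 (σ K).2 f ^ (2 : ℝ) ^ (m + 1)) ^ 2)
              ^ (1 / (2 * (2 : ℝ) ^ (m + 1))) := by
  by_cases hl : Even ℓ
  · refine ⟨id, ℓ / 2, fun f => ?_⟩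
    simp only [← hph_eq_normph, Finset.sum_product, id]
    rw [normph, hph, if_pos hl, pow_succ' (2 : ℝ) (m + 1)]
  · refine ⟨Prod.swap, (ℓ - 1) / 2, fun f => ?_⟩
    simp only [← hph_eq_normph, Finset.sum_product, Prod.fst_swap, Prod.snd_swap]
    rw [normph, hph, if_neg hl, pow_succ' (2 : ℝ) (m + 1)]

theorem normph_add_le (p : Fin n → ℂ) (ħ : ℝ) (m ℓ : ℕ) (R S : MI n) {f g : (Fin n → ℂ) → ℂ}
    (hf : ContDiff ℝ ∞ f) (hg : ContDiff ℝ ∞ g) :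
    normph p ħ m ℓ R S (f + g) ≤ normph p ħ m ℓ R S f + normph p ħ m ℓ R S g := by
  induction m generalizing ℓ R S with
  | zero =>
    simp only [normph_zero_eq]
    refine le_trans ?_ (minkowski_tsum _ _ _ (by norm_num))
    gcongr with N
    rw [(wirt_smoothLin R (N + S)).add f g hf hg]
    exact enorm_add_le _ _
  | succ m ih =>
    obtain ⟨σ, ℓ', h⟩ := normph_succ_eq p ħ m ℓ R S
    rw [h, h, h]
    exact minkowski_mixed _ _ _ _ _ _ (one_le_pow₀ (by norm_num)) fun K => ih _ _ _

theorem normph_smul (p : Fin n → ℂ) (ħ : ℝ) (m ℓ : ℕ) (R S : MI n) (a : ℂ)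
    {f : (Fin n → ℂ) → ℂ} (hf : ContDiff ℝ ∞ f) :
    normph p ħ m ℓ R S (a • f) = ‖a‖ₑ * normph p ħ m ℓ R S f := by
  induction m generalizing ℓ R S with
  | zero =>
    simp only [normph_zero_eq]
    have h : ∀ N : MI n, ‖wirt R (N + S) (a • f) p‖ₑ = ‖a‖ₑ * ‖wirt R (N + S) f p‖ₑ := fun N => by
      rw [(wirt_smoothLin R (N + S)).smul a f hf, Pi.smul_apply, enorm_smul]
    simp only [h, ENNReal.mul_rpow_of_nonneg _ _ (zero_le_two (α := ℝ)),
      mul_left_comm _ (‖a‖ₑ ^ (2 : ℝ)), ENNReal.tsum_mul_left]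
    rw [ENNReal.mul_rpow_of_nonneg _ _ (by norm_num), ← ENNReal.rpow_mul]
    norm_num
  | succ m ih =>
    obtain ⟨σ, ℓ', h⟩ := normph_succ_eq p ħ m ℓ R S
    have hq : (0 : ℝ) < 2 ^ (m + 1) := by positivity
    rw [h, h]
    simp only [ih, ENNReal.mul_rpow_of_nonneg _ _ hq.le,
      mul_left_comm _ (‖a‖ₑ ^ (2 : ℝ) ^ (m + 1)), ← Finset.mul_sum, mul_pow]
    simp only [mul_left_comm _ ((‖a‖ₑ ^ (2 : ℝ) ^ (m + 1)) ^ 2), ENNReal.tsum_mul_left]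
    rw [ENNReal.mul_rpow_of_nonneg _ _ (by positivity), ← ENNReal.rpow_natCast,
      ← ENNReal.rpow_mul, ← ENNReal.rpow_mul]
    have : (2 : ℝ) ^ (m + 1) * ((2 : ℕ) : ℝ) * (1 / (2 * 2 ^ (m + 1))) = 1 := by
      push_cast
      field_simp
    rw [mul_assoc] at this
    rw [this, ENNReal.rpow_one]

theorem normph_zero_fun (p : Fin n → ℂ) (ħ : ℝ) (m ℓ : ℕ) (R S : MI n) :
    normph p ħ m ℓ R S (0 : (Fin n → ℂ) → ℂ) = 0 := by
  have h := normph_smul p ħ m ℓ R S 0 (f := (0 : (Fin n → ℂ) → ℂ)) contDiff_const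
  simpa using h

/-! ### The spaces -/

/-- The smooth functions all of whose seminorms at `p` are finite, as a subspace of all functions
on `ℂⁿ`. -/
def tildeSubmodule (p : Fin n → ℂ) (ħ : ℝ) : Submodule ℂ ((Fin n → ℂ) → ℂ) where
  carrier := {f | ContDiff ℝ ∞ f ∧
    ∀ (m ℓ : ℕ) (R S : MI n), ℓ < 2 ^ m → normph p ħ m ℓ R S f < ⊤}
  add_mem' {f g} hf hg := ⟨hf.1.add hg.1, fun m ℓ R S hl =>
    (normph_add_le p ħ m ℓ R S hf.1 hg.1).trans_lt
      (ENNReal.add_lt_top.2 ⟨hf.2 m ℓ R S hl, hg.2 m ℓ R S hl⟩)⟩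
  zero_mem' := ⟨contDiff_const, fun m ℓ R S _ => by rw [normph_zero_fun]; simp⟩
  smul_mem' a f hf := ⟨contDiff_const.smul hf.1, fun m ℓ R S hl => by
    rw [normph_smul p ħ m ℓ R S a hf.1]
    exact ENNReal.mul_lt_top (by simp) (hf.2 m ℓ R S hl)⟩

/-- The real-analytic functions on `ℂⁿ` all of whose seminorms at `p` are finite. -/
def wickSubmodule (p : Fin n → ℂ) (ħ : ℝ) : Submodule ℂ ((Fin n → ℂ) → ℂ) where
  carrier := {f | f ∈ tildeSubmodule p ħ ∧ AnalyticOnNhd ℝ f Set.univ}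
  add_mem' hf hg := ⟨add_mem hf.1 hg.1, hf.2.add hg.2⟩
  zero_mem' := ⟨zero_mem _, analyticOnNhd_const⟩
  smul_mem' a _ hf := ⟨Submodule.smul_mem _ a hf.1, hf.2.const_smul (c := a)⟩

/-- The space `Ã_{p,ħ}`, as a type of its own, so that it does not inherit the topology of
pointwise convergence. -/
def TildeA (p : Fin n → ℂ) (ħ : ℝ) : Type := tildeSubmodule p ħ

instance (p : Fin n → ℂ) (ħ : ℝ) : AddCommGroup (TildeA p ħ) :=
  inferInstanceAs (AddCommGroup (tildeSubmodule p ħ))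

instance (p : Fin n → ℂ) (ħ : ℝ) : Module ℂ (TildeA p ħ) :=
  inferInstanceAs (Module ℂ (tildeSubmodule p ħ))

/-- The space `A_{p,ħ}`, realised by the real-analytic representatives. -/
def WickA (p : Fin n → ℂ) (ħ : ℝ) : Type := wickSubmodule p ħ

instance (p : Fin n → ℂ) (ħ : ℝ) : AddCommGroup (WickA p ħ) :=
  inferInstanceAs (AddCommGroup (wickSubmodule p ħ))

instance (p : Fin n → ℂ) (ħ : ℝ) : Module ℂ (WickA p ħ) :=
  inferInstanceAs (Module ℂ (wickSubmodule p ħ))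

/-- The function underlying an element of `Ã_{p,ħ}`. -/
def TildeA.toFun {p : Fin n → ℂ} {ħ : ℝ} (f : TildeA p ħ) : (Fin n → ℂ) → ℂ := f.1

/-- The function underlying an element of `A_{p,ħ}`. -/
def WickA.toFun {p : Fin n → ℂ} {ħ : ℝ} (f : WickA p ħ) : (Fin n → ℂ) → ℂ := f.1

instance (p : Fin n → ℂ) (ħ : ℝ) : CoeFun (TildeA p ħ) (fun _ => (Fin n → ℂ) → ℂ) :=
  ⟨TildeA.toFun⟩

instance (p : Fin n → ℂ) (ħ : ℝ) : CoeFun (WickA p ħ) (fun _ => (Fin n → ℂ) → ℂ) :=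
  ⟨WickA.toFun⟩

/-- The inclusion of `A_{p,ħ}` into `Ã_{p,ħ}`. -/
def incl (p : Fin n → ℂ) (ħ : ℝ) : WickA p ħ →ₗ[ℂ] TildeA p ħ where
  toFun f := ⟨f.1, f.2.1⟩
  map_add' _ _ := rfl
  map_smul' _ _ := rfl

/-- The labels `(m, ℓ, R, S)` with `0 ≤ ℓ < 2 ^ m`. -/
abbrev Label (n : ℕ) : Type := (Σ m : ℕ, Fin (2 ^ m)) × MI n × MI n

/-- The seminorms `‖·‖_{m,ℓ,R,S}^{p,ħ}` on `Ã_{p,ħ}`. -/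
def tildeSeminorm (p : Fin n → ℂ) (ħ : ℝ) : SeminormFamily ℂ (TildeA p ħ) (Label n) := fun i =>
  Seminorm.of (fun f => (normph p ħ i.1.1 i.1.2 i.2.1 i.2.2 f).toReal)
    (fun f g => by
      have hf := (f.2.2 i.1.1 i.1.2 i.2.1 i.2.2 i.1.2.2).ne
      have hg := (g.2.2 i.1.1 i.1.2 i.2.1 i.2.2 i.1.2.2).ne
      have h := normph_add_le p ħ i.1.1 i.1.2 i.2.1 i.2.2 f.2.1 g.2.1
      have h' := ENNReal.toReal_mono (ENNReal.add_ne_top.2 ⟨hf, hg⟩) h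
      rwa [ENNReal.toReal_add hf hg] at h')
    (fun a f => by
      have h := congrArg ENNReal.toReal (normph_smul p ħ i.1.1 i.1.2 i.2.1 i.2.2 a f.2.1)
      rwa [ENNReal.toReal_mul, toReal_enorm] at h)

/-- The seminorms `‖·‖_{m,ℓ,R,S}^{p,ħ}` on `A_{p,ħ}`. -/
def wickSeminorm (p : Fin n → ℂ) (ħ : ℝ) : SeminormFamily ℂ (WickA p ħ) (Label n) := fun i =>
  (tildeSeminorm p ħ i).comp (incl p ħ)

instance : Nonempty (Label n) := ⟨(⟨0, ⟨0, by simp⟩⟩, 0, 0)⟩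

/-- The locally convex topology of `Ã_{p,ħ}` given by the seminorms. -/
instance (p : Fin n → ℂ) (ħ : ℝ) : TopologicalSpace (TildeA p ħ) :=
  (tildeSeminorm p ħ).moduleFilterBasis.topology

/-- The locally convex topology of `A_{p,ħ}` given by the seminorms. -/
instance (p : Fin n → ℂ) (ħ : ℝ) : TopologicalSpace (WickA p ħ) :=
  (wickSeminorm p ħ).moduleFilterBasis.topology

/-- The functions in `Ã_{p,ħ}` with vanishing `∞`-jet at `p`. -/
def flat (p : Fin n → ℂ) (ħ : ℝ) : Submodule ℂ (TildeA p ħ) where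
  carrier := {f | ∀ k : ℕ, iteratedFDeriv ℝ k f p = 0}
  add_mem' {f g} hf hg k := by
    have h := iteratedFDeriv_add_apply (𝕜 := ℝ) (x := p) (i := k)
      (f.2.1.contDiffAt.of_le (by exact_mod_cast le_top))
      (g.2.1.contDiffAt.of_le (by exact_mod_cast le_top))
    exact h.trans (by erw [hf k, hg k, add_zero])
  zero_mem' k := by
    change iteratedFDeriv ℝ k (fun _ => (0 : ℂ)) p = 0
    simp
  smul_mem' a f hf k := by
    have h := iteratedFDeriv_const_smul_apply (𝕜 := ℝ) (x := p) (i := k) (a := a)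
      (f.2.1.contDiffAt.of_le (by exact_mod_cast le_top))
    exact h.trans (by erw [hf k, smul_zero])

/-- The map sending an element of `A_{p,ħ}` to its class in the quotient of `Ã_{p,ħ}` by the
functions with vanishing `∞`-jet at `p`. -/
def toQuotient (p : Fin n → ℂ) (ħ : ℝ) : WickA p ħ →ₗ[ℂ] (TildeA p ħ ⧸ flat p ħ) :=
  (flat p ħ).mkQ ∘ₗ incl p ħ

/-! ### The Wick star product and Fréchet `*`-algebras -/

/-- The `N`-th term `(2ħ)^{|N|} / N! · ∂^{|N|}f/∂z^N · ∂^{|N|}g/∂z̄^N` of the Wick star product. -/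
def wickTerm (ħ : ℝ) (f g : (Fin n → ℂ) → ℂ) (N : MI n) : (Fin n → ℂ) → ℂ := fun z =>
  ((2 * ħ : ℝ) : ℂ) ^ deg N / (fact N : ℂ) * (dzPow N f z * dzbarPow N g z)

/-- `h` is the Wick star product of `f` and `g`: the terms of the series are in `A_{p,ħ}`, and the
series converges in the topology of `A_{p,ħ}`, absolutely with respect to every seminorm, to `h`. -/
def IsWickProduct {p : Fin n → ℂ} {ħ : ℝ} (f g h : WickA p ħ) : Prop :=
  ∃ t : MI n → WickA p ħ, (∀ N, (t N : (Fin n → ℂ) → ℂ) = wickTerm ħ f g N) ∧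
    (∀ i, Summable fun N => wickSeminorm p ħ i (t N)) ∧ HasSum t h

/-- `V` with the product `mul` and the involution `str` is a Fréchet `*`-algebra: a complete
metrizable locally convex space with a continuous associative bilinear product and a continuous
antilinear involution reversing products. -/
structure IsFrechetStarAlgebra (V : Type) [AddCommGroup V] [Module ℂ V] [TopologicalSpace V]
    (mul : V → V → V) (str : V → V) : Prop where
  isTopologicalAddGroup : IsTopologicalAddGroup V
  continuousSMul : ContinuousSMul ℂ V
  locallyConvexSpace : LocallyConvexSpace ℝ V
  metrizableSpace : TopologicalSpace.MetrizableSpace V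
  completeSpace : @CompleteSpace V (IsTopologicalAddGroup.rightUniformSpace V)
  add_mul : ∀ a b c, mul (a + b) c = mul a c + mul b c
  mul_add : ∀ a b c, mul a (b + c) = mul a b + mul a c
  smul_mul : ∀ (r : ℂ) a b, mul (r • a) b = r • mul a b
  mul_smul : ∀ (r : ℂ) a b, mul a (r • b) = r • mul a b
  mul_assoc : ∀ a b c, mul (mul a b) c = mul a (mul b c)
  continuous_mul : Continuous fun x : V × V => mul x.1 x.2
  str_add : ∀ a b, str (a + b) = str a + str b
  str_smul : ∀ (r : ℂ) a, str (r • a) = (starRingEnd ℂ) r • str a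
  str_str : ∀ a, str (str a) = a
  str_mul : ∀ a b, str (mul a b) = mul (str b) (str a)
  continuous_str : Continuous str

end Wick

end

/-! The recursive seminorms at `p` define the same topology as the weighted supremum norms `aq ε
(jet p f)`, the supremum over all multiindices of |∂^α f(p)| / (α!)^ε, for all ε > 0. So the algebra
consists of the real-analytic functions whose Wirtinger derivatives grow more slowly than every
positive power of the factorials, and the recursion is needed only to prove this equivalence.

One half, `hph_le` and `normph_le`, is an induction on m: binomials, numbers of summands and powers
of ħ are geometric in the degree and are absorbed into an arbitrarily small power of the factorials
(`pow_mdeg_le_wt`), while the weight 1/N! makes the sum over N converge. For the other half,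
`aq_le_normph`, single summands are kept. They bound h_{m,1,0,0} below by a power of one derivative
divided by a fixed power of factorials, and the root of order 2^(m+1) makes that factorial power as
small as desired.

In terms of arrays of derivatives everything becomes elementary. Finite `aq (1/2)` gives an
everywhere convergent Taylor series that may be differentiated term by term (`ent_of_aq`,
`Ent.wop_pser`), so an array of the class at `p` comes from exactly one real-analytic function.
Since every seminorm depends only on the jet, passing to this function inverts the quotient map
(`isHomeomorph_toQuotient`). Re-expansion at another point costs only a doubling of ε
(`aq_translate_le`), hence the class `IsWickFn` and its topology are independent of `p`.

For the product, the two shifts by N cost (N!)^(4ε) against the coefficient 1/N!, so the series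
converges absolutely with a bilinear bound (`aq_termArray_le`). Associativity is Leibniz' rule
together with a rearrangement of one absolutely convergent triple series (`tsum_termArray_assoc`).
Completeness holds because limits of arrays satisfy the same bounds (`exists_limit_of_cauchy`), and
metrizability because ε = 1/(k+1) suffices. -/

noncomputable section

namespace Wick

/-! ### Factorials and degrees of multiindices -/

section Multiindex

open scoped ENNReal

variable {ι : Type*} [Fintype ι]

/-- The degree of a multiindex over an arbitrary finite type. -/
def mdeg (α : ι → ℕ) : ℕ := ∑ i, α i

/-- The factorial of a multiindex over an arbitrary finite type. -/
def mfact (α : ι → ℕ) : ℕ := ∏ i, (α i).factorial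

@[simp] theorem mdeg_zero : mdeg (0 : ι → ℕ) = 0 := by simp [mdeg]

@[simp] theorem mfact_zero : mfact (0 : ι → ℕ) = 1 := by simp [mfact]

theorem mdeg_add (α β : ι → ℕ) : mdeg (α + β) = mdeg α + mdeg β := by
  simp [mdeg, Finset.sum_add_distrib]

theorem mfact_pos (α : ι → ℕ) : 0 < mfact α := Finset.prod_pos fun _ _ => Nat.factorial_pos _

theorem mfact_ne_zero (α : ι → ℕ) : mfact α ≠ 0 := (mfact_pos α).ne'

theorem mfact_mul_le (α β : ι → ℕ) : mfact α * mfact β ≤ mfact (α + β) := by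
  rw [mfact, mfact, mfact, ← Finset.prod_mul_distrib]
  exact Finset.prod_le_prod' fun i _ =>
    Nat.le_of_dvd (Nat.factorial_pos _) (Nat.factorial_mul_factorial_dvd_factorial_add _ _)

/-- Each coordinate contributes a binomial coefficient, which is at most a power of 2. -/
theorem mfact_add_le (α β : ι → ℕ) :
    mfact (α + β) ≤ 2 ^ (mdeg α + mdeg β) * (mfact α * mfact β) := by
  rw [← mdeg_add, mdeg, ← Finset.prod_pow_eq_pow_sum, mfact, mfact, mfact,
    ← Finset.prod_mul_distrib, ← Finset.prod_mul_distrib]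
  refine Finset.prod_le_prod' fun i _ => ?_
  rw [Pi.add_apply, ← Nat.add_choose_mul_factorial_mul_factorial, mul_assoc]
  exact Nat.mul_le_mul_right _ (Nat.choose_le_two_pow _ _)

theorem mfact_mono {α β : ι → ℕ} (h : α ≤ β) : mfact α ≤ mfact β :=
  Finset.prod_le_prod' fun i _ => Nat.factorial_le (h i)

theorem multiindex_induction [DecidableEq ι] {P : (ι → ℕ) → Prop} (zero : P 0)
    (add_single : ∀ α i, P α → P (α + Pi.single i 1)) (α : ι → ℕ) : P α := by
  induction h : mdeg α generalizing α with
  | zero =>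
    have : α = 0 := by
      funext i
      simpa using (Finset.sum_eq_zero_iff.1 h) i (Finset.mem_univ i)
    rwa [this]
  | succ k ih =>
    obtain ⟨i, hi⟩ : ∃ i, α i ≠ 0 := by
      by_contra! hc
      have : α = 0 := funext hc
      simp [this] at h
    have hα : α = (α - Pi.single i 1) + Pi.single i 1 := by
      funext j
      by_cases hj : j = i
      · subst hj
        simp
        omega
      · simp [hj]
    rw [hα]
    refine add_single _ _ (ih _ ?_)
    rw [hα, mdeg_add] at h
    have : mdeg (Pi.single i 1 : ι → ℕ) = 1 := by simp [mdeg]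
    omega

/-- The weight `(α!)^ε`. -/
def wt (ε : ℝ) (α : ι → ℕ) : ℝ≥0∞ := (mfact α : ℝ≥0∞) ^ ε

theorem wt_ne_zero (ε : ℝ) (α : ι → ℕ) : wt ε α ≠ 0 := by
  simp [wt, ENNReal.rpow_eq_zero_iff, mfact_ne_zero]

theorem wt_ne_top (ε : ℝ) (α : ι → ℕ) : wt ε α ≠ ⊤ := by
  simp [wt, ENNReal.rpow_eq_top_iff, mfact_ne_zero]

theorem wt_add_exp (ε δ : ℝ) (α : ι → ℕ) : wt (ε + δ) α = wt ε α * wt δ α :=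
  ENNReal.rpow_add _ _ (by simp [mfact_ne_zero]) (by simp)

theorem wt_neg (ε : ℝ) (α : ι → ℕ) : wt (-ε) α = (wt ε α)⁻¹ := ENNReal.rpow_neg _ _

theorem wt_mul_neg (ε : ℝ) (α : ι → ℕ) : wt ε α * wt (-ε) α = 1 := by
  rw [wt_neg, ENNReal.mul_inv_cancel (wt_ne_zero _ _) (wt_ne_top _ _)]

theorem wt_one (α : ι → ℕ) : wt 1 α = mfact α := by simp [wt]

theorem wt_zero_index (ε : ℝ) : wt ε (0 : ι → ℕ) = 1 := by simp [wt]

theorem wt_pow (ε : ℝ) (k : ℕ) (α : ι → ℕ) : wt ε α ^ k = wt (k * ε) α := by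
  rw [wt, wt, ← ENNReal.rpow_natCast, ← ENNReal.rpow_mul, mul_comm]

theorem one_le_mfact (α : ι → ℕ) : (1 : ℝ≥0∞) ≤ mfact α := by
  exact_mod_cast mfact_pos α

theorem wt_mono_exp {ε δ : ℝ} (h : ε ≤ δ) (α : ι → ℕ) : wt ε α ≤ wt δ α :=
  ENNReal.rpow_le_rpow_of_exponent_le (one_le_mfact α) h

theorem wt_mono {ε : ℝ} (hε : 0 ≤ ε) {α β : ι → ℕ} (h : α ≤ β) : wt ε α ≤ wt ε β :=
  ENNReal.rpow_le_rpow (by exact_mod_cast mfact_mono h) hε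

theorem wt_mul_le {ε : ℝ} (hε : 0 ≤ ε) (α β : ι → ℕ) : wt ε α * wt ε β ≤ wt ε (α + β) := by
  rw [wt, wt, ← ENNReal.mul_rpow_of_nonneg _ _ hε]
  exact ENNReal.rpow_le_rpow (by exact_mod_cast mfact_mul_le α β) hε

/-- The weights are submultiplicative up to geometric factors; ε ≤ 1 serves only to keep the base of
these factors equal to 2. -/
theorem wt_add_le {ε : ℝ} (hε : 0 ≤ ε) (hε1 : ε ≤ 1) (α β : ι → ℕ) :
    wt ε (α + β) ≤ 2 ^ mdeg α * wt ε α * (2 ^ mdeg β * wt ε β) := by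
  have h : (mfact (α + β) : ℝ≥0∞) ≤ 2 ^ (mdeg α + mdeg β) * (mfact α * mfact β) := by
    exact_mod_cast mfact_add_le α β
  have h2 : ((2 : ℝ≥0∞) ^ (mdeg α + mdeg β)) ^ ε ≤ 2 ^ (mdeg α + mdeg β) := by
    conv_rhs => rw [← ENNReal.rpow_one (2 ^ (mdeg α + mdeg β))]
    exact ENNReal.rpow_le_rpow_of_exponent_le (one_le_pow₀ (by norm_num)) hε1
  calc wt ε (α + β) ≤ (2 ^ (mdeg α + mdeg β) * (mfact α * mfact β) : ℝ≥0∞) ^ ε :=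
        ENNReal.rpow_le_rpow h hε
    _ = ((2 : ℝ≥0∞) ^ (mdeg α + mdeg β)) ^ ε * (wt ε α * wt ε β) := by
        rw [ENNReal.mul_rpow_of_nonneg _ _ hε, ENNReal.mul_rpow_of_nonneg _ _ hε, wt, wt]
    _ ≤ 2 ^ (mdeg α + mdeg β) * (wt ε α * wt ε β) := by gcongr
    _ = _ := by rw [pow_add]; ring

/-- Geometric growth is negligible against any positive power of the factorial. In one variable, x^k
/ k! ≤ exp x is taken at x = K^(1/δ) and raised to the power δ; the multivariate bound is the
product over the coordinates. Almost every estimate below discards its geometric constants in this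
way. -/
theorem pow_mdeg_le_wt (K : ℝ≥0∞) (hK : K ≠ ⊤) {δ : ℝ} (hδ : 0 < δ) :
    ∃ C : ℝ≥0∞, C ≠ ⊤ ∧ ∀ α : ι → ℕ, K ^ mdeg α ≤ C * wt δ α := by
  lift K to NNReal using hK
  have key : ∀ k : ℕ, (K : ℝ≥0∞) ^ k ≤
      ENNReal.ofReal (Real.exp ((K : ℝ) ^ (1 / δ))) ^ δ * (k.factorial : ℝ≥0∞) ^ δ := by
    intro k
    have h := Real.pow_div_factorial_le_exp ((K : ℝ) ^ (1 / δ)) (by positivity) k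
    rw [div_le_iff₀ (by positivity)] at h
    have h' := Real.rpow_le_rpow (by positivity) h hδ.le
    have e1 : (((K : ℝ) ^ (1 / δ)) ^ k) ^ δ = (K : ℝ) ^ k := by
      rw [← Real.rpow_natCast, ← Real.rpow_mul (by positivity), ← Real.rpow_mul (by positivity),
        ← Real.rpow_natCast]
      congr 1
      field_simp
    rw [e1] at h'
    rw [← ENNReal.mul_rpow_of_nonneg _ _ hδ.le, ← ENNReal.ofReal_natCast k.factorial,
      ← ENNReal.ofReal_mul (by positivity), ENNReal.ofReal_rpow_of_nonneg (by positivity) hδ.le,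
      ← ENNReal.ofReal_coe_nnreal, ← ENNReal.ofReal_pow (by positivity)]
    exact ENNReal.ofReal_le_ofReal h'
  refine ⟨∏ _i : ι, ENNReal.ofReal (Real.exp ((K : ℝ) ^ (1 / δ))) ^ δ,
    ENNReal.prod_ne_top fun i _ => ENNReal.rpow_ne_top_of_nonneg hδ.le ENNReal.ofReal_ne_top,
    fun α => ?_⟩
  have : wt δ α = ∏ i, ((α i).factorial : ℝ≥0∞) ^ δ := by
    rw [wt, mfact, Nat.cast_prod, ENNReal.prod_rpow_of_nonneg hδ.le]
  rw [this, ← Finset.prod_mul_distrib, mdeg, ← Finset.prod_pow_eq_pow_sum]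
  exact Finset.prod_le_prod' fun i _ => key _

theorem tsum_half_pow_mdeg_ne_top : ∑' α : ι → ℕ, (2⁻¹ : ℝ≥0∞) ^ mdeg α ≠ ⊤ := by
  classical
  refine ne_top_of_le_ne_top (b := ∏ _i : ι, (2 : ℝ≥0∞)) (ENNReal.prod_ne_top (by simp)) ?_
  rw [ENNReal.tsum_eq_iSup_sum]
  refine iSup_le fun s => ?_
  -- A finite set of multiindices lies in a box, and over a box the sum factors into geometric sums.
  have hs : s ⊆ Fintype.piFinset fun i => Finset.range (s.sup (fun α => α i) + 1) := by
    intro α hα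
    rw [Fintype.mem_piFinset]
    intro i
    rw [Finset.mem_range, Nat.lt_succ_iff]
    exact Finset.le_sup (f := fun α => α i) hα
  refine (Finset.sum_le_sum_of_subset hs).trans ?_
  simp only [mdeg, ← Finset.prod_pow_eq_pow_sum]
  rw [← Finset.prod_univ_sum]
  refine Finset.prod_le_prod' fun i _ => (ENNReal.sum_le_tsum _).trans ?_
  rw [ENNReal.tsum_geometric]
  simp

theorem tsum_pow_mdeg_mul_wt_ne_top (K : ℝ≥0∞) (hK : K ≠ ⊤) {δ : ℝ} (hδ : 0 < δ) :
    ∑' α : ι → ℕ, K ^ mdeg α * wt (-δ) α ≠ ⊤ := by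
  -- Absorbing 2K instead of K leaves a summable factor 2^(-|α|).
  obtain ⟨C, hC, h⟩ := pow_mdeg_le_wt (ι := ι) (2 * K) (ENNReal.mul_ne_top (by simp) hK) hδ
  refine ne_top_of_le_ne_top (ENNReal.mul_ne_top hC (tsum_half_pow_mdeg_ne_top (ι := ι))) ?_
  rw [← ENNReal.tsum_mul_left]
  refine ENNReal.tsum_le_tsum fun α => ?_
  calc K ^ mdeg α * wt (-δ) α
      = (2⁻¹ : ℝ≥0∞) ^ mdeg α * ((2 * K) ^ mdeg α * wt (-δ) α) := by
        rw [mul_pow, ← mul_assoc, ← mul_assoc, ← mul_pow,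
          ENNReal.inv_mul_cancel (by simp) (by simp),
          one_pow, one_mul]
    _ ≤ (2⁻¹ : ℝ≥0∞) ^ mdeg α * (C * wt δ α * wt (-δ) α) := by gcongr; exact h α
    _ = C * 2⁻¹ ^ mdeg α := by rw [mul_assoc C, wt_mul_neg, mul_one, mul_comm]

end Multiindex

variable {n : ℕ}

/-! ### Wirtinger operators -/

/-- The real-linear coordinate functionals `zᵏ` and `z̄ᵏ`. -/
def coord : Fin n ⊕ Fin n → (Fin n → ℂ) →L[ℝ] ℂ :=
  Sum.elim (fun k => ContinuousLinearMap.proj k)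
    (fun k => (Complex.conjCLE : ℂ →L[ℝ] ℂ).comp (ContinuousLinearMap.proj k))

@[simp] theorem coord_inl (k : Fin n) (z : Fin n → ℂ) : coord (Sum.inl k) z = z k := rfl

@[simp] theorem coord_inr (k : Fin n) (z : Fin n → ℂ) :
    coord (Sum.inr k) z = (starRingEnd ℂ) (z k) := rfl

/-- The Wirtinger operators `∂/∂zᵏ` and `∂/∂z̄ᵏ`. -/
def wop : Fin n ⊕ Fin n → ((Fin n → ℂ) → ℂ) → ((Fin n → ℂ) → ℂ) := Sum.elim dz dzbar

/-- The sign distinguishing `∂/∂zᵏ` and `∂/∂z̄ᵏ`. -/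
def wsgn : Fin n ⊕ Fin n → ℂ := Sum.elim (fun _ => -1) (fun _ => 1)

/-- The coordinate direction of a Wirtinger operator. -/
def wdir : Fin n ⊕ Fin n → Fin n := Sum.elim id id

/-- The linear functional of the differential defining a Wirtinger operator. -/
def symb (κ : Fin n ⊕ Fin n) : ((Fin n → ℂ) →L[ℝ] ℂ) →L[ℝ] ℂ :=
  (1 / 2 : ℂ) • (ContinuousLinearMap.apply ℝ ℂ (Pi.single (wdir κ) 1) +
    (wsgn κ * Complex.I) • ContinuousLinearMap.apply ℝ ℂ (Pi.single (wdir κ) Complex.I))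

theorem symb_apply (κ : Fin n ⊕ Fin n) (L : (Fin n → ℂ) →L[ℝ] ℂ) :
    symb κ L = (1 / 2 : ℂ) * (L (Pi.single (wdir κ) 1) +
      wsgn κ * Complex.I * L (Pi.single (wdir κ) Complex.I)) := rfl

theorem wop_eq (κ : Fin n ⊕ Fin n) (f : (Fin n → ℂ) → ℂ) :
    wop κ f = fun z => symb κ (fderiv ℝ f z) := by
  funext z
  rw [symb_apply]
  rcases κ with k | k <;> simp [wop, dz, dzbar, wsgn, wdir, sub_eq_add_neg]

theorem symb_coord (κ κ' : Fin n ⊕ Fin n) :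
    symb κ (coord κ') = if κ' = κ then 1 else 0 := by
  rw [symb_apply]
  rcases κ with k | k <;> rcases κ' with k' | k' <;> by_cases h : k' = k <;>
    simp [wsgn, wdir, h] <;> norm_num

/-- The forms dz^k and dz̄^k are a complex basis of the real-linear maps to ℂ, with dual basis
`symb`; evaluation on the real basis e_k, i e_k verifies this. -/
theorem eq_sum_symb (L : (Fin n → ℂ) →L[ℝ] ℂ) : L = ∑ κ, symb κ L • coord κ := by
  refine ContinuousLinearMap.ext fun v => ?_
  have hv : v = ∑ k, ((v k).re • (Pi.single k 1 : Fin n → ℂ) +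
      (v k).im • (Pi.single k Complex.I : Fin n → ℂ)) := by
    funext j
    simp [Finset.sum_apply, Pi.single_apply]
    rw [Finset.sum_add_distrib]
    simp [Complex.re_add_im]
  conv_lhs => rw [hv]
  simp only [map_sum, map_add, map_smul, Fintype.sum_sum_type, add_apply,
    sum_apply, smul_apply, coord_inl, coord_inr,
    smul_eq_mul, symb_apply, wsgn, wdir, Sum.elim_inl, Sum.elim_inr, id, Complex.real_smul]
  rw [← Finset.sum_add_distrib]
  refine Finset.sum_congr rfl fun k _ => ?_
  have h1 : v k = (v k).re + (v k).im * Complex.I := (Complex.re_add_im _).symm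
  have h2 : (starRingEnd ℂ) (v k) = (v k).re - (v k).im * Complex.I := by
    apply Complex.ext <;> simp
  rw [h2]
  conv_rhs => rw [h1]
  simp only [Complex.add_re, Complex.ofReal_re, Complex.mul_re, Complex.I_re, mul_zero,
    Complex.ofReal_im, Complex.I_im, mul_one, sub_self, add_zero, Complex.add_im, Complex.mul_im,
    zero_add]
  linear_combination (L (Pi.single k Complex.I) * (v k).im) * Complex.I_sq

theorem fderiv_eq_sum_wop (f : (Fin n → ℂ) → ℂ) (z : Fin n → ℂ) :
    fderiv ℝ f z = ∑ κ, wop κ f z • coord κ := by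
  simp only [wop_eq]
  exact eq_sum_symb _

theorem wop_smoothLin (κ : Fin n ⊕ Fin n) : SmoothLin (wop (n := n) κ) := by
  rcases κ with k | k
  · exact ⟨fun _ h => dz_smooth k h, fun _ _ h h' => dz_add k h h', fun a _ h => dz_smul k a h⟩
  · exact ⟨fun _ h => dzbar_smooth k h, fun _ _ h h' => dzbar_add k h h',
      fun a _ h => dzbar_smul k a h⟩

/-- Both sides are the same combination of values of the second real derivative, which is symmetric.
-/
theorem wop_comm (κ κ' : Fin n ⊕ Fin n) {f : (Fin n → ℂ) → ℂ} (hf : ContDiff ℝ ∞ f) :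
    wop κ (wop κ' f) = wop κ' (wop κ f) := by
  funext z
  have hd : DifferentiableAt ℝ (fderiv ℝ f) z :=
    ((hf.fderiv_right (m := ∞) (by simp)).differentiable (by simp)) z
  have hsymm : IsSymmSndFDerivAt ℝ f z :=
    (hf.contDiffAt (x := z)).isSymmSndFDerivAt (by simp; exact WithTop.coe_le_coe.2 le_top)
  have hsymm : ∀ v w, fderiv ℝ (fderiv ℝ f) z v w = fderiv ℝ (fderiv ℝ f) z w v :=
    fun v w => hsymm.eq v w
  have key : ∀ κ κ' : Fin n ⊕ Fin n, wop κ (wop κ' f) z =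
      symb κ ((symb κ').comp (fderiv ℝ (fderiv ℝ f) z)) := fun κ κ' => by
    have h : fderiv ℝ (wop κ' f) z = (symb κ').comp (fderiv ℝ (fderiv ℝ f) z) := by
      rw [wop_eq κ']
      exact ((symb κ').hasFDerivAt.comp z hd.hasFDerivAt).fderiv
    rw [wop_eq κ, ← h]
  rw [key, key]
  generalize fderiv ℝ (fderiv ℝ f) z = B at hsymm
  simp only [symb_apply, ContinuousLinearMap.comp_apply]
  rw [hsymm (Pi.single (wdir κ) 1) (Pi.single (wdir κ') 1),
    hsymm (Pi.single (wdir κ) 1) (Pi.single (wdir κ') Complex.I),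
    hsymm (Pi.single (wdir κ) Complex.I) (Pi.single (wdir κ') 1),
    hsymm (Pi.single (wdir κ) Complex.I) (Pi.single (wdir κ') Complex.I)]
  ring

/-! ### Reordering of iterated commuting operators -/

section Foldr

variable {D : Fin n → ((Fin n → ℂ) → ℂ) → ((Fin n → ℂ) → ℂ)}

theorem iterate_comm_of_smooth {T E : ((Fin n → ℂ) → ℂ) → ((Fin n → ℂ) → ℂ)} (hT : SmoothLin T)
    (h : ∀ f, ContDiff ℝ ∞ f → T (E f) = E (T f)) (r : ℕ) {f : (Fin n → ℂ) → ℂ}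
    (hf : ContDiff ℝ ∞ f) : T^[r] (E f) = E (T^[r] f) := by
  induction r generalizing f with
  | zero => rfl
  | succ r ih => rw [Function.iterate_succ_apply, h f hf, ih (hT.smooth _ hf),
      Function.iterate_succ_apply]

theorem foldr_comm_of_smooth (hD : ∀ k, SmoothLin (D k))
    {E : ((Fin n → ℂ) → ℂ) → ((Fin n → ℂ) → ℂ)}
    (h : ∀ k f, ContDiff ℝ ∞ f → D k (E f) = E (D k f)) (R : MI n) (l : List (Fin n))
    {f : (Fin n → ℂ) → ℂ} (hf : ContDiff ℝ ∞ f) :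
    l.foldr (fun k g => (D k)^[R k] g) (E f) = E (l.foldr (fun k g => (D k)^[R k] g) f) := by
  induction l with
  | nil => rfl
  | cons k l ih =>
    rw [List.foldr_cons, ih, iterate_comm_of_smooth (hD k) (h k), List.foldr_cons]
    exact (SmoothLin.foldr hD R l).smooth _ hf

/-- The additional `D j` is commuted inwards past all operators standing to the right of position j;
`Nodup` ensures that only one position changes. -/
theorem foldr_add_single (hD : ∀ k, SmoothLin (D k))
    (h : ∀ k j f, ContDiff ℝ ∞ f → D k (D j f) = D j (D k f)) (R : MI n) (j : Fin n)
    (l : List (Fin n)) (hl : l.Nodup) (hj : j ∈ l) {f : (Fin n → ℂ) → ℂ} (hf : ContDiff ℝ ∞ f) :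
    l.foldr (fun k g => (D k)^[(R + Pi.single j 1 : MI n) k] g) f =
      l.foldr (fun k g => (D k)^[R k] g) (D j f) := by
  induction l with
  | nil => simp at hj
  | cons k l ih =>
    rw [List.nodup_cons] at hl
    by_cases hk : j = k
    · subst hk
      have e : l.foldr (fun k g => (D k)^[(R + Pi.single j 1 : MI n) k] g) f =
          l.foldr (fun k g => (D k)^[R k] g) f := by
        refine List.foldr_ext _ _ _ fun a ha b => ?_
        have : a ≠ j := fun h => hl.1 (h ▸ ha)
        simp [this]
      rw [List.foldr_cons, List.foldr_cons, e, foldr_comm_of_smooth hD (h · j) R l hf]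
      simp
    · rw [List.foldr_cons, List.foldr_cons,
        ih hl.2 ((List.mem_cons.1 hj).resolve_left hk)]
      simp [Ne.symm hk]

end Foldr

/-- Iterated Wirtinger derivatives, indexed by multiindices over `Fin n ⊕ Fin n`. -/
def wpow (α : Fin n ⊕ Fin n → ℕ) : ((Fin n → ℂ) → ℂ) → ((Fin n → ℂ) → ℂ) :=
  wirt (fun k => α (Sum.inl k)) (fun k => α (Sum.inr k))

theorem wirt_eq_wpow (R S : MI n) : wirt R S = wpow (Sum.elim R S) := rfl

theorem wpow_smoothLin (α : Fin n ⊕ Fin n → ℕ) : SmoothLin (wpow (n := n) α) := wirt_smoothLin _ _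

theorem dzPow_zero (f : (Fin n → ℂ) → ℂ) : dzPow 0 f = f := by
  unfold dzPow
  induction List.finRange n with
  | nil => rfl
  | cons k l ih => simp

theorem dzbarPow_zero (f : (Fin n → ℂ) → ℂ) : dzbarPow 0 f = f := by
  unfold dzbarPow
  induction List.finRange n with
  | nil => rfl
  | cons k l ih => simp

theorem dzPow_eq_wpow (R : MI n) (f : (Fin n → ℂ) → ℂ) : dzPow R f = wpow (Sum.elim R 0) f := by
  rw [← wirt_eq_wpow, wirt, dzbarPow_zero]

theorem dzbarPow_eq_wpow (S : MI n) (f : (Fin n → ℂ) → ℂ) :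
    dzbarPow S f = wpow (Sum.elim 0 S) f := by
  rw [← wirt_eq_wpow, wirt, dzPow_zero]

@[simp] theorem wpow_zero (f : (Fin n → ℂ) → ℂ) : wpow 0 f = f := by
  change dzPow 0 (dzbarPow 0 f) = f
  rw [dzbarPow_zero, dzPow_zero]

/-- The recursion that makes `multiindex_induction` applicable to derivatives. A holomorphic
derivative must additionally be moved through the antiholomorphic block, which is applied first. -/
theorem wpow_add_single (α : Fin n ⊕ Fin n → ℕ) (κ : Fin n ⊕ Fin n) {f : (Fin n → ℂ) → ℂ}
    (hf : ContDiff ℝ ∞ f) : wpow (α + Pi.single κ 1) f = wpow α (wop κ f) := by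
  have hz : ∀ k : Fin n, SmoothLin (dz k) := fun k => wop_smoothLin (Sum.inl k)
  have hzb : ∀ k : Fin n, SmoothLin (dzbar k) := fun k => wop_smoothLin (Sum.inr k)
  rcases κ with j | j
  · have e1 : (fun k => (α + Pi.single (Sum.inl j) 1 : Fin n ⊕ Fin n → ℕ) (Sum.inl k)) =
        (fun k => α (Sum.inl k)) + Pi.single j 1 := by
      funext k
      simp [Pi.single_apply]
    have e2 : (fun k => (α + Pi.single (Sum.inl j) 1 : Fin n ⊕ Fin n → ℕ) (Sum.inr k)) =
        fun k => α (Sum.inr k) := by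
      funext k
      simp
    rw [wpow, wpow, e1, e2, wirt, wirt, dzPow]
    refine (foldr_add_single hz
      (fun k i g hg => wop_comm (Sum.inl k) (Sum.inl i) hg) _ _ _ (List.nodup_finRange n)
      (List.mem_finRange j) ((SmoothLin.foldr hzb _ _).smooth _ hf)).trans ?_
    refine congrArg (dzPow _) ?_
    exact (foldr_comm_of_smooth hzb (E := dz j)
      (fun k g hg => wop_comm (Sum.inr k) (Sum.inl j) hg) _ _ hf).symm
  · have e1 : (fun k => (α + Pi.single (Sum.inr j) 1 : Fin n ⊕ Fin n → ℕ) (Sum.inr k)) =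
        (fun k => α (Sum.inr k)) + Pi.single j 1 := by
      funext k
      simp [Pi.single_apply]
    have e2 : (fun k => (α + Pi.single (Sum.inr j) 1 : Fin n ⊕ Fin n → ℕ) (Sum.inl k)) =
        fun k => α (Sum.inl k) := by
      funext k
      simp
    rw [wpow, wpow, e1, e2, wirt, wirt, dzbarPow, foldr_add_single hzb
      (fun k i g hg => wop_comm (Sum.inr k) (Sum.inr i) hg) _ _ _ (List.nodup_finRange n)
      (List.mem_finRange j) hf]
    rfl

theorem wop_conj (κ : Fin n ⊕ Fin n) {f : (Fin n → ℂ) → ℂ} (hf : ContDiff ℝ ∞ f) :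
    wop κ (fun z => (starRingEnd ℂ) (f z)) = fun z => (starRingEnd ℂ) (wop κ.swap f z) := by
  funext z
  have h : fderiv ℝ (fun z => (starRingEnd ℂ) (f z)) z =
      (Complex.conjCLE : ℂ →L[ℝ] ℂ).comp (fderiv ℝ f z) :=
    ((Complex.conjCLE : ℂ →L[ℝ] ℂ).hasFDerivAt.comp z
      (hf.differentiable (by simp) z).hasFDerivAt).fderiv
  simp only [wop_eq]
  rw [h]
  rcases κ with k | k <;> simp [symb_apply, wsgn, wdir] <;> left <;>
    exact (map_ofNat (starRingEnd ℂ) 2).symm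

theorem smooth_conj {f : (Fin n → ℂ) → ℂ} (hf : ContDiff ℝ ∞ f) :
    ContDiff ℝ ∞ (fun z => (starRingEnd ℂ) (f z)) :=
  (Complex.conjCLE : ℂ →L[ℝ] ℂ).contDiff.comp hf

theorem wpow_conj (α : Fin n ⊕ Fin n → ℕ) {f : (Fin n → ℂ) → ℂ} (hf : ContDiff ℝ ∞ f) :
    wpow α (fun z => (starRingEnd ℂ) (f z)) =
      fun z => (starRingEnd ℂ) (wpow (α ∘ Sum.swap) f z) := by
  induction α using multiindex_induction generalizing f with
  | zero =>
    have : (0 : Fin n ⊕ Fin n → ℕ) ∘ Sum.swap = 0 := rfl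
    simp [this]
  | add_single α κ ih =>
    have e : (α + Pi.single κ 1) ∘ Sum.swap = α ∘ Sum.swap + Pi.single κ.swap 1 := by
      funext i
      have : (i.swap = κ) ↔ (i = κ.swap) := by
        constructor
        · rintro rfl; simp
        · rintro rfl; simp
      simp [Pi.single_apply, this]
    rw [wpow_add_single α κ (smooth_conj hf), wop_conj κ hf,
      ih ((wop_smoothLin _).smooth _ hf), e, wpow_add_single _ _ hf]

/-! ### Infinite jets -/

/-- A Wirtinger derivative is a fixed continuous linear map applied to the differential, so its k-th
derivative is controlled by the derivative of order k + 1 of the function. -/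
theorem wop_iteratedFDeriv_eq_zero (κ : Fin n ⊕ Fin n) {f : (Fin n → ℂ) → ℂ}
    (hf : ContDiff ℝ ∞ f) {p : Fin n → ℂ} (h : ∀ k : ℕ, iteratedFDeriv ℝ k f p = 0) (k : ℕ) :
    iteratedFDeriv ℝ k (wop κ f) p = 0 := by
  have hd : ContDiffAt ℝ ∞ (fderiv ℝ f) p := (hf.fderiv_right (m := ∞) (by simp)).contDiffAt
  rw [wop_eq]
  have h1 := (symb κ).norm_iteratedFDeriv_comp_left (f := fderiv ℝ f) (x := p) (n := k) hd
    (by exact_mod_cast le_top)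
  rw [norm_iteratedFDeriv_fderiv, h, norm_zero, mul_zero] at h1
  exact norm_le_zero_iff.1 h1

theorem wpow_eq_zero_of_iteratedFDeriv {f : (Fin n → ℂ) → ℂ} (hf : ContDiff ℝ ∞ f)
    {p : Fin n → ℂ} (h : ∀ k : ℕ, iteratedFDeriv ℝ k f p = 0) (α : Fin n ⊕ Fin n → ℕ) :
    wpow α f p = 0 := by
  induction α using multiindex_induction generalizing f with
  | zero => simpa using congrArg (fun L => L 0) (h 0)
  | add_single α κ ih =>
    rw [wpow_add_single _ _ hf]
    exact ih ((wop_smoothLin κ).smooth _ hf) (wop_iteratedFDeriv_eq_zero κ hf h)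

/-- Induction on the order through `fderiv_eq_sum_wop`: the differential is a combination of
constant forms with Wirtinger derivatives as coefficients. -/
theorem iteratedFDeriv_eq_zero_of_wpow {f : (Fin n → ℂ) → ℂ} (hf : ContDiff ℝ ∞ f)
    {p : Fin n → ℂ} (h : ∀ α, wpow α f p = 0) (k : ℕ) : iteratedFDeriv ℝ k f p = 0 := by
  induction k generalizing f with
  | zero =>
    have := h 0
    rw [wpow_zero] at this
    ext v
    simpa using this
  | succ k ih =>
    rw [← norm_eq_zero, ← norm_iteratedFDeriv_fderiv, norm_eq_zero]
    have e : fderiv ℝ f = fun z => ∑ κ, wop κ f z • coord κ := funext (fderiv_eq_sum_wop f)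
    rw [e, iteratedFDeriv_fun_sum_apply]
    · refine Finset.sum_eq_zero fun κ _ => ?_
      have hs := (wop_smoothLin κ).smooth _ hf
      have h1 := ((ContinuousLinearMap.toSpanSingleton ℂ (coord κ)).restrictScalars ℝ)
        |>.norm_iteratedFDeriv_comp_left (f := wop κ f) (x := p) (n := k) hs.contDiffAt
        (by exact_mod_cast le_top)
      rw [ih hs fun α => by rw [← wpow_add_single _ _ hf]; exact h _, norm_zero, mul_zero] at h1
      exact norm_le_zero_iff.1 h1
    · intro κ _
      exact (((wop_smoothLin κ).smooth _ hf).contDiffAt.smul contDiffAt_const).of_le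
        (by exact_mod_cast le_top)

/-! ### Entire power series in `z` and `z̄` -/

theorem norm_coord_le (κ : Fin n ⊕ Fin n) (v : Fin n → ℂ) : ‖coord κ v‖ ≤ ‖v‖ := by
  rcases κ with k | k
  · exact norm_le_pi_norm v k
  · simpa using norm_le_pi_norm v k

theorem opNorm_coord_le (κ : Fin n ⊕ Fin n) : ‖(coord κ : (Fin n → ℂ) →L[ℝ] ℂ)‖ ≤ 1 :=
  ContinuousLinearMap.opNorm_le_bound _ zero_le_one fun v => by simpa using norm_coord_le κ v

/-- The monomial `z^R z̄^S`. -/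
def mono (α : Fin n ⊕ Fin n → ℕ) (z : Fin n → ℂ) : ℂ := ∏ κ, coord κ z ^ α κ

theorem norm_mono_le (α : Fin n ⊕ Fin n → ℕ) (z : Fin n → ℂ) : ‖mono α z‖ ≤ ‖z‖ ^ mdeg α := by
  rw [mono, norm_prod, mdeg, ← Finset.prod_pow_eq_pow_sum]
  refine Finset.prod_le_prod (fun _ _ => norm_nonneg _) fun κ _ => ?_
  rw [norm_pow]
  gcongr
  exact norm_coord_le κ z

theorem mono_add (α β : Fin n ⊕ Fin n → ℕ) (z : Fin n → ℂ) :
    mono (α + β) z = mono α z * mono β z := by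
  simp [mono, pow_add, Finset.prod_mul_distrib]

@[simp] theorem mono_zero_index (z : Fin n → ℂ) : mono 0 z = 1 := by simp [mono]

theorem mono_zero {α : Fin n ⊕ Fin n → ℕ} (hα : α ≠ 0) : mono α (0 : Fin n → ℂ) = 0 := by
  obtain ⟨κ, hκ⟩ := Function.ne_iff.1 hα
  exact Finset.prod_eq_zero (Finset.mem_univ κ) (by rw [map_zero, zero_pow hκ])

/-- The multilinear form of degree `k` underlying a monomial; zero unless `k` is its degree. -/
def monoForm (α : Fin n ⊕ Fin n → ℕ) : FormalMultilinearSeries ℝ (Fin n → ℂ) ℂ := fun k =>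
  if h : Fintype.card (Σ κ, Fin (α κ)) = k then
    ((ContinuousMultilinearMap.mkPiAlgebra ℝ (Σ κ, Fin (α κ)) ℂ).compContinuousLinearMap
      fun i => coord i.1).domDomCongr (Fintype.equivFinOfCardEq h)
  else 0

theorem card_sigma_eq_mdeg (α : Fin n ⊕ Fin n → ℕ) :
    Fintype.card (Σ κ, Fin (α κ)) = mdeg α := by
  simp [mdeg, Fintype.card_sigma]

theorem monoForm_apply (α : Fin n ⊕ Fin n → ℕ) (k : ℕ) (v : Fin n → ℂ) :
    monoForm α k (fun _ => v) = if k = mdeg α then mono α v else 0 := by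
  unfold monoForm
  rw [← card_sigma_eq_mdeg]
  by_cases h : Fintype.card (Σ κ, Fin (α κ)) = k
  · rw [dif_pos h, if_pos h.symm]
    simp [mono, Fintype.prod_sigma]
  · rw [dif_neg h, if_neg (Ne.symm h)]
    rfl

theorem norm_monoForm_le (α : Fin n ⊕ Fin n → ℕ) (k : ℕ) :
    ‖monoForm α k‖ ≤ if k = mdeg α then 1 else 0 := by
  unfold monoForm
  rw [← card_sigma_eq_mdeg]
  by_cases h : Fintype.card (Σ κ, Fin (α κ)) = k
  · rw [dif_pos h, if_pos h.symm]
    refine ContinuousMultilinearMap.opNorm_le_bound zero_le_one fun m => ?_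
    rw [one_mul, ← (Fintype.equivFinOfCardEq h).prod_comp]
    simp only [ContinuousMultilinearMap.domDomCongr_apply,
      ContinuousMultilinearMap.compContinuousLinearMap_apply,
      ContinuousMultilinearMap.mkPiAlgebra_apply, norm_prod]
    exact Finset.prod_le_prod (fun _ _ => norm_nonneg _) fun i _ => norm_coord_le _ _
  · rw [dif_neg h, if_neg (Ne.symm h), norm_zero]

/-- The array `b` of derivatives defines an everywhere absolutely convergent Taylor series. -/
def Ent (b : (Fin n ⊕ Fin n → ℕ) → ℂ) : Prop :=
  ∀ r : ℝ, 0 ≤ r → Summable fun α => ‖b α‖ / mfact α * r ^ mdeg α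

/-- The function with the array `b` of Wirtinger derivatives at `p`. -/
def pser (p : Fin n → ℂ) (b : (Fin n ⊕ Fin n → ℕ) → ℂ) (z : Fin n → ℂ) : ℂ :=
  ∑' α, b α / mfact α * mono α (z - p)

theorem Ent.summable_norm {b : (Fin n ⊕ Fin n → ℕ) → ℂ} (hb : Ent b) (v : Fin n → ℂ) :
    Summable fun α => ‖b α / mfact α * mono α v‖ := by
  refine (hb ‖v‖ (norm_nonneg v)).of_nonneg_of_le (fun _ => norm_nonneg _) fun α => ?_
  rw [norm_mul, norm_div, Complex.norm_natCast]
  gcongr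
  exact norm_mono_le α v

theorem Ent.hasSum {b : (Fin n ⊕ Fin n → ℕ) → ℂ} (hb : Ent b) (p z : Fin n → ℂ) :
    HasSum (fun α => b α / mfact α * mono α (z - p)) (pser p b z) :=
  (hb.summable_norm (z - p)).of_norm.hasSum

@[simp] theorem pser_self (p : Fin n → ℂ) (b : (Fin n ⊕ Fin n → ℕ) → ℂ) : pser p b p = b 0 := by
  rw [pser, tsum_eq_single 0 fun α hα => by rw [sub_self, mono_zero hα, mul_zero]]
  simp

/-- The multiindex series is written as a double series supported on k = |α|, so that grouping by
degree becomes an interchange of sums. -/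
theorem summable_prod_single_degree {b : (Fin n ⊕ Fin n → ℕ) → ℂ} (hb : Ent b) {r : ℝ}
    (hr : 0 ≤ r) : Summable fun x : (Fin n ⊕ Fin n → ℕ) × ℕ =>
      ‖b x.1‖ / mfact x.1 * ((if x.2 = mdeg x.1 then 1 else 0) * r ^ x.2) := by
  have e : ∀ α : Fin n ⊕ Fin n → ℕ, HasSum (fun k : ℕ => ‖b α‖ / mfact α *
      ((if k = mdeg α then 1 else 0) * r ^ k)) (‖b α‖ / mfact α * r ^ mdeg α) := fun α => by
    have := hasSum_single (f := fun k : ℕ => ‖b α‖ / mfact α *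
      ((if k = mdeg α then 1 else 0) * r ^ k)) (mdeg α) fun k hk => by simp [hk]
    simpa using this
  refine (summable_prod_of_nonneg fun x => ?_).2 ⟨fun α => (e α).summable, ?_⟩
  · have : (0 : ℝ) ≤ if x.2 = mdeg x.1 then 1 else 0 := by split_ifs <;> norm_num
    exact mul_nonneg (by positivity) (mul_nonneg this (by positivity))
  · simpa only [(e _).tsum_eq] using hb r hr

/-- The Taylor series belonging to an array of Wirtinger derivatives. -/
def taylorForm (b : (Fin n ⊕ Fin n → ℕ) → ℂ) : FormalMultilinearSeries ℝ (Fin n → ℂ) ℂ := fun k =>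
  ∑' α, (b α / mfact α) • monoForm α k

theorem norm_smul_monoForm_le (b : (Fin n ⊕ Fin n → ℕ) → ℂ) (α : Fin n ⊕ Fin n → ℕ) (k : ℕ) :
    ‖(b α / mfact α) • monoForm α k‖ ≤ ‖b α‖ / mfact α * (if k = mdeg α then 1 else 0) := by
  rw [norm_smul, norm_div, Complex.norm_natCast]
  gcongr
  exact norm_monoForm_le α k

theorem Ent.summable_norm_smul_monoForm {b : (Fin n ⊕ Fin n → ℕ) → ℂ} (hb : Ent b) (k : ℕ) :
    Summable fun α => ‖(b α / mfact α) • monoForm α k‖ := by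
  refine (hb 1 zero_le_one).of_nonneg_of_le (fun _ => norm_nonneg _) fun α =>
    (norm_smul_monoForm_le b α k).trans ?_
  rw [one_pow]
  gcongr
  split_ifs <;> norm_num

theorem Ent.radius_taylorForm {b : (Fin n ⊕ Fin n → ℕ) → ℂ} (hb : Ent b) :
    (taylorForm b).radius = ⊤ := by
  refine (FormalMultilinearSeries.radius_eq_top_of_summable_norm _ fun r => ?_)
  have h := (summable_prod_single_degree hb r.2).prod_symm.prod
  refine h.of_nonneg_of_le (fun k => by positivity) fun k => ?_
  simp only [Prod.fst_swap, Prod.snd_swap, ← mul_assoc]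
  rw [tsum_mul_right]
  refine mul_le_mul_of_nonneg_right ?_ (by positivity)
  refine (norm_tsum_le_tsum_norm (hb.summable_norm_smul_monoForm k)).trans ?_
  refine (hb.summable_norm_smul_monoForm k).tsum_le_tsum (norm_smul_monoForm_le b · k) ?_
  refine (hb 1 zero_le_one).of_nonneg_of_le (fun α => ?_) fun α => ?_
  · exact mul_nonneg (by positivity) (by split_ifs <;> norm_num)
  · rw [one_pow]
    gcongr
    split_ifs <;> norm_num

theorem Ent.taylorForm_apply {b : (Fin n ⊕ Fin n → ℕ) → ℂ} (hb : Ent b) (k : ℕ) (y : Fin n → ℂ) :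
    HasSum (fun α => b α / mfact α * if k = mdeg α then mono α y else 0)
      (taylorForm b k fun _ => y) := by
  have h := ContinuousMultilinearMap.hasSum_eval
    (hb.summable_norm_smul_monoForm k).of_norm.hasSum (fun _ => y)
  have e : ∀ α, ((b α / mfact α) • monoForm α k) (fun _ => y) =
      b α / mfact α * if k = mdeg α then mono α y else 0 := fun α => by
    rw [← monoForm_apply]
    rfl
  simp only [e] at h
  exact h

/-- One absolutely convergent double series over (α, k), summed first over k and then first over α.
-/
theorem Ent.hasSum_taylorForm {b : (Fin n ⊕ Fin n → ℕ) → ℂ} (hb : Ent b) (p y : Fin n → ℂ) :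
    HasSum (fun k : ℕ => taylorForm b k fun _ => y) (pser p b (p + y)) := by
  have hs : Summable fun x : (Fin n ⊕ Fin n → ℕ) × ℕ =>
      b x.1 / mfact x.1 * if x.2 = mdeg x.1 then mono x.1 y else 0 := by
    refine Summable.of_norm ((summable_prod_single_degree hb
      (norm_nonneg y)).of_nonneg_of_le (fun _ => norm_nonneg _) fun x => ?_)
    rw [norm_mul, norm_div, Complex.norm_natCast]
    refine mul_le_mul_of_nonneg_left ?_ (by positivity)
    split_ifs with h
    · rw [one_mul, h]
      exact norm_mono_le _ _
    · simp
  have h1 : HasSum (fun α => b α / mfact α * mono α y) (∑' x : (Fin n ⊕ Fin n → ℕ) × ℕ,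
      b x.1 / mfact x.1 * if x.2 = mdeg x.1 then mono x.1 y else 0) := by
    refine hs.hasSum.prod_fiberwise fun α => ?_
    have := hasSum_single (f := fun k : ℕ => b α / mfact α * if k = mdeg α then mono α y else 0)
      (mdeg α) fun k hk => by simp [hk]
    simpa using this
  have h2 := hb.hasSum p (p + y)
  rw [add_sub_cancel_left] at h2
  rw [h2.unique h1]
  exact ((Equiv.prodComm _ _).hasSum_iff.2 hs.hasSum).prod_fiberwise
    fun k => hb.taylorForm_apply k y

theorem Ent.hasFPowerSeriesOnBall {b : (Fin n ⊕ Fin n → ℕ) → ℂ} (hb : Ent b) (p : Fin n → ℂ) :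
    HasFPowerSeriesOnBall (pser p b) (taylorForm b) p ⊤ where
  r_le := hb.radius_taylorForm.ge
  r_pos := by simp
  hasSum {y} _ := hb.hasSum_taylorForm p y

theorem Ent.analyticOnNhd {b : (Fin n ⊕ Fin n → ℕ) → ℂ} (hb : Ent b) (p : Fin n → ℂ) :
    AnalyticOnNhd ℝ (pser p b) Set.univ := by
  have := (hb.hasFPowerSeriesOnBall p).analyticOnNhd
  rwa [Metric.eball_top] at this

theorem smooth_of_analytic {f : (Fin n → ℂ) → ℂ} (hf : AnalyticOnNhd ℝ f Set.univ) :
    ContDiff ℝ ∞ f := hf.contDiff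

theorem Ent.smooth {b : (Fin n ⊕ Fin n → ℕ) → ℂ} (hb : Ent b) (p : Fin n → ℂ) :
    ContDiff ℝ ∞ (pser p b) := smooth_of_analytic (hb.analyticOnNhd p)

/-! ### Term by term differentiation -/

theorem hasFDerivAt_mono (α : Fin n ⊕ Fin n → ℕ) (z : Fin n → ℂ) :
    HasFDerivAt (mono α) (∑ κ, ((α κ : ℂ) * mono (α - Pi.single κ 1) z) • coord κ) z := by
  have h := HasFDerivAt.finsetProd (u := Finset.univ) (x := z)
    (g := fun κ (z : Fin n → ℂ) => coord κ z ^ α κ)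
    fun κ _ => ((coord κ : (Fin n → ℂ) →L[ℝ] ℂ).hasFDerivAt (x := z)).pow (α κ)
  refine h.congr_fderiv ?_
  refine Finset.sum_congr rfl fun κ _ => ?_
  have e : mono (α - Pi.single κ 1) z =
      (∏ i ∈ Finset.univ.erase κ, coord i z ^ α i) * coord κ z ^ (α κ - 1) := by
    rw [mono, ← Finset.prod_erase_mul _ _ (Finset.mem_univ κ)]
    congr 1
    · refine Finset.prod_congr rfl fun i hi => ?_
      simp [(Finset.mem_erase.1 hi).1]
    · simp
  rw [e, smul_smul]
  simp only [nsmul_eq_mul]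
  congr 1
  ring

/-- The factors α_κ add up to |α| ≤ 2^|α|, and r ≥ 1 lets the loss of one degree be ignored. -/
theorem norm_fderiv_mono_le (α : Fin n ⊕ Fin n → ℕ) {z : Fin n → ℂ} {r : ℝ} (hr : 1 ≤ r)
    (hz : ‖z‖ ≤ r) :
    ‖∑ κ, ((α κ : ℂ) * mono (α - Pi.single κ 1) z) • (coord κ : (Fin n → ℂ) →L[ℝ] ℂ)‖ ≤
      (2 * r) ^ mdeg α := by
  have h : ∀ κ ∈ Finset.univ, ‖((α κ : ℂ) * mono (α - Pi.single κ 1) z) •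
      (coord κ : (Fin n → ℂ) →L[ℝ] ℂ)‖ ≤ α κ * r ^ mdeg α := fun κ _ => by
    rw [norm_smul, norm_mul, Complex.norm_natCast, ← mul_one (α κ * r ^ mdeg α : ℝ)]
    gcongr
    · refine (norm_mono_le _ _).trans ((pow_le_pow_left₀ (norm_nonneg _) hz _).trans ?_)
      exact pow_le_pow_right₀ hr (Finset.sum_le_sum fun i _ => Nat.sub_le _ _)
    · exact opNorm_coord_le κ
  refine (norm_sum_le_of_le _ h).trans ?_
  rw [← Finset.sum_mul, mul_pow, ← Nat.cast_sum]
  gcongr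
  exact_mod_cast (Nat.lt_two_pow_self (n := mdeg α)).le

/-- The shifted array, belonging to a derivative. -/
def shift (β : Fin n ⊕ Fin n → ℕ) (b : (Fin n ⊕ Fin n → ℕ) → ℂ) : (Fin n ⊕ Fin n → ℕ) → ℂ :=
  fun α => b (α + β)

theorem mfact_add_single (α : Fin n ⊕ Fin n → ℕ) (κ : Fin n ⊕ Fin n) :
    mfact (α + Pi.single κ 1) = (α κ + 1) * mfact α := by
  rw [mfact, mfact, ← Finset.mul_prod_erase _ _ (Finset.mem_univ κ),
    ← Finset.mul_prod_erase _ (fun i => (α i).factorial) (Finset.mem_univ κ), ← mul_assoc]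
  congr 1
  · simp [Nat.factorial_succ]
  · refine Finset.prod_congr rfl fun i hi => ?_
    simp [(Finset.mem_erase.1 hi).1]

theorem mdeg_add_single (α : Fin n ⊕ Fin n → ℕ) (κ : Fin n ⊕ Fin n) :
    mdeg (α + Pi.single κ 1) = mdeg α + 1 := by
  rw [mdeg_add]
  simp [mdeg]

theorem le_mdeg (α : Fin n ⊕ Fin n → ℕ) (κ : Fin n ⊕ Fin n) : α κ ≤ mdeg α :=
  Finset.single_le_sum (f := α) (fun _ _ => Nat.zero_le _) (Finset.mem_univ κ)

theorem Ent.shift_single {b : (Fin n ⊕ Fin n → ℕ) → ℂ} (hb : Ent b) (κ : Fin n ⊕ Fin n) :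
    Ent (shift (Pi.single κ 1) b) := by
  intro r hr
  -- The 2 in the radius absorbs the factor α_κ + 1 coming from the factorial, and r + 1 ≥ 1 absorbs
  -- the raised degree.
  have h := (hb (2 * (r + 1)) (by positivity)).comp_injective
    (add_left_injective (Pi.single κ 1 : Fin n ⊕ Fin n → ℕ))
  refine h.of_nonneg_of_le (fun α => by positivity) fun α => ?_
  have e : ‖b (α + Pi.single κ 1)‖ / mfact α =
      ‖b (α + Pi.single κ 1)‖ / mfact (α + Pi.single κ 1) * (α κ + 1 : ℕ) := by
    rw [mfact_add_single]
    have := mfact_ne_zero α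
    push_cast
    field_simp
  simp only [shift, Function.comp_apply]
  rw [e, mul_assoc]
  gcongr
  rw [mdeg_add_single, mul_pow]
  gcongr
  · have : α κ + 1 < 2 ^ (mdeg α + 1) :=
      (Nat.succ_le_succ (le_mdeg α κ)).trans_lt Nat.lt_two_pow_self
    exact_mod_cast this.le
  · calc r ^ mdeg α ≤ (r + 1) ^ mdeg α := by gcongr; linarith
      _ ≤ (r + 1) ^ (mdeg α + 1) := pow_le_pow_right₀ (by linarith) (Nat.le_succ _)

theorem Ent.shift {b : (Fin n ⊕ Fin n → ℕ) → ℂ} (hb : Ent b) (β : Fin n ⊕ Fin n → ℕ) :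
    Ent (shift β b) := by
  induction β using multiindex_induction generalizing b with
  | zero => exact hb
  | add_single β κ ih =>
    have : Wick.shift (β + Pi.single κ 1) b = Wick.shift β (Wick.shift (Pi.single κ 1) b) := by
      funext α
      simp [Wick.shift, add_assoc]
    rw [this]
    exact ih (hb.shift_single κ)

/-- Differentiation under the sum on a ball about `p` containing z, with the majorant that `Ent`
supplies at radius 2r. -/
theorem Ent.wop_pser {b : (Fin n ⊕ Fin n → ℕ) → ℂ} (hb : Ent b) (p : Fin n → ℂ)
    (κ : Fin n ⊕ Fin n) : wop κ (pser p b) = pser p (Wick.shift (Pi.single κ 1) b) := by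
  funext z
  set r : ℝ := ‖z - p‖ + 1 with hr
  have hr1 : 1 ≤ r := by simp [hr]
  let c : (Fin n ⊕ Fin n → ℕ) → ℂ := fun α => b α / mfact α
  let g : (Fin n ⊕ Fin n → ℕ) → (Fin n → ℂ) → ((Fin n → ℂ) →L[ℝ] ℂ) := fun α w =>
    c α • ∑ i, ((α i : ℂ) * mono (α - Pi.single i 1) (w - p)) • coord i
  have hg : ∀ α, ∀ w ∈ Metric.ball p r, ‖g α w‖ ≤ ‖b α‖ / mfact α * (2 * r) ^ mdeg α := by
    intro α w hw
    rw [norm_smul, norm_div, Complex.norm_natCast]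
    gcongr
    exact norm_fderiv_mono_le α hr1 (by rw [← dist_eq_norm]; exact (Metric.mem_ball.1 hw).le)
  have hz : z ∈ Metric.ball p r := by
    rw [Metric.mem_ball, dist_eq_norm, hr]
    linarith
  have hsum := hb (2 * r) (by positivity)
  have hd : HasFDerivAt (pser p b) (∑' α, g α z) z := by
    refine hasFDerivAt_tsum_of_isPreconnected hsum Metric.isOpen_ball
      (convex_ball p r).isPreconnected (fun α w _ => ?_) hg hz (hb.summable_norm (z - p)).of_norm hz
    have := (hasFDerivAt_mono α (w - p)).comp w ((hasFDerivAt_id w).sub_const p)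
    exact this.const_mul (c α)
  have hgs : Summable fun α => g α z :=
    Summable.of_norm (hsum.of_nonneg_of_le (fun _ => norm_nonneg _) fun α => hg α z hz)
  rw [wop_eq]
  change symb κ (fderiv ℝ (pser p b) z) = _
  rw [hd.fderiv, (symb κ).map_tsum hgs]
  have e : ∀ α, symb κ (g α z) = c α * (α κ * mono (α - Pi.single κ 1) (z - p)) := by
    intro α
    have hsm : ∀ (a : ℂ) (L : (Fin n → ℂ) →L[ℝ] ℂ), symb κ (a • L) = a * symb κ L := by
      intro a L
      simp only [symb_apply, smul_apply, smul_eq_mul]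
      ring
    simp only [g, hsm, map_sum, symb_coord, mul_ite, mul_one, mul_zero, Finset.sum_ite_eq',
      Finset.mem_univ, if_true]
  simp only [e]
  -- Terms with α_κ = 0 vanish, so the sum may be reindexed by α + e_κ; the factor α_κ + 1 then
  -- cancels against the factorial.
  rw [pser, ← (add_left_injective (Pi.single κ 1 : Fin n ⊕ Fin n → ℕ)).tsum_eq]
  · refine tsum_congr fun α => ?_
    have h1 : (mfact α : ℂ) ≠ 0 := by exact_mod_cast mfact_ne_zero α
    have h2 : ((α κ : ℂ) + 1) ≠ 0 := by exact_mod_cast Nat.succ_ne_zero (α κ)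
    simp only [c, mfact_add_single, Wick.shift, Pi.add_apply, Pi.single_eq_same, Nat.cast_add,
      Nat.cast_one, Nat.cast_mul, add_tsub_cancel_right]
    field_simp
  · intro α hα
    have hne : α κ ≠ 0 := by
      rintro h0
      simp [h0] at hα
    refine ⟨α - Pi.single κ 1, ?_⟩
    funext i
    by_cases hi : i = κ
    · subst hi
      simp
      omega
    · simp [hi]

theorem Ent.wpow_pser {b : (Fin n ⊕ Fin n → ℕ) → ℂ} (hb : Ent b) (p : Fin n → ℂ)
    (β : Fin n ⊕ Fin n → ℕ) : wpow β (pser p b) = pser p (Wick.shift β b) := by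
  induction β using multiindex_induction generalizing b with
  | zero =>
    rw [wpow_zero]
    rfl
  | add_single β κ ih =>
    rw [wpow_add_single _ _ (hb.smooth p), hb.wop_pser, ih (hb.shift_single κ)]
    congr 1
    funext α
    simp [Wick.shift, add_assoc]

theorem Ent.wpow_pser_self {b : (Fin n ⊕ Fin n → ℕ) → ℂ} (hb : Ent b) (p : Fin n → ℂ)
    (β : Fin n ⊕ Fin n → ℕ) : wpow β (pser p b) p = b β := by
  rw [hb.wpow_pser, pser_self, Wick.shift, zero_add]

/-! ### Uniqueness of real-analytic functions with a given jet -/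

/-- All Taylor coefficients at `p` vanish, hence the function vanishes near `p`, and the identity
theorem on ℂⁿ does the rest. -/
theorem analytic_eq_zero_of_wpow {f : (Fin n → ℂ) → ℂ} (hf : AnalyticOnNhd ℝ f Set.univ)
    {p : Fin n → ℂ} (h : ∀ α, wpow α f p = 0) : f = 0 := by
  obtain ⟨P, r, hP⟩ := hf p (Set.mem_univ p)
  refine hf.eq_of_eventuallyEq (z₀ := p) analyticOnNhd_const ?_
  refine Filter.eventually_of_mem (Metric.eball_mem_nhds p hP.r_pos) fun y hy => ?_
  have hy' : y - p ∈ Metric.eball (0 : Fin n → ℂ) r := by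
    simpa [edist_eq_enorm_sub] using hy
  have hs := hP.hasSum hy'
  have h0 : ∀ k : ℕ, P k (fun _ => y - p) = 0 := by
    intro k
    have := hP.factorial_smul (y - p) k
    rw [iteratedFDeriv_eq_zero_of_wpow (smooth_of_analytic hf) h k] at this
    simpa [Nat.factorial_ne_zero] using this
  simp only [h0, add_sub_cancel] at hs
  exact hs.unique hasSum_zero

theorem analytic_ext_wpow {f g : (Fin n → ℂ) → ℂ} (hf : AnalyticOnNhd ℝ f Set.univ)
    (hg : AnalyticOnNhd ℝ g Set.univ) {p : Fin n → ℂ} (h : ∀ α, wpow α f p = wpow α g p) :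
    f = g := by
  refine sub_eq_zero.1 (analytic_eq_zero_of_wpow (hf.sub hg) (p := p) fun α => ?_)
  have e : f - g = f + (-1 : ℂ) • g := by simp [sub_eq_add_neg]
  have hfs := smooth_of_analytic hf
  have hgs := smooth_of_analytic hg
  rw [e, (wpow_smoothLin α).add f ((-1 : ℂ) • g) hfs (hgs.const_smul (-1 : ℂ)),
    (wpow_smoothLin α).smul _ _ hgs]
  simp [h α]

theorem analytic_eq_pser {f : (Fin n → ℂ) → ℂ} (hf : AnalyticOnNhd ℝ f Set.univ)
    (p : Fin n → ℂ) (hb : Ent fun α => wpow α f p) : f = pser p fun α => wpow α f p :=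
  analytic_ext_wpow hf (hb.analyticOnNhd p) (p := p) fun α => (hb.wpow_pser_self p α).symm

/-! ### Weighted supremum norms of arrays -/

section ArrayNorm

open scoped ENNReal

section General

variable {ι : Type*} [Fintype ι]

/-- The supremum norm of an array with respect to the weight `(α!)^ε`. -/
def aq (ε : ℝ) (b : (ι → ℕ) → ℂ) : ℝ≥0∞ := ⨆ α, ‖b α‖ₑ * wt (-ε) α

theorem enorm_le_aq (ε : ℝ) (b : (ι → ℕ) → ℂ) (α : ι → ℕ) : ‖b α‖ₑ ≤ aq ε b * wt ε α :=
  calc ‖b α‖ₑ = ‖b α‖ₑ * wt (-ε) α * wt ε α := by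
        rw [mul_assoc, mul_comm (wt (-ε) α), wt_mul_neg, mul_one]
    _ ≤ aq ε b * wt ε α := by
        gcongr
        exact le_iSup (fun α => ‖b α‖ₑ * wt (-ε) α) α

theorem aq_le {ε : ℝ} {b : (ι → ℕ) → ℂ} {Q : ℝ≥0∞} (h : ∀ α, ‖b α‖ₑ ≤ Q * wt ε α) :
    aq ε b ≤ Q :=
  iSup_le fun α => calc ‖b α‖ₑ * wt (-ε) α ≤ Q * wt ε α * wt (-ε) α := by gcongr; exact h α
    _ = Q := by rw [mul_assoc, wt_mul_neg, mul_one]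

theorem aq_anti {ε δ : ℝ} (h : ε ≤ δ) (b : (ι → ℕ) → ℂ) : aq δ b ≤ aq ε b :=
  aq_le fun α => (enorm_le_aq ε b α).trans (by gcongr; exact wt_mono_exp h α)

theorem aq_add_le (ε : ℝ) (b c : (ι → ℕ) → ℂ) : aq ε (b + c) ≤ aq ε b + aq ε c :=
  aq_le fun α => (enorm_add_le _ _).trans
    ((add_le_add (enorm_le_aq ε b α) (enorm_le_aq ε c α)).trans_eq (add_mul _ _ _).symm)

theorem aq_smul (ε : ℝ) (a : ℂ) (b : (ι → ℕ) → ℂ) : aq ε (a • b) = ‖a‖ₑ * aq ε b := by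
  simp only [aq, Pi.smul_apply, enorm_smul, mul_assoc, ENNReal.mul_iSup]

theorem wt_sumElim {κ : Type*} [Fintype κ] {ε : ℝ} (hε : 0 ≤ ε) (R : ι → ℕ) (S : κ → ℕ) :
    wt ε (Sum.elim R S) = wt ε R * wt ε S := by
  simp [wt, mfact, ENNReal.mul_rpow_of_nonneg _ _ hε]

theorem mdeg_sumElim {κ : Type*} [Fintype κ] (R : ι → ℕ) (S : κ → ℕ) :
    mdeg (Sum.elim R S) = mdeg R + mdeg S := by
  simp [mdeg]

theorem wt_neg_one (α : ι → ℕ) : wt (-1) α = (mfact α : ℝ≥0∞)⁻¹ := by rw [wt_neg, wt_one]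

theorem card_Iic_le [DecidableEq ι] (α : ι → ℕ) : (Finset.Iic α).card ≤ 2 ^ mdeg α := by
  rw [Pi.card_Iic, mdeg, ← Finset.prod_pow_eq_pow_sum]
  refine Finset.prod_le_prod' fun i _ => ?_
  rw [Nat.card_Iic]
  exact Nat.lt_two_pow_self

end General

/-! ### Summability, shifts and change of base point under weighted norms -/

theorem tsum_array_le (r : ℝ≥0∞) (hr : r ≠ ⊤) : ∃ C : ℝ≥0∞, C ≠ ⊤ ∧
    ∀ b : (Fin n ⊕ Fin n → ℕ) → ℂ,
      ∑' α, ‖b α‖ₑ * wt (-1) α * r ^ mdeg α ≤ C * aq (1 / 2) b := by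
  refine ⟨_, tsum_pow_mdeg_mul_wt_ne_top (ι := Fin n ⊕ Fin n) r hr (δ := 1 / 2) (by norm_num),
    fun b => ?_⟩
  rw [← ENNReal.tsum_mul_right]
  refine ENNReal.tsum_le_tsum fun α => ?_
  -- Growth (α!)^(1/2) against the Taylor factor 1/α! leaves (α!)^(-1/2), which beats every
  -- geometric factor.
  have e : wt (-(1 / 2)) α = wt (1 / 2) α * wt (-1) α := by
    rw [← wt_add_exp]
    norm_num
  calc ‖b α‖ₑ * wt (-1) α * r ^ mdeg α
      ≤ aq (1 / 2) b * wt (1 / 2) α * wt (-1) α * r ^ mdeg α := by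
        gcongr
        exact enorm_le_aq _ _ _
    _ = r ^ mdeg α * wt (-(1 / 2)) α * aq (1 / 2) b := by rw [e]; ring

theorem enorm_natCast_complex (k : ℕ) : ‖(k : ℂ)‖ₑ = k := by
  rw [← ofReal_norm, Complex.norm_natCast, ENNReal.ofReal_natCast]

theorem enorm_div_mfact (x : ℂ) (α : Fin n ⊕ Fin n → ℕ) :
    ‖x / mfact α‖ₑ = ‖x‖ₑ * wt (-1) α := by
  have : (mfact α : ℂ) ≠ 0 := by exact_mod_cast mfact_ne_zero α
  rw [div_eq_mul_inv, enorm_mul, enorm_inv this, wt_neg_one, enorm_natCast_complex]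

theorem ent_of_aq {b : (Fin n ⊕ Fin n → ℕ) → ℂ} (hb : aq (1 / 2) b ≠ ⊤) : Ent b := by
  intro r hr
  obtain ⟨C, hC, h⟩ := tsum_array_le (n := n) (ENNReal.ofReal r) ENNReal.ofReal_ne_top
  have h1 := ne_top_of_le_ne_top (ENNReal.mul_ne_top hC hb) (h b)
  have e : ∀ α, ‖b α‖ₑ * wt (-1) α * ENNReal.ofReal r ^ mdeg α =
      ENNReal.ofReal (‖b α‖ / mfact α * r ^ mdeg α) := fun α => by
    rw [← enorm_div_mfact, ENNReal.ofReal_mul (by positivity), ENNReal.ofReal_pow hr,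
      ← ofReal_norm, norm_div, Complex.norm_natCast]
  simp only [e] at h1
  have h2 := ENNReal.summable_toReal h1
  refine h2.congr fun α => ?_
  exact ENNReal.toReal_ofReal (by positivity)

theorem enorm_pser_le (p z : Fin n → ℂ) : ∃ C : ℝ≥0∞, C ≠ ⊤ ∧
    ∀ b : (Fin n ⊕ Fin n → ℕ) → ℂ, ‖pser p b z‖ₑ ≤ C * aq (1 / 2) b := by
  obtain ⟨C, hC, h⟩ := tsum_array_le (n := n) ‖z - p‖ₑ enorm_ne_top
  refine ⟨C, hC, fun b => le_trans ?_ (h b)⟩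
  refine enorm_tsum_le_tsum_enorm.trans (ENNReal.tsum_le_tsum fun α => ?_)
  rw [enorm_mul, enorm_div_mfact]
  gcongr
  rw [← ofReal_norm, ← ofReal_norm, ← ENNReal.ofReal_pow (norm_nonneg _)]
  exact ENNReal.ofReal_le_ofReal (norm_mono_le _ _)

/-- Doubling the exponent pays for the powers of 2 from `wt_add_le`, once in α and once in β. -/
theorem aq_shift_le {ε : ℝ} (hε : 0 < ε) (hε1 : ε ≤ 1) : ∃ C : ℝ≥0∞, C ≠ ⊤ ∧
    ∀ (b : (Fin n ⊕ Fin n → ℕ) → ℂ) (β : Fin n ⊕ Fin n → ℕ),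
      aq (2 * ε) (shift β b) ≤ C * wt (2 * ε) β * aq ε b := by
  obtain ⟨C, hC, h⟩ := pow_mdeg_le_wt (ι := Fin n ⊕ Fin n) 2 (by simp) hε
  refine ⟨C * C, ENNReal.mul_ne_top hC hC, fun b β => aq_le fun α => ?_⟩
  calc ‖b (α + β)‖ₑ ≤ aq ε b * wt ε (α + β) := enorm_le_aq _ _ _
    _ ≤ aq ε b * (2 ^ mdeg α * wt ε α * (2 ^ mdeg β * wt ε β)) := by
        gcongr
        exact wt_add_le hε.le hε1 α β
    _ ≤ aq ε b * (C * wt ε α * wt ε α * (C * wt ε β * wt ε β)) := by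
        gcongr
        · exact h α
        · exact h β
    _ = C * C * wt (2 * ε) β * aq ε b * wt (2 * ε) α := by
        rw [two_mul, wt_add_exp, wt_add_exp]
        ring

/-- The derivative of order α at `p'` is the value there of the series of the shifted array, so a
bound for values and the shift estimate suffice. The restriction ε ≤ 1/4 brings 2ε below the
exponent 1/2 needed for evaluation. -/
theorem aq_translate_le {ε : ℝ} (hε : 0 < ε) (hε1 : ε ≤ 1 / 4) (p p' : Fin n → ℂ) :
    ∃ C : ℝ≥0∞, C ≠ ⊤ ∧ ∀ b : (Fin n ⊕ Fin n → ℕ) → ℂ, Ent b →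
      aq (2 * ε) (fun α => wpow α (pser p b) p') ≤ C * aq ε b := by
  obtain ⟨C, hC, h⟩ := aq_shift_le (n := n) hε (by linarith)
  obtain ⟨C', hC', h'⟩ := enorm_pser_le p p'
  refine ⟨C' * C, ENNReal.mul_ne_top hC' hC, fun b hb => aq_le fun α => ?_⟩
  rw [hb.wpow_pser]
  calc _ ≤ C' * aq (1 / 2) (shift α b) := h' _
    _ ≤ C' * aq (2 * ε) (shift α b) := by
        gcongr
        exact aq_anti (by linarith) _
    _ ≤ C' * (C * wt (2 * ε) α * aq ε b) := by
        gcongr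
        exact h b α
    _ = _ := by ring

/-! ### Convolution of arrays -/

/-- This makes the general Cauchy product theorem available for series over multiindices. -/
instance {ι : Type*} [Fintype ι] [DecidableEq ι] : Finset.HasAntidiagonal (ι → ℕ) where
  antidiagonal α := {x ∈ Finset.Iic α ×ˢ Finset.Iic α | x.1 + x.2 = α}
  mem_antidiagonal {α x} := by
    simp only [Finset.mem_filter, Finset.mem_product, Finset.mem_Iic, and_iff_right_iff_imp]
    rintro rfl
    exact ⟨le_self_add, le_add_self⟩

/-- The array belonging to a pointwise product. -/
def conv (b c : (Fin n ⊕ Fin n → ℕ) → ℂ) : (Fin n ⊕ Fin n → ℕ) → ℂ := fun α =>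
  mfact α * ∑ x ∈ Finset.HasAntidiagonal.antidiagonal α, b x.1 / mfact x.1 * (c x.2 / mfact x.2)

theorem card_antidiagonal_le {ι : Type*} [Fintype ι] [DecidableEq ι] (α : ι → ℕ) :
    (Finset.HasAntidiagonal.antidiagonal α).card ≤ 2 ^ mdeg α := by
  refine le_trans ?_ (card_Iic_le α)
  refine Finset.card_le_card_of_injOn Prod.fst (fun x hx => ?_) fun x hx y hy h => ?_
  · have := Finset.HasAntidiagonal.mem_antidiagonal.1 (Finset.mem_coe.1 hx)
    simp only [Finset.coe_Iic, Set.mem_Iic]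
    exact this ▸ le_self_add
  · have h1 := Finset.HasAntidiagonal.mem_antidiagonal.1 (Finset.mem_coe.1 hx)
    have h2 := Finset.HasAntidiagonal.mem_antidiagonal.1 (Finset.mem_coe.1 hy)
    refine Prod.ext h (add_left_cancel (a := x.1) ?_)
    rw [h1, h, h2]

/-- The binomial factor and the number of splittings of α are each at most 2^|α|; the resulting
4^|α| is absorbed by the second (α!)^ε. -/
theorem aq_conv_le {ε : ℝ} (hε : 0 < ε) : ∃ C : ℝ≥0∞, C ≠ ⊤ ∧
    ∀ b c : (Fin n ⊕ Fin n → ℕ) → ℂ, aq (2 * ε) (conv b c) ≤ C * aq ε b * aq ε c := by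
  obtain ⟨C, hC, h⟩ := pow_mdeg_le_wt (ι := Fin n ⊕ Fin n) 4 (by simp) hε
  refine ⟨C, hC, fun b c => aq_le fun α => ?_⟩
  have hterm : ∀ x ∈ Finset.HasAntidiagonal.antidiagonal α,
      ‖(mfact α : ℂ) * (b x.1 / mfact x.1 * (c x.2 / mfact x.2))‖ₑ ≤
        2 ^ mdeg α * (aq ε b * aq ε c * wt ε α) := by
    intro x hx
    have hx : x.1 + x.2 = α := Finset.HasAntidiagonal.mem_antidiagonal.1 hx
    have h0 : (mfact α : ℝ≥0∞) * (wt (-1) x.1 * wt (-1) x.2) ≤ 2 ^ mdeg α := by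
      have h3 : (mfact α : ℝ≥0∞) ≤ 2 ^ mdeg α * (mfact x.1 * mfact x.2) := by
        rw [← hx, mdeg_add]
        exact_mod_cast mfact_add_le x.1 x.2
      calc (mfact α : ℝ≥0∞) * (wt (-1) x.1 * wt (-1) x.2)
          ≤ 2 ^ mdeg α * (mfact x.1 * mfact x.2) * (wt (-1) x.1 * wt (-1) x.2) := by gcongr
        _ = 2 ^ mdeg α * ((wt 1 x.1 * wt (-1) x.1) * (wt 1 x.2 * wt (-1) x.2)) := by
            rw [wt_one, wt_one]; ring
        _ = 2 ^ mdeg α := by rw [wt_mul_neg, wt_mul_neg, one_mul, mul_one]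
    rw [enorm_mul, enorm_mul, enorm_div_mfact, enorm_div_mfact, enorm_natCast_complex]
    calc (mfact α : ℝ≥0∞) * (‖b x.1‖ₑ * wt (-1) x.1 * (‖c x.2‖ₑ * wt (-1) x.2))
        = mfact α * (wt (-1) x.1 * wt (-1) x.2) * (‖b x.1‖ₑ * ‖c x.2‖ₑ) := by ring
      _ ≤ 2 ^ mdeg α * (aq ε b * wt ε x.1 * (aq ε c * wt ε x.2)) := by
          gcongr
          · exact enorm_le_aq _ _ _
          · exact enorm_le_aq _ _ _
      _ = 2 ^ mdeg α * (aq ε b * aq ε c * (wt ε x.1 * wt ε x.2)) := by ring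
      _ ≤ 2 ^ mdeg α * (aq ε b * aq ε c * wt ε α) := by
          gcongr
          rw [← hx]
          exact wt_mul_le hε.le _ _
  rw [conv, Finset.mul_sum]
  calc _ ≤ ∑ x ∈ Finset.HasAntidiagonal.antidiagonal α,
        ‖(mfact α : ℂ) * (b x.1 / mfact x.1 * (c x.2 / mfact x.2))‖ₑ := enorm_sum_le _ _
    _ ≤ (Finset.HasAntidiagonal.antidiagonal α).card • (2 ^ mdeg α * (aq ε b * aq ε c * wt ε α)) :=
        Finset.sum_le_card_nsmul _ _ _ hterm
    _ ≤ 2 ^ mdeg α * (2 ^ mdeg α * (aq ε b * aq ε c * wt ε α)) := by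
        rw [nsmul_eq_mul]
        gcongr
        exact_mod_cast card_antidiagonal_le α
    _ = 4 ^ mdeg α * (aq ε b * aq ε c * wt ε α) := by
        rw [← mul_assoc, ← mul_pow]
        norm_num
    _ ≤ C * wt ε α * (aq ε b * aq ε c * wt ε α) := by
        gcongr
        exact h α
    _ = _ := by rw [two_mul, wt_add_exp]; ring

theorem pser_mul_pser {b c : (Fin n ⊕ Fin n → ℕ) → ℂ} (hb : Ent b) (hc : Ent c)
    (p z : Fin n → ℂ) : pser p b z * pser p c z = pser p (conv b c) z := by
  have h1 := hb.summable_norm (z - p)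
  have h2 := hc.summable_norm (z - p)
  have h3 := summable_mul_of_summable_norm h1 h2
  refine (Summable.tsum_mul_tsum_eq_tsum_sum_antidiagonal h1.of_norm h2.of_norm h3).trans ?_
  refine tsum_congr fun α => ?_
  have h0 : (mfact α : ℂ) ≠ 0 := by exact_mod_cast mfact_ne_zero α
  have h4 : conv b c α / mfact α = ∑ x ∈ Finset.HasAntidiagonal.antidiagonal α,
      b x.1 / mfact x.1 * (c x.2 / mfact x.2) := mul_div_cancel_left₀ _ h0
  rw [h4, Finset.sum_mul]
  refine Finset.sum_congr rfl fun x hx => ?_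
  rw [← Finset.HasAntidiagonal.mem_antidiagonal.1 hx, mono_add]
  ring

end ArrayNorm

/-! ### Comparison of the recursive seminorms with the weighted supremum norms -/

section Comparison

open scoped ENNReal

/-- The array of all Wirtinger derivatives at `p`. -/
def jet (p : Fin n → ℂ) (f : (Fin n → ℂ) → ℂ) : (Fin n ⊕ Fin n → ℕ) → ℂ := fun α => wpow α f p

/-! ### Upper bounds of the recursive quantities -/

/-- The sum over N common to the base case and the recursion step. The exponent stays below δ/2 so
that the other δ/2 absorbs the geometric factors in R and S, and below 1/2 so that 1/N! still leaves
(N!)^(-1/2) for convergence. -/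
theorem tsum_step_le {K : ℝ≥0∞} (hK : K ≠ ⊤) {δ : ℝ} (hδ : 0 < δ) :
    ∃ C : ℝ≥0∞, C ≠ ⊤ ∧ ∀ R S : MI n,
      ∑' N : MI n, wt (-1) N * (K ^ (mdeg R + mdeg S + mdeg N) *
        (wt (min δ 1 / 2) R * wt (min δ 1 / 2) (N + S))) ≤ C * (wt δ R * wt δ S) := by
  have hm : 0 < min δ 1 := lt_min hδ one_pos
  obtain ⟨C₁, hC₁, h₁⟩ := pow_mdeg_le_wt (ι := Fin n) K hK (half_pos hδ)
  obtain ⟨C₂, hC₂, h₂⟩ := pow_mdeg_le_wt (ι := Fin n) (2 * K) (ENNReal.mul_ne_top (by simp) hK)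
    (half_pos hδ)
  have h₃ := tsum_pow_mdeg_mul_wt_ne_top (ι := Fin n) (2 * K) (ENNReal.mul_ne_top (by simp) hK)
    (δ := 1 / 2) (by norm_num)
  refine ⟨C₁ * C₂ * ∑' N : MI n, (2 * K) ^ mdeg N * wt (-(1 / 2)) N,
    ENNReal.mul_ne_top (ENNReal.mul_ne_top hC₁ hC₂) h₃, fun R S => ?_⟩
  rw [mul_right_comm, ← ENNReal.tsum_mul_left]
  refine ENNReal.tsum_le_tsum fun N => ?_
  have e2 : ∀ R : MI n, wt δ R = wt (δ / 2) R * wt (δ / 2) R := fun R => by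
    rw [← wt_add_exp]
    ring_nf
  have hle : min δ 1 / 2 ≤ δ / 2 := by linarith [min_le_left δ 1]
  have hle1 : min δ 1 / 2 ≤ 1 / 2 := by linarith [min_le_right δ 1]
  calc wt (-1) N * (K ^ (mdeg R + mdeg S + mdeg N) *
        (wt (min δ 1 / 2) R * wt (min δ 1 / 2) (N + S)))
      ≤ wt (-1) N * (K ^ (mdeg R + mdeg S + mdeg N) * (wt (δ / 2) R *
          (2 ^ mdeg N * wt (1 / 2) N * (2 ^ mdeg S * wt (δ / 2) S)))) := by
        gcongr
        · exact wt_mono_exp hle R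
        · refine (wt_add_le (by positivity) (by linarith) N S).trans ?_
          gcongr
          · exact wt_mono_exp hle1 N
          · exact wt_mono_exp hle S
    _ = (K ^ mdeg R * wt (δ / 2) R) * ((2 * K) ^ mdeg S * wt (δ / 2) S) *
          ((2 * K) ^ mdeg N * (wt (-1) N * wt (1 / 2) N)) := by
        rw [pow_add, pow_add, mul_pow, mul_pow]
        ring
    _ ≤ (C₁ * wt (δ / 2) R * wt (δ / 2) R) * (C₂ * wt (δ / 2) S * wt (δ / 2) S) *
          ((2 * K) ^ mdeg N * (wt (-1) N * wt (1 / 2) N)) := by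
        gcongr
        · exact h₁ R
        · exact h₂ S
    _ = C₁ * C₂ * (wt δ R * wt δ S) * ((2 * K) ^ mdeg N * wt (-(1 / 2)) N) := by
        rw [e2 R, e2 S, ← wt_add_exp (-1)]
        norm_num
        ring

theorem binom_le (R I : MI n) : (binom R I : ℝ≥0∞) ≤ 2 ^ mdeg R := by
  have : binom R I ≤ 2 ^ mdeg R := by
    rw [mdeg, ← Finset.prod_pow_eq_pow_sum]
    exact Finset.prod_le_prod' fun k _ => Nat.choose_le_two_pow _ _
  exact_mod_cast this

theorem sum_binom_le (R T : MI n) {x : MI n → MI n → ℝ≥0∞} {B : ℝ≥0∞}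
    (h : ∀ I ≤ R, ∀ J ≤ T, x I J ≤ B) :
    ∑ I ∈ Finset.Iic R, ∑ J ∈ Finset.Iic T, (binom R I : ℝ≥0∞) * (binom T J : ℝ≥0∞) * x I J ≤
      4 ^ (mdeg R + mdeg T) * B := by
  have hcard : ∀ R : MI n, ((Finset.Iic R).card : ℝ≥0∞) ≤ 2 ^ mdeg R := fun R => by
    exact_mod_cast card_Iic_le R
  calc _ ≤ ∑ I ∈ Finset.Iic R, ∑ J ∈ Finset.Iic T, (2 ^ mdeg R * 2 ^ mdeg T * B : ℝ≥0∞) := by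
        refine Finset.sum_le_sum fun I hI => Finset.sum_le_sum fun J hJ => ?_
        gcongr
        · exact binom_le R I
        · exact binom_le T J
        · exact h I (Finset.mem_Iic.1 hI) J (Finset.mem_Iic.1 hJ)
    _ = (Finset.Iic R).card * ((Finset.Iic T).card * (2 ^ mdeg R * 2 ^ mdeg T * B)) := by
        simp [Finset.sum_const, nsmul_eq_mul]
    _ ≤ 2 ^ mdeg R * (2 ^ mdeg T * (2 ^ mdeg R * 2 ^ mdeg T * B)) := by
        gcongr
        · exact hcard R
        · exact hcard T
    _ = 4 ^ (mdeg R + mdeg T) * B := by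
        rw [show (4 : ℝ≥0∞) = 2 * 2 by norm_num, mul_pow, pow_add]
        ring

theorem ofReal_weight {ħ : ℝ} (hħ : 0 < ħ) (N : MI n) (k : ℕ) :
    ENNReal.ofReal ((2 * ħ) ^ k / (fact N : ℝ)) = ENNReal.ofReal (2 * ħ) ^ k * wt (-1) N := by
  have : 0 < (fact N : ℝ) := by exact_mod_cast mfact_pos N
  rw [ENNReal.ofReal_div_of_pos this, ENNReal.ofReal_pow (by positivity), wt_neg_one,
    ENNReal.ofReal_natCast]
  rfl

/-- Keeping an arbitrary δ in the dependence on R and S is what lets the induction run, since each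
squaring doubles it. The bound is symmetric in R and S, so even and odd ℓ are treated alike. -/
theorem hph_le {ħ : ℝ} (hħ : 0 < ħ) (m : ℕ) {δ : ℝ} (hδ : 0 < δ) :
    ∃ ε : ℝ, 0 < ε ∧ ∃ C : ℝ≥0∞, C ≠ ⊤ ∧ ∀ (p : Fin n → ℂ) (f : (Fin n → ℂ) → ℂ) (ℓ : ℕ)
      (R S : MI n), hph p ħ f m ℓ R S ≤
        C * aq ε (jet p f) ^ 2 ^ (m + 1) * (wt δ R * wt δ S) := by
  induction m generalizing δ with
  | zero =>
    have hm : 0 < min δ 1 := lt_min hδ one_pos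
    obtain ⟨C, hC, h⟩ := tsum_step_le (n := n) (K := ENNReal.ofReal (2 * ħ))
      ENNReal.ofReal_ne_top hδ
    -- The square in the base case doubles this to the exponent `min δ 1 / 2` of `tsum_step_le`.
    refine ⟨min δ 1 / 4, by positivity, C, hC, fun p f ℓ R S => ?_⟩
    set Q := aq (min δ 1 / 4) (jet p f) with hQ
    rw [hph]
    calc _ ≤ ∑' N : MI n, Q ^ 2 * (wt (-1) N * (ENNReal.ofReal (2 * ħ) ^
          (mdeg R + mdeg S + mdeg N) * (wt (min δ 1 / 2) R * wt (min δ 1 / 2) (N + S)))) := by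
          refine ENNReal.tsum_le_tsum fun N => ?_
          have h1 : ‖wirt R (N + S) f p‖ₑ ≤
              Q * (wt (min δ 1 / 4) R * wt (min δ 1 / 4) (N + S)) := by
            rw [← wt_sumElim (by positivity)]
            exact enorm_le_aq _ (jet p f) _
          have e : ∀ R : MI n, wt (min δ 1 / 2) R = wt (min δ 1 / 4) R ^ 2 := fun R => by
            rw [wt_pow]
            congr 1
            push_cast
            ring
          rw [ofReal_weight hħ]
          calc _ ≤ ENNReal.ofReal (2 * ħ) ^ (deg R + deg S + deg N) * wt (-1) N *
                (Q * (wt (min δ 1 / 4) R * wt (min δ 1 / 4) (N + S))) ^ 2 := by gcongr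
            _ = _ := by
                rw [e, e]
                simp only [deg, mdeg]
                ring
      _ ≤ Q ^ 2 * (C * (wt δ R * wt δ S)) := by
          rw [ENNReal.tsum_mul_left]
          gcongr
          exact h R S
      _ = _ := by ring
  | succ m ih =>
    have hm : 0 < min δ 1 := lt_min hδ one_pos
    obtain ⟨ε, hε, C, hC, h⟩ := ih (δ := min δ 1 / 4) (by positivity)
    -- 16 is the square of the base 4 in `sum_binom_le`.
    obtain ⟨C', hC', h'⟩ := tsum_step_le (n := n) (K := 16) (by simp) hδ
    refine ⟨ε, hε, C' * C ^ 2, ENNReal.mul_ne_top hC' (ENNReal.pow_ne_top hC),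
      fun p f ℓ R S => ?_⟩
    set Q := aq ε (jet p f) ^ 2 ^ (m + 1) with hQ
    have e : ∀ R : MI n, wt (min δ 1 / 2) R = wt (min δ 1 / 4) R ^ 2 := fun R => by
      rw [wt_pow]
      congr 1
      push_cast
      ring
    have hmono : ∀ {I R : MI n}, I ≤ R → wt (min δ 1 / 4) I ≤ wt (min δ 1 / 4) R :=
      fun h => wt_mono (by positivity) h
    have key : ∀ x : MI n → MI n → MI n → ℝ≥0∞,
        (∀ N I J, x N I J ≤ C * Q * (wt (min δ 1 / 4) I * wt (min δ 1 / 4) J)) →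
        ∑' N : MI n, (fact N : ℝ≥0∞)⁻¹ * (∑ I ∈ Finset.Iic R, ∑ J ∈ Finset.Iic (N + S),
          (binom R I : ℝ≥0∞) * (binom (N + S) J : ℝ≥0∞) * x N I J) ^ 2 ≤
        C' * C ^ 2 * aq ε (jet p f) ^ 2 ^ (m + 1 + 1) * (wt δ R * wt δ S) := by
      intro x hx
      calc _ ≤ ∑' N : MI n, C ^ 2 * Q ^ 2 * (wt (-1) N * (16 ^ (mdeg R + mdeg S + mdeg N) *
            (wt (min δ 1 / 2) R * wt (min δ 1 / 2) (N + S)))) := by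
            refine ENNReal.tsum_le_tsum fun N => ?_
            have h1 := sum_binom_le R (N + S) (x := x N)
              (B := C * Q * (wt (min δ 1 / 4) R * wt (min δ 1 / 4) (N + S)))
              fun I hI J hJ => (hx N I J).trans (by
                gcongr
                · exact hmono hI
                · exact hmono hJ)
            calc _ ≤ (fact N : ℝ≥0∞)⁻¹ * (4 ^ (mdeg R + mdeg (N + S)) *
                  (C * Q * (wt (min δ 1 / 4) R * wt (min δ 1 / 4) (N + S)))) ^ 2 := by gcongr
              _ = C ^ 2 * Q ^ 2 * (wt (-1) N * (16 ^ (mdeg R + mdeg S + mdeg N) *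
                  (wt (min δ 1 / 2) R * wt (min δ 1 / 2) (N + S)))) := by
                  have h16 : ∀ k : ℕ, (16 : ℝ≥0∞) ^ k = 4 ^ k * 4 ^ k := fun k => by
                    rw [← mul_pow]
                    norm_num
                  rw [e, e, wt_neg_one, mdeg_add, h16]
                  simp only [fact, mfact]
                  ring
        _ ≤ C ^ 2 * Q ^ 2 * (C' * (wt δ R * wt δ S)) := by
            rw [ENNReal.tsum_mul_left]
            gcongr
            exact h' R S
        _ = _ := by
            rw [hQ, ← pow_mul, ← pow_succ]
            ring
    rw [hph]
    split_ifs
    · exact key _ fun N I J => h p f _ I J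
    · exact key (fun N I J => hph p ħ f m ((ℓ - 1) / 2) J I)
        fun N I J => (h p f _ J I).trans_eq (by ring)

theorem normph_le {ħ : ℝ} (hħ : 0 < ħ) (m ℓ : ℕ) (R S : MI n) :
    ∃ ε : ℝ, 0 < ε ∧ ∃ C : ℝ≥0∞, C ≠ ⊤ ∧ ∀ (p : Fin n → ℂ) (f : (Fin n → ℂ) → ℂ),
      normph p ħ m ℓ R S f ≤ C * aq ε (jet p f) := by
  obtain ⟨ε, hε, C, hC, h⟩ := hph_le (n := n) hħ m one_pos
  have hq : (0 : ℝ) < 1 / 2 ^ (m + 1) := by positivity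
  refine ⟨ε, hε, (C * (wt 1 R * wt 1 S)) ^ ((1 : ℝ) / 2 ^ (m + 1)),
    ENNReal.rpow_ne_top_of_nonneg hq.le (ENNReal.mul_ne_top hC
      (ENNReal.mul_ne_top (wt_ne_top _ _) (wt_ne_top _ _))), fun p f => ?_⟩
  rw [normph]
  calc _ ≤ (C * (wt 1 R * wt 1 S) * aq ε (jet p f) ^ 2 ^ (m + 1)) ^ ((1 : ℝ) / 2 ^ (m + 1)) :=
        ENNReal.rpow_le_rpow ((h p f ℓ R S).trans_eq (by ring)) hq.le
    _ = _ := by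
        rw [ENNReal.mul_rpow_of_nonneg _ _ hq.le, ← ENNReal.rpow_natCast (aq ε (jet p f)),
          ← ENNReal.rpow_mul]
        push_cast
        rw [mul_one_div_cancel (by positivity), ENNReal.rpow_one]

/-! ### Lower bounds of the recursive quantities -/

theorem binom_self (R : MI n) : binom R R = 1 := by simp [binom]

/-- Only the summand N with I = R and J = N is kept: the second index becomes the summation index,
at the price of 1/N!. -/
theorem le_hph_succ_even (p : Fin n → ℂ) (ħ : ℝ) (f : (Fin n → ℂ) → ℂ) (m : ℕ) (R N : MI n) :
    (fact N : ℝ≥0∞)⁻¹ * hph p ħ f m 0 R N ^ 2 ≤ hph p ħ f (m + 1) 0 R 0 := by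
  rw [hph, if_pos ⟨0, rfl⟩]
  refine le_trans ?_ (ENNReal.le_tsum N)
  gcongr
  rw [add_zero]
  refine le_trans ?_ (Finset.single_le_sum (fun _ _ => zero_le)
    (Finset.mem_Iic.2 (le_refl R)))
  refine le_trans ?_ (Finset.single_le_sum (fun _ _ => zero_le)
    (Finset.mem_Iic.2 (le_refl N)))
  simp [binom_self]

/-- For odd ℓ the indices I and J are exchanged, so here the first index is the one replaced by the
summation index. -/
theorem le_hph_succ_odd (p : Fin n → ℂ) (ħ : ℝ) (f : (Fin n → ℂ) → ℂ) (m : ℕ) (N : MI n) :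
    (fact N : ℝ≥0∞)⁻¹ * hph p ħ f m 0 N 0 ^ 2 ≤ hph p ħ f (m + 1) 1 0 0 := by
  rw [hph, if_neg (by decide)]
  refine le_trans ?_ (ENNReal.le_tsum N)
  gcongr
  rw [add_zero]
  refine le_trans ?_ (Finset.single_le_sum (fun _ _ => zero_le)
    (Finset.mem_Iic.2 (le_refl (0 : MI n))))
  refine le_trans ?_ (Finset.single_le_sum (fun _ _ => zero_le)
    (Finset.mem_Iic.2 (le_refl N)))
  simp [binom_self]

theorem sq_le_hph_succ (p : Fin n → ℂ) (ħ : ℝ) (f : (Fin n → ℂ) → ℂ) (m : ℕ) (R S : MI n) :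
    hph p ħ f m 0 R S ^ 2 ≤ hph p ħ f (m + 1) 0 R S := by
  conv_rhs => rw [hph, if_pos ⟨0, rfl⟩]
  refine le_trans ?_ (ENNReal.le_tsum 0)
  simp only [zero_add]
  have : (fact (0 : MI n) : ℝ≥0∞)⁻¹ = 1 := by simp [fact]
  rw [this, one_mul]
  gcongr
  refine le_trans ?_ (Finset.single_le_sum (fun _ _ => zero_le)
    (Finset.mem_Iic.2 (le_refl R)))
  refine le_trans ?_ (Finset.single_le_sum (fun _ _ => zero_le)
    (Finset.mem_Iic.2 (le_refl S)))
  simp [binom_self]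

theorem pow_le_hph {ħ : ℝ} (hħ : 0 < ħ) (p : Fin n → ℂ) (f : (Fin n → ℂ) → ℂ) (m : ℕ)
    (R S : MI n) : (ENNReal.ofReal √(2 * ħ) ^ (mdeg R + mdeg S) * ‖wirt R S f p‖ₑ) ^ 2 ^ (m + 1) ≤
      hph p ħ f m 0 R S := by
  induction m with
  | zero =>
    rw [hph]
    refine le_trans (le_of_eq ?_) (ENNReal.le_tsum 0)
    rw [ofReal_weight hħ, wt_zero_index, zero_add, mul_one, pow_one 2]
    have : deg (0 : MI n) = 0 := by simp [deg]
    rw [zero_add, this, add_zero, mul_pow, ← pow_mul, mul_comm _ 2, pow_mul,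
      ← ENNReal.ofReal_pow (by positivity), Real.sq_sqrt (by positivity)]
    rfl
  | succ m ih =>
    refine le_trans ?_ (sq_le_hph_succ p ħ f m R S)
    rw [pow_succ 2 (m + 1), pow_mul]
    gcongr

/-- An even step frees S and an odd step then frees R. The second squaring turns the loss S! into
(S!)², so the total loss R! (S!)² is at most (R! S!)², independently of m. -/
theorem pow_le_hph_one {ħ : ℝ} (hħ : 0 < ħ) (p : Fin n → ℂ) (f : (Fin n → ℂ) → ℂ) (m : ℕ)
    (R S : MI n) :
    (ENNReal.ofReal √(2 * ħ) ^ (mdeg R + mdeg S) * ‖wirt R S f p‖ₑ) ^ 2 ^ (m + 3) ≤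
      wt 2 (Sum.elim R S) * hph p ħ f (m + 2) 1 0 0 := by
  set x := (ENNReal.ofReal √(2 * ħ) ^ (mdeg R + mdeg S) * ‖wirt R S f p‖ₑ) ^ 2 ^ (m + 1) with hx
  have h1 : wt (-1) S * x ^ 2 ≤ hph p ħ f (m + 1) 0 R 0 := by
    refine le_trans ?_ (le_hph_succ_even p ħ f m R S)
    rw [wt_neg_one]
    gcongr
    · exact le_rfl
    · exact pow_le_hph hħ p f m R S
  have h2 : wt (-1) R * (wt (-1) S * x ^ 2) ^ 2 ≤ hph p ħ f (m + 2) 1 0 0 := by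
    refine le_trans ?_ (le_hph_succ_odd p ħ f (m + 1) R)
    rw [wt_neg_one]
    gcongr
    exact le_rfl
  have e1 : (ENNReal.ofReal √(2 * ħ) ^ (mdeg R + mdeg S) * ‖wirt R S f p‖ₑ) ^ 2 ^ (m + 3) =
      x ^ 4 := by
    rw [hx, ← pow_mul]
    congr 1
    ring
  have e2 : ∀ R : MI n, wt 2 R = wt 1 R * wt 1 R := fun R => by
    rw [← wt_add_exp]
    norm_num
  rw [e1]
  calc x ^ 4 = (wt 1 R * wt (-1) R) * (wt 1 S * wt (-1) S) ^ 2 * x ^ 4 := by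
        rw [wt_mul_neg, wt_mul_neg]
        ring
    _ = wt 1 R * wt 2 S * (wt (-1) R * (wt (-1) S * x ^ 2) ^ 2) := by
        rw [e2]
        ring
    _ ≤ wt 2 R * wt 2 S * hph p ħ f (m + 2) 1 0 0 := by
        gcongr
        exact wt_mono_exp (by norm_num) R
    _ = _ := by rw [wt_sumElim (by norm_num)]

/-- The root of order 2^(k+3) reduces the squared factorials to the exponent 2 / 2^(k+3), at most
ε/2 for large k. The remaining ε/2 absorbs the powers of √(2ħ). A single seminorm suffices for each
ε. -/
theorem aq_le_normph {ħ : ℝ} (hħ : 0 < ħ) {ε : ℝ} (hε : 0 < ε) :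
    ∃ m : ℕ, 1 < 2 ^ m ∧ ∃ C : ℝ≥0∞, C ≠ ⊤ ∧ ∀ (p : Fin n → ℂ) (f : (Fin n → ℂ) → ℂ),
      aq ε (jet p f) ≤ C * normph p ħ m 1 0 0 f := by
  obtain ⟨k, hk⟩ := exists_pow_lt_of_lt_one hε (show (1 / 2 : ℝ) < 1 by norm_num)
  set κ := ENNReal.ofReal √(2 * ħ) with hκ
  have hκ0 : κ ≠ 0 := by
    rw [hκ, Ne, ENNReal.ofReal_eq_zero, not_le]
    positivity
  obtain ⟨C, hC, h⟩ := pow_mdeg_le_wt (ι := Fin n ⊕ Fin n) κ⁻¹ (ENNReal.inv_ne_top.2 hκ0)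
    (half_pos hε)
  refine ⟨k + 2, Nat.one_lt_two_pow (by omega), C, hC, fun p f => aq_le fun α => ?_⟩
  obtain ⟨R, S, rfl⟩ : ∃ R S : MI n, α = Sum.elim R S :=
    ⟨_, _, (Sum.elim_comp_inl_inr α).symm⟩
  have hq : (0 : ℝ) < 2 ^ (k + 3) := by positivity
  have h1 : κ ^ (mdeg R + mdeg S) * ‖wirt R S f p‖ₑ ≤
      wt (2 / 2 ^ (k + 3)) (Sum.elim R S) * normph p ħ (k + 2) 1 0 0 f := by
    have h2 := pow_le_hph_one hħ p f k R S
    rw [hph_eq_normph, ← ENNReal.rpow_natCast] at h2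
    push_cast at h2
    rw [← ENNReal.rpow_le_rpow_iff hq]
    refine h2.trans_eq ?_
    rw [ENNReal.mul_rpow_of_nonneg _ _ hq.le, wt, wt, ← ENNReal.rpow_mul,
      div_mul_cancel₀ _ hq.ne']
  have hle : 2 / 2 ^ (k + 3) ≤ ε / 2 := by
    have : (2 : ℝ) / 2 ^ (k + 3) = (1 / 2) ^ k / 4 := by
      rw [pow_add, one_div, inv_pow]
      field_simp
      norm_num
    rw [this]
    linarith
  rw [← mdeg_sumElim] at h1
  change ‖wirt R S f p‖ₑ ≤ _
  calc ‖wirt R S f p‖ₑ = κ⁻¹ ^ mdeg (Sum.elim R S) *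
        (κ ^ mdeg (Sum.elim R S) * ‖wirt R S f p‖ₑ) := by
        rw [← mul_assoc, ← mul_pow, ENNReal.inv_mul_cancel hκ0 ENNReal.ofReal_ne_top, one_pow,
          one_mul]
    _ ≤ C * wt (ε / 2) (Sum.elim R S) * (wt (ε / 2) (Sum.elim R S) *
        normph p ħ (k + 2) 1 0 0 f) := by
        refine mul_le_mul' (h _) (h1.trans ?_)
        gcongr
        exact wt_mono_exp hle _
    _ = _ := by
        conv_rhs => rw [← add_halves ε, wt_add_exp]
        ring

end Comparison

/-! ### The underlying class of functions -/

section FunctionClass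

open scoped ENNReal

/-- Real-analytic functions whose Wirtinger derivatives at every point grow more slowly than every
positive power of the factorials. -/
def IsWickFn (f : (Fin n → ℂ) → ℂ) : Prop :=
  AnalyticOnNhd ℝ f Set.univ ∧ ∀ (p : Fin n → ℂ) (ε : ℝ), 0 < ε → aq ε (jet p f) ≠ ⊤

theorem IsWickFn.smooth {f : (Fin n → ℂ) → ℂ} (hf : IsWickFn f) : ContDiff ℝ ∞ f :=
  smooth_of_analytic hf.1

theorem IsWickFn.ent {f : (Fin n → ℂ) → ℂ} (hf : IsWickFn f) (p : Fin n → ℂ) : Ent (jet p f) :=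
  ent_of_aq (hf.2 p _ (by norm_num))

theorem IsWickFn.eq_pser {f : (Fin n → ℂ) → ℂ} (hf : IsWickFn f) (p : Fin n → ℂ) :
    f = pser p (jet p f) := analytic_eq_pser hf.1 p (hf.ent p)

theorem jet_pser {b : (Fin n ⊕ Fin n → ℕ) → ℂ} (hb : Ent b) (p : Fin n → ℂ) :
    jet p (pser p b) = b := funext fun α => hb.wpow_pser_self p α

/-- Bounds for all ε at one point propagate to every point, because translation costs only a factor
2 in ε. -/
theorem isWickFn_pser {b : (Fin n ⊕ Fin n → ℕ) → ℂ} (hb : ∀ ε : ℝ, 0 < ε → aq ε b ≠ ⊤)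
    (p : Fin n → ℂ) : IsWickFn (pser p b) := by
  have hE : Ent b := ent_of_aq (hb _ (by norm_num))
  refine ⟨hE.analyticOnNhd p, fun p' ε hε => ?_⟩
  have hm : 0 < min ε (1 / 2) := lt_min hε (by norm_num)
  obtain ⟨C, hC, h⟩ := aq_translate_le (n := n) (ε := min ε (1 / 2) / 2) (by positivity)
    (by linarith [min_le_right ε (1 / 2)]) p p'
  refine ne_top_of_le_ne_top (ENNReal.mul_ne_top hC (hb _ (by positivity)))
    (le_trans (aq_anti ?_ _) (h b hE))
  linarith [min_le_left ε (1 / 2)]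

theorem isWickFn_of_jet {f : (Fin n → ℂ) → ℂ} (hf : AnalyticOnNhd ℝ f Set.univ) (p : Fin n → ℂ)
    (h : ∀ ε : ℝ, 0 < ε → aq ε (jet p f) ≠ ⊤) : IsWickFn f := by
  rw [analytic_eq_pser hf p (ent_of_aq (h _ (by norm_num)))]
  exact isWickFn_pser h p

theorem IsWickFn.aq_jet_le {ε : ℝ} (hε : 0 < ε) (hε1 : ε ≤ 1 / 4) (p p' : Fin n → ℂ) :
    ∃ C : ℝ≥0∞, C ≠ ⊤ ∧ ∀ f : (Fin n → ℂ) → ℂ, IsWickFn f →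
      aq (2 * ε) (jet p' f) ≤ C * aq ε (jet p f) := by
  obtain ⟨C, hC, h⟩ := aq_translate_le (n := n) hε hε1 p p'
  refine ⟨C, hC, fun f hf => ?_⟩
  conv_lhs => rw [hf.eq_pser p]
  exact h _ (hf.ent p)

theorem jet_ne_top_of_tilde {p : Fin n → ℂ} {ħ : ℝ} (hħ : 0 < ħ) {f : (Fin n → ℂ) → ℂ}
    (hf : f ∈ tildeSubmodule p ħ) (ε : ℝ) (hε : 0 < ε) : aq ε (jet p f) ≠ ⊤ := by
  obtain ⟨m, hm, C, hC, h⟩ := aq_le_normph (n := n) hħ hε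
  exact ne_top_of_le_ne_top (ENNReal.mul_ne_top hC (hf.2 m 1 0 0 hm).ne) (h p f)

/-- The right-hand side does not mention `p`; this is the independence of the function space from
the base point. -/
theorem mem_wickSubmodule_iff {p : Fin n → ℂ} {ħ : ℝ} (hħ : 0 < ħ) {f : (Fin n → ℂ) → ℂ} :
    f ∈ wickSubmodule p ħ ↔ IsWickFn f := by
  refine ⟨fun hf => isWickFn_of_jet hf.2 p (jet_ne_top_of_tilde hħ hf.1), fun hf =>
    ⟨⟨hf.smooth, fun m ℓ R S _ => ?_⟩, hf.1⟩⟩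
  obtain ⟨ε, hε, C, hC, h⟩ := normph_le (n := n) hħ m ℓ R S
  exact (h p f).trans_lt (ENNReal.mul_lt_top hC.lt_top (hf.2 p ε hε).lt_top)

/-! ### Jets of linear combinations and conjugates -/

theorem jet_add (p : Fin n → ℂ) {f g : (Fin n → ℂ) → ℂ} (hf : ContDiff ℝ ∞ f)
    (hg : ContDiff ℝ ∞ g) : jet p (f + g) = jet p f + jet p g :=
  funext fun α => by simp [jet, (wpow_smoothLin α).add f g hf hg]

theorem jet_smul (p : Fin n → ℂ) (a : ℂ) {f : (Fin n → ℂ) → ℂ} (hf : ContDiff ℝ ∞ f) :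
    jet p (a • f) = a • jet p f :=
  funext fun α => by simp [jet, (wpow_smoothLin α).smul a f hf]

theorem jet_conj (p : Fin n → ℂ) {f : (Fin n → ℂ) → ℂ} (hf : ContDiff ℝ ∞ f)
    (α : Fin n ⊕ Fin n → ℕ) : jet p (fun z => (starRingEnd ℂ) (f z)) α =
      (starRingEnd ℂ) (jet p f (α ∘ Sum.swap)) := by
  rw [jet, wpow_conj α hf]
  rfl

theorem aq_jet_conj_le (ε : ℝ) (p : Fin n → ℂ) {f : (Fin n → ℂ) → ℂ} (hf : ContDiff ℝ ∞ f) :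
    aq ε (jet p fun z => (starRingEnd ℂ) (f z)) ≤ aq ε (jet p f) := by
  refine aq_le fun α => ?_
  have h1 : wt ε (α ∘ Sum.swap) = wt ε α := by
    rw [wt, wt, mfact, mfact]
    congr 2
    exact (Equiv.sumComm (Fin n) (Fin n)).prod_comp fun i => (α i).factorial
  rw [jet_conj p hf, ← h1, RCLike.enorm_conj]
  exact enorm_le_aq _ _ _

theorem IsWickFn.conj {f : (Fin n → ℂ) → ℂ} (hf : IsWickFn f) :
    IsWickFn fun z => (starRingEnd ℂ) (f z) :=
  ⟨(Complex.conjCLE : ℂ →L[ℝ] ℂ).comp_analyticOnNhd hf.1, fun p ε hε =>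
    ne_top_of_le_ne_top (hf.2 p ε hε) (aq_jet_conj_le ε p hf.smooth)⟩

/-! ### The terms of the Wick star product -/

/-- The coefficient `(2ħ)^{|N|} / N!`. -/
def wickCoeff (ħ : ℝ) (N : MI n) : ℂ := ((2 * ħ : ℝ) : ℂ) ^ deg N / (fact N : ℂ)

theorem enorm_wickCoeff {ħ : ℝ} (hħ : 0 < ħ) (N : MI n) :
    ‖wickCoeff ħ N‖ₑ = ENNReal.ofReal (2 * ħ) ^ mdeg N * wt (-1) N := by
  have h0 : (fact N : ℂ) ≠ 0 := by exact_mod_cast mfact_ne_zero N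
  rw [wickCoeff, div_eq_mul_inv, enorm_mul, enorm_inv h0, enorm_natCast_complex, wt_neg_one,
    enorm_pow]
  congr 2
  rw [← ofReal_norm, Complex.norm_real, Real.norm_of_nonneg (by positivity)]

theorem pser_smul (p : Fin n → ℂ) (a : ℂ) (b : (Fin n ⊕ Fin n → ℕ) → ℂ) :
    pser p (a • b) = a • pser p b := by
  funext z
  simp only [pser, Pi.smul_apply, smul_eq_mul, ← tsum_mul_left]
  exact tsum_congr fun α => by ring

/-- The array of a term of the Wick star product. -/
def termArray (ħ : ℝ) (b c : (Fin n ⊕ Fin n → ℕ) → ℂ) (N : MI n) : (Fin n ⊕ Fin n → ℕ) → ℂ :=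
  wickCoeff ħ N • conv (shift (Sum.elim N 0) b) (shift (Sum.elim 0 N) c)

theorem wickTerm_eq_pser (ħ : ℝ) {f g : (Fin n → ℂ) → ℂ} (hf : IsWickFn f) (hg : IsWickFn g)
    (N : MI n) (p : Fin n → ℂ) :
    wickTerm ħ f g N = pser p (termArray ħ (jet p f) (jet p g) N) := by
  rw [termArray, pser_smul]
  funext z
  rw [Pi.smul_apply, ← pser_mul_pser ((hf.ent p).shift _) ((hg.ent p).shift _), wickTerm,
    dzPow_eq_wpow, dzbarPow_eq_wpow, ← (hf.ent p).wpow_pser, ← (hg.ent p).wpow_pser,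
    ← hf.eq_pser p, ← hg.eq_pser p]
  rfl

/-- The shifts raise ε to 2ε and cost (N!)^(2ε) each; the convolution raises 2ε to 4ε. Against the
coefficient this leaves (2ħ)^|N| (N!)^(4ε-1), summable since 4ε ≤ 1/2. -/
theorem aq_termArray_le {ħ : ℝ} (hħ : 0 < ħ) {ε : ℝ} (hε : 0 < ε) (hε1 : ε ≤ 1 / 8) :
    ∃ u : MI n → ℝ≥0∞, ∑' N, u N ≠ ⊤ ∧ ∀ (b c : (Fin n ⊕ Fin n → ℕ) → ℂ) (N : MI n),
      aq (4 * ε) (termArray ħ b c N) ≤ u N * (aq ε b * aq ε c) := by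
  obtain ⟨C, hC, h⟩ := aq_conv_le (n := n) (ε := 2 * ε) (by positivity)
  obtain ⟨C', hC', h'⟩ := aq_shift_le (n := n) hε (by linarith)
  refine ⟨fun N => C * C' ^ 2 * (ENNReal.ofReal (2 * ħ) ^ mdeg N * wt (-(1 - 4 * ε)) N), ?_,
    fun b c N => ?_⟩
  · rw [ENNReal.tsum_mul_left]
    exact ENNReal.mul_ne_top (ENNReal.mul_ne_top hC (ENNReal.pow_ne_top hC'))
      (tsum_pow_mdeg_mul_wt_ne_top _ ENNReal.ofReal_ne_top (by linarith))
  · have e1 : wt (2 * ε) (Sum.elim N (0 : MI n)) = wt (2 * ε) N := by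
      rw [wt_sumElim (by positivity), wt_zero_index, mul_one]
    have e2 : wt (2 * ε) (Sum.elim (0 : MI n) N) = wt (2 * ε) N := by
      rw [wt_sumElim (by positivity), wt_zero_index, one_mul]
    have e3 : wt (-(1 - 2 * (2 * ε))) N = wt (-1) N * (wt (2 * ε) N * wt (2 * ε) N) := by
      rw [← wt_add_exp, ← wt_add_exp]
      congr 1
      ring
    rw [termArray, aq_smul, enorm_wickCoeff hħ, show 4 * ε = 2 * (2 * ε) by ring]
    calc _ ≤ ENNReal.ofReal (2 * ħ) ^ mdeg N * wt (-1) N * (C *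
          (C' * wt (2 * ε) (Sum.elim N (0 : MI n)) * aq ε b) *
          (C' * wt (2 * ε) (Sum.elim (0 : MI n) N) * aq ε c)) := by
          refine mul_le_mul_right ((h _ _).trans ?_) _
          gcongr
          · exact h' b _
          · exact h' c _
      _ = _ := by
          simp only [e1, e2, e3]
          ring

theorem termArray_ne_top {ħ : ℝ} (hħ : 0 < ħ) {b c : (Fin n ⊕ Fin n → ℕ) → ℂ}
    (hb : ∀ ε : ℝ, 0 < ε → aq ε b ≠ ⊤) (hc : ∀ ε : ℝ, 0 < ε → aq ε c ≠ ⊤) (N : MI n) (ε : ℝ)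
    (hε : 0 < ε) : aq ε (termArray ħ b c N) ≠ ⊤ := by
  have hm : 0 < min ε (1 / 2) := lt_min hε (by norm_num)
  obtain ⟨u, hu, h⟩ := aq_termArray_le (n := n) hħ (ε := min ε (1 / 2) / 4) (by positivity)
    (by linarith [min_le_right ε (1 / 2)])
  refine ne_top_of_le_ne_top (ENNReal.mul_ne_top (ENNReal.ne_top_of_tsum_ne_top hu N)
    (ENNReal.mul_ne_top (hb _ (by positivity)) (hc _ (by positivity))))
    (le_trans (aq_anti ?_ _) (h b c N))
  linarith [min_le_left ε (1 / 2)]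

theorem jet_wickTerm {ħ : ℝ} (hħ : 0 < ħ) {f g : (Fin n → ℂ) → ℂ} (hf : IsWickFn f)
    (hg : IsWickFn g) (N : MI n) (p : Fin n → ℂ) :
    jet p (wickTerm ħ f g N) = termArray ħ (jet p f) (jet p g) N := by
  rw [wickTerm_eq_pser ħ hf hg N p, jet_pser
    (ent_of_aq (termArray_ne_top hħ (hf.2 p) (hg.2 p) N _ (by norm_num)))]

theorem isWickFn_wickTerm {ħ : ℝ} (hħ : 0 < ħ) {f g : (Fin n → ℂ) → ℂ} (hf : IsWickFn f)
    (hg : IsWickFn g) (N : MI n) : IsWickFn (wickTerm ħ f g N) := by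
  rw [wickTerm_eq_pser ħ hf hg N 0]
  exact isWickFn_pser (termArray_ne_top hħ (hf.2 0) (hg.2 0) N) 0

/-! ### Pointwise associativity -/

theorem hasSum_sum_antidiagonal {A : Type*} [AddMonoid A] [Finset.HasAntidiagonal A] {B : Type*}
    {G : (A × A) × B → ℂ} (hG : Summable G) :
    HasSum (fun N => ∑' M, ∑ x ∈ Finset.HasAntidiagonal.antidiagonal N, G (x, M)) (∑' y, G y) := by
  have h1 : HasSum (fun x => ∑' M, G (x, M)) (∑' y, G y) :=
    hG.hasSum.prod_fiberwise fun x => (hG.prod_factor x).hasSum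
  have h2 := (Finset.HasAntidiagonal.sigmaAntidiagonalEquivProd (A := A)).hasSum_iff.2 h1
  refine (h2.sigma fun N => hasSum_fintype _).congr_fun fun N => ?_
  rw [Summable.tsum_finsetSum fun x _ => hG.prod_factor x]
  exact (Finset.sum_coe_sort (Finset.HasAntidiagonal.antidiagonal N)
    fun x => ∑' M, G (x, M)).symm

/-- The summand of the threefold Wick star product. -/
def tripleTerm (ħ : ℝ) (b c d : (Fin n ⊕ Fin n → ℕ) → ℂ) (y : (MI n × MI n) × MI n) : ℂ :=
  wickCoeff ħ y.1.1 * wickCoeff ħ y.1.2 * wickCoeff ħ y.2 *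
    (b (Sum.elim (y.1.1 + y.2) 0) * c (Sum.elim y.1.2 y.2) * d (Sum.elim 0 (y.1.1 + y.1.2)))

theorem summable_of_tsum_enorm {ι : Type*} {f : ι → ℂ} (h : ∑' i, ‖f i‖ₑ ≠ ⊤) : Summable f := by
  refine Summable.of_norm ((ENNReal.summable_toReal h).congr fun i => ?_)
  simp

/-- Each of the three summation indices enters exactly two of the three arrays, so its weight is
N!^(-1 + 2/8) up to geometric factors, and the majorant is a product of three convergent sums. -/
theorem summable_tripleTerm {ħ : ℝ} (hħ : 0 < ħ) {b c d : (Fin n ⊕ Fin n → ℕ) → ℂ}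
    (hb : aq (1 / 8) b ≠ ⊤) (hc : aq (1 / 8) c ≠ ⊤) (hd : aq (1 / 8) d ≠ ⊤) :
    Summable (tripleTerm ħ b c d) := by
  set K := ENNReal.ofReal (2 * ħ) with hK
  have hs := tsum_pow_mdeg_mul_wt_ne_top (ι := Fin n) (4 * K)
    (ENNReal.mul_ne_top (by simp) ENNReal.ofReal_ne_top) (δ := 3 / 4) (by norm_num)
  set g : MI n → ℝ≥0∞ := fun N => (4 * K) ^ mdeg N * wt (-(3 / 4)) N with hg
  refine summable_of_tsum_enorm (ne_top_of_le_ne_top (b := ∑' y : (MI n × MI n) × MI n,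
    (aq (1 / 8) b * aq (1 / 8) c * aq (1 / 8) d) * ((g y.1.1 * g y.1.2) * g y.2)) ?_ ?_)
  · rw [ENNReal.tsum_mul_left]
    refine ENNReal.mul_ne_top (ENNReal.mul_ne_top (ENNReal.mul_ne_top hb hc) hd) ?_
    rw [ENNReal.tsum_prod']
    simp only [ENNReal.tsum_mul_left, ENNReal.tsum_mul_right]
    refine ENNReal.mul_ne_top ?_ hs
    rw [ENNReal.tsum_prod']
    simp only [ENNReal.tsum_mul_left, ENNReal.tsum_mul_right]
    exact ENNReal.mul_ne_top hs hs
  · refine ENNReal.tsum_le_tsum ?_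
    rintro ⟨⟨I, J⟩, M⟩
    have e : ∀ N : MI n, wt (-(3 / 4)) N = wt (-1) N * (wt (1 / 8) N * wt (1 / 8) N) := fun N => by
      rw [← wt_add_exp, ← wt_add_exp]
      congr 1
      norm_num
    have hw : ∀ R S : MI n, wt (1 / 8) (R + S) ≤
        2 ^ mdeg R * wt (1 / 8) R * (2 ^ mdeg S * wt (1 / 8) S) := fun R S =>
      wt_add_le (by norm_num) (by norm_num) R S
    have e4 : ∀ k : ℕ, (4 : ℝ≥0∞) ^ k = 2 ^ k * 2 ^ k := fun k => by
      rw [← mul_pow]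
      norm_num
    have one_le : ∀ k : ℕ, (1 : ℝ≥0∞) ≤ 2 ^ k := fun k => one_le_pow₀ (by norm_num)
    simp only [tripleTerm, enorm_mul, enorm_wickCoeff hħ]
    calc _ ≤ K ^ mdeg I * wt (-1) I * (K ^ mdeg J * wt (-1) J) * (K ^ mdeg M * wt (-1) M) *
          (aq (1 / 8) b * (2 ^ mdeg I * wt (1 / 8) I * (2 ^ mdeg M * wt (1 / 8) M)) *
            (aq (1 / 8) c * (1 * wt (1 / 8) J * (1 * wt (1 / 8) M))) *
            (aq (1 / 8) d * (2 ^ mdeg I * wt (1 / 8) I * (2 ^ mdeg J * wt (1 / 8) J)))) := by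
          gcongr
          · refine (enorm_le_aq (1 / 8) b _).trans ?_
            rw [wt_sumElim (by norm_num), wt_zero_index, mul_one]
            gcongr
            exact hw I M
          · refine (enorm_le_aq (1 / 8) c _).trans ?_
            rw [wt_sumElim (by norm_num), one_mul, one_mul]
          · refine (enorm_le_aq (1 / 8) d _).trans ?_
            rw [wt_sumElim (by norm_num), wt_zero_index, one_mul]
            gcongr
            exact hw I J
      -- Superfluous powers of 2 are inserted so that the three indices carry the same factor `g`.
      _ ≤ K ^ mdeg I * wt (-1) I * (K ^ mdeg J * wt (-1) J) * (K ^ mdeg M * wt (-1) M) *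
          (aq (1 / 8) b * (2 ^ mdeg I * wt (1 / 8) I * (2 ^ mdeg M * wt (1 / 8) M)) *
            (aq (1 / 8) c * (2 ^ mdeg J * wt (1 / 8) J * (2 ^ mdeg M * wt (1 / 8) M))) *
            (aq (1 / 8) d * (2 ^ mdeg I * wt (1 / 8) I * (2 ^ mdeg J * wt (1 / 8) J)))) := by
          gcongr
          · exact one_le _
          · exact one_le _
      _ = _ := by
          simp only [hg, e, mul_pow, e4]
          ring

theorem sum_antidiagonal_sumElim_left (N : MI n)
    (G : (Fin n ⊕ Fin n → ℕ) × (Fin n ⊕ Fin n → ℕ) → ℂ) :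
    ∑ x ∈ Finset.HasAntidiagonal.antidiagonal (Sum.elim N (0 : MI n)), G x =
      ∑ x ∈ Finset.HasAntidiagonal.antidiagonal N, G (Sum.elim x.1 0, Sum.elim x.2 0) := by
  symm
  refine Finset.sum_bij (fun x _ => (Sum.elim x.1 0, Sum.elim x.2 0)) ?_ ?_ ?_ fun _ _ => rfl
  · rintro x hx
    rw [Finset.HasAntidiagonal.mem_antidiagonal] at hx ⊢
    funext i
    rcases i with i | i <;> simp [← hx]
  · rintro x - y - h
    exact Prod.ext (funext fun k => congrFun (Prod.mk.inj h).1 (Sum.inl k))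
      (funext fun k => congrFun (Prod.mk.inj h).2 (Sum.inl k))
  · rintro ⟨α, β⟩ hx
    rw [Finset.HasAntidiagonal.mem_antidiagonal] at hx
    have h0 : ∀ k, α (Sum.inr k) = 0 ∧ β (Sum.inr k) = 0 := fun k => by
      simpa using congrFun hx (Sum.inr k)
    refine ⟨(α ∘ Sum.inl, β ∘ Sum.inl), ?_, ?_⟩
    · rw [Finset.HasAntidiagonal.mem_antidiagonal]
      funext k
      simpa using congrFun hx (Sum.inl k)
    · refine Prod.ext ?_ ?_ <;> funext i <;> rcases i with i | i <;> simp [h0]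

theorem sum_antidiagonal_sumElim_right (N : MI n)
    (G : (Fin n ⊕ Fin n → ℕ) × (Fin n ⊕ Fin n → ℕ) → ℂ) :
    ∑ x ∈ Finset.HasAntidiagonal.antidiagonal (Sum.elim (0 : MI n) N), G x =
      ∑ x ∈ Finset.HasAntidiagonal.antidiagonal N, G (Sum.elim 0 x.1, Sum.elim 0 x.2) := by
  symm
  refine Finset.sum_bij (fun x _ => (Sum.elim 0 x.1, Sum.elim 0 x.2)) ?_ ?_ ?_ fun _ _ => rfl
  · rintro x hx
    rw [Finset.HasAntidiagonal.mem_antidiagonal] at hx ⊢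
    funext i
    rcases i with i | i <;> simp [← hx]
  · rintro x - y - h
    exact Prod.ext (funext fun k => congrFun (Prod.mk.inj h).1 (Sum.inr k))
      (funext fun k => congrFun (Prod.mk.inj h).2 (Sum.inr k))
  · rintro ⟨α, β⟩ hx
    rw [Finset.HasAntidiagonal.mem_antidiagonal] at hx
    have h0 : ∀ k, α (Sum.inl k) = 0 ∧ β (Sum.inl k) = 0 := fun k => by
      simpa using congrFun hx (Sum.inl k)
    refine ⟨(α ∘ Sum.inr, β ∘ Sum.inr), ?_, ?_⟩
    · rw [Finset.HasAntidiagonal.mem_antidiagonal]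
      funext k
      simpa using congrFun hx (Sum.inr k)
    · refine Prod.ext ?_ ?_ <;> funext i <;> rcases i with i | i <;> simp [h0]

theorem mfact_sumElim (R S : MI n) : mfact (Sum.elim R S) = mfact R * mfact S := by
  simp [mfact]

theorem wickCoeff_mul_fact (ħ : ℝ) (N : MI n) {x : MI n × MI n}
    (hx : x ∈ Finset.HasAntidiagonal.antidiagonal N) :
    wickCoeff ħ N * (mfact N / (mfact x.1 * mfact x.2)) = wickCoeff ħ x.1 * wickCoeff ħ x.2 := by
  have h : ∀ N : MI n, (mfact N : ℂ) ≠ 0 := fun N => by exact_mod_cast mfact_ne_zero N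
  have hd : deg N = deg x.1 + deg x.2 := by
    rw [← Finset.HasAntidiagonal.mem_antidiagonal.1 hx]
    exact mdeg_add _ _
  have h1 := h N
  have h2 := h x.1
  have h3 := h x.2
  simp only [wickCoeff, hd, pow_add, show ∀ N : MI n, fact N = mfact N from fun _ => rfl]
  field_simp

/-- Leibniz' rule for ∂_z^N applied to the M-th term of the inner product; the binomial coefficients
merge with the coefficient of N by `wickCoeff_mul_fact`. -/
theorem mul_termArray_left (ħ : ℝ) (b c d : (Fin n ⊕ Fin n → ℕ) → ℂ) (N M : MI n) :
    wickCoeff ħ N * (termArray ħ b c M (Sum.elim N 0) * d (Sum.elim 0 N)) =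
      ∑ x ∈ Finset.HasAntidiagonal.antidiagonal N, tripleTerm ħ b c d (x, M) := by
  rw [termArray, Pi.smul_apply, conv, sum_antidiagonal_sumElim_left, smul_eq_mul, Finset.mul_sum,
    Finset.mul_sum, Finset.sum_mul, Finset.mul_sum]
  refine Finset.sum_congr rfl fun x hx => ?_
  have hN : N = x.1 + x.2 := (Finset.HasAntidiagonal.mem_antidiagonal.1 hx).symm
  have e1 : Sum.elim x.1 (0 : MI n) + Sum.elim M 0 = Sum.elim (x.1 + M) 0 := by
    funext i
    rcases i with i | i <;> simp
  have e2 : Sum.elim x.2 (0 : MI n) + Sum.elim (0 : MI n) M = Sum.elim x.2 M := by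
    funext i
    rcases i with i | i <;> simp
  simp only [tripleTerm, shift, e1, e2, mfact_sumElim, mfact_zero, mul_one, ← hN,
    ← wickCoeff_mul_fact ħ N hx]
  ring

theorem mul_termArray_right (ħ : ℝ) (b c d : (Fin n ⊕ Fin n → ℕ) → ℂ) (N M : MI n) :
    wickCoeff ħ N * (b (Sum.elim N 0) * termArray ħ c d M (Sum.elim 0 N)) =
      ∑ x ∈ Finset.HasAntidiagonal.antidiagonal N, tripleTerm ħ b c d ((x.2, M), x.1) := by
  rw [termArray, Pi.smul_apply, conv, sum_antidiagonal_sumElim_right, smul_eq_mul, Finset.mul_sum,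
    Finset.mul_sum, Finset.mul_sum, Finset.mul_sum]
  refine Finset.sum_congr rfl fun x hx => ?_
  have hN : N = x.1 + x.2 := (Finset.HasAntidiagonal.mem_antidiagonal.1 hx).symm
  have e1 : Sum.elim (0 : MI n) x.1 + Sum.elim M 0 = Sum.elim M x.1 := by
    funext i
    rcases i with i | i <;> simp
  have e2 : Sum.elim (0 : MI n) x.2 + Sum.elim (0 : MI n) M = Sum.elim (0 : MI n) (x.2 + M) := by
    funext i
    rcases i with i | i <;> simp
  have h1 := wickCoeff_mul_fact ħ N hx
  simp only [tripleTerm, shift, e1, e2, mfact_sumElim, mfact_zero, one_mul]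
  rw [add_comm x.2 x.1, ← hN, mul_right_comm (wickCoeff ħ x.2), mul_comm (wickCoeff ħ x.2), ← h1]
  ring

/-- Both bracketings sum the same absolutely convergent family; they differ by the cyclic
permutation `e` of the three indices. -/
theorem tsum_termArray_assoc {ħ : ℝ} (hħ : 0 < ħ) {b c d : (Fin n ⊕ Fin n → ℕ) → ℂ}
    (hb : aq (1 / 8) b ≠ ⊤) (hc : aq (1 / 8) c ≠ ⊤) (hd : aq (1 / 8) d ≠ ⊤) :
    ∑' N : MI n, wickCoeff ħ N *
        ((∑' M, termArray ħ b c M (Sum.elim N 0)) * d (Sum.elim 0 N)) =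
      ∑' N : MI n, wickCoeff ħ N *
        (b (Sum.elim N 0) * ∑' M, termArray ħ c d M (Sum.elim 0 N)) := by
  have hs := summable_tripleTerm hħ hb hc hd
  let e : (MI n × MI n) × MI n ≃ (MI n × MI n) × MI n :=
    ⟨fun y => ((y.1.2, y.2), y.1.1), fun y => ((y.2, y.1.1), y.1.2), fun _ => rfl, fun _ => rfl⟩
  have hs' : Summable fun y => tripleTerm ħ b c d (e y) := e.summable_iff.2 hs
  simp only [← tsum_mul_left, ← tsum_mul_right, mul_termArray_left, mul_termArray_right]
  rw [(hasSum_sum_antidiagonal hs).tsum_eq, ← e.tsum_eq]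
  exact (hasSum_sum_antidiagonal hs').tsum_eq.symm

end FunctionClass

/-! ### The space `A_{p,ħ}` with the weighted supremum seminorms -/

section WickSpace

open scoped ENNReal NNReal Topology

variable {p : Fin n → ℂ} {ħ : ℝ}

theorem WickA.ext {f g : WickA p ħ} (h : f.toFun = g.toFun) : f = g := Subtype.ext h

theorem WickA.toFun_add (f g : WickA p ħ) : (f + g).toFun = f.toFun + g.toFun := rfl

theorem WickA.toFun_smul (a : ℂ) (f : WickA p ħ) : (a • f).toFun = a • f.toFun := rfl

theorem WickA.isWickFn (hħ : 0 < ħ) (f : WickA p ħ) : IsWickFn f.toFun :=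
  (mem_wickSubmodule_iff hħ).1 f.2

/-- The element of `A_{p,ħ}` given by a function of the class. -/
def WickA.of (p : Fin n → ℂ) (hħ : 0 < ħ) (f : (Fin n → ℂ) → ℂ) (hf : IsWickFn f) : WickA p ħ :=
  ⟨f, (mem_wickSubmodule_iff hħ).2 hf⟩

theorem WickA.toFun_of (hħ : 0 < ħ) (f : (Fin n → ℂ) → ℂ) (hf : IsWickFn f) :
    (WickA.of p hħ f hf).toFun = f := rfl

theorem one_div_nat_pos (k : ℕ) : (0 : ℝ) < 1 / (k + 1) := by positivity

/-- The weighted supremum seminorms on `A_{p,ħ}`. -/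
def supSeminorm (p : Fin n → ℂ) (hħ : 0 < ħ) : SeminormFamily ℂ (WickA p ħ) ℕ := fun k =>
  Seminorm.of (fun f => (aq (1 / (k + 1)) (jet p f.toFun)).toReal)
    (fun f g => by
      have hf := f.isWickFn hħ
      have hg := g.isWickFn hħ
      have h1 := hf.2 p _ (one_div_nat_pos k)
      have h2 := hg.2 p _ (one_div_nat_pos k)
      rw [← ENNReal.toReal_add h1 h2, WickA.toFun_add, jet_add p hf.smooth hg.smooth]
      exact ENNReal.toReal_mono (ENNReal.add_ne_top.2 ⟨h1, h2⟩) (aq_add_le _ _ _))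
    (fun a f => by
      rw [WickA.toFun_smul, jet_smul p a (f.isWickFn hħ).smooth, aq_smul, ENNReal.toReal_mul,
        toReal_enorm])

theorem ofReal_supSeminorm (hħ : 0 < ħ) (k : ℕ) (f : WickA p ħ) :
    ENNReal.ofReal (supSeminorm p hħ k f) = aq (1 / (k + 1)) (jet p f.toFun) :=
  ENNReal.ofReal_toReal ((f.isWickFn hħ).2 p _ (one_div_nat_pos k))

theorem supSeminorm_le_of_aq_le (hħ : 0 < ħ) {k : ℕ} {f : WickA p ħ} {r : ℝ} (hr : 0 ≤ r)
    (h : aq (1 / (k + 1)) (jet p f.toFun) ≤ ENNReal.ofReal r) : supSeminorm p hħ k f ≤ r := by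
  rw [← ofReal_supSeminorm hħ] at h
  exact (ENNReal.ofReal_le_ofReal_iff hr).1 h

theorem exists_nat_one_div_le {ε : ℝ} (hε : 0 < ε) : ∃ k : ℕ, (1 : ℝ) / (k + 1) ≤ ε :=
  (exists_nat_one_div_lt hε).imp fun _ h => h.le

theorem exists_wickSeminorm_le (hħ : 0 < ħ) (i : Label n) :
    ∃ (k : ℕ) (C : ℝ≥0), ∀ (p : Fin n → ℂ) (f : WickA p ħ),
      wickSeminorm p ħ i f ≤ C * supSeminorm p hħ k f := by
  obtain ⟨ε, hε, C, hC, h⟩ := normph_le (n := n) hħ i.1.1 i.1.2 i.2.1 i.2.2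
  obtain ⟨k, hk⟩ := exists_nat_one_div_le hε
  refine ⟨k, C.toNNReal, fun p f => ?_⟩
  have h1 := (h p f.toFun).trans (mul_le_mul_right (aq_anti hk _) C)
  have h2 := ENNReal.toReal_mono
    (ENNReal.mul_ne_top hC ((f.isWickFn hħ).2 p _ (one_div_nat_pos k))) h1
  rwa [ENNReal.toReal_mul] at h2

theorem exists_supSeminorm_le (hħ : 0 < ħ) (k : ℕ) :
    ∃ (i : Label n) (C : ℝ≥0), ∀ (p : Fin n → ℂ) (f : WickA p ħ),
      supSeminorm p hħ k f ≤ C * wickSeminorm p ħ i f := by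
  obtain ⟨m, hm, C, hC, h⟩ := aq_le_normph (n := n) hħ (one_div_nat_pos k)
  refine ⟨(⟨m, ⟨1, hm⟩⟩, 0, 0), C.toNNReal, fun p f => ?_⟩
  have h2 := ENNReal.toReal_mono (ENNReal.mul_ne_top hC (f.2.1.2 m 1 0 0 hm).ne) (h p f.toFun)
  rwa [ENNReal.toReal_mul] at h2

theorem withSeminorms_wick (p : Fin n → ℂ) (ħ : ℝ) : WithSeminorms (wickSeminorm p ħ) := ⟨rfl⟩

theorem withSeminorms_tilde (p : Fin n → ℂ) (ħ : ℝ) : WithSeminorms (tildeSeminorm p ħ) := ⟨rfl⟩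

theorem isBounded_of_forall_exists {E F ι κ : Type*} [AddCommGroup E] [Module ℂ E]
    [AddCommGroup F] [Module ℂ F] {σ : ℂ →+* ℂ} [RingHomIsometric σ] {q : ι → Seminorm ℂ E}
    {r : κ → Seminorm ℂ F} (T : E →ₛₗ[σ] F)
    (h : ∀ k, ∃ (i : ι) (C : ℝ≥0), ∀ x, r k (T x) ≤ C * q i x) : Seminorm.IsBounded q r T := by
  intro k
  obtain ⟨i, C, hC⟩ := h k
  refine ⟨{i}, C, fun x => ?_⟩
  rw [Finset.sup_singleton]
  exact hC x

/-- Replaces the original labels by a family indexed by ℕ, in which all later estimates are made. -/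
theorem withSeminorms_sup (p : Fin n → ℂ) (hħ : 0 < ħ) : WithSeminorms (supSeminorm p hħ) := by
  refine (withSeminorms_wick p ħ).congr ?_ ?_
  · refine isBounded_of_forall_exists _ fun k => ?_
    obtain ⟨i, C, h⟩ := exists_supSeminorm_le (n := n) hħ k
    exact ⟨i, C, h p⟩
  · refine isBounded_of_forall_exists _ fun i => ?_
    obtain ⟨k, C, h⟩ := exists_wickSeminorm_le (n := n) hħ i
    exact ⟨k, C, h p⟩

/-! ### Topological properties -/

instance (p : Fin n → ℂ) (ħ : ℝ) : IsTopologicalAddGroup (WickA p ħ) :=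
  (withSeminorms_wick p ħ).topologicalAddGroup

theorem firstCountable_wick (p : Fin n → ℂ) (hħ : 0 < ħ) : FirstCountableTopology (WickA p ħ) :=
  (withSeminorms_sup p hħ).firstCountableTopology

theorem norm_wpow_le_supSeminorm (hħ : 0 < ħ) (k : ℕ) (f : WickA p ħ) (α : Fin n ⊕ Fin n → ℕ) :
    ‖wpow α f.toFun p‖ ≤ (wt (1 / (k + 1)) α).toReal * supSeminorm p hħ k f := by
  have h := enorm_le_aq (1 / (k + 1)) (jet p f.toFun) α
  rw [← ofReal_supSeminorm hħ] at h
  have h2 := ENNReal.toReal_mono (ENNReal.mul_ne_top ENNReal.ofReal_ne_top (wt_ne_top _ _)) h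
  rwa [ENNReal.toReal_mul, ENNReal.toReal_ofReal (apply_nonneg _ _), mul_comm, toReal_enorm] at h2

theorem t1Space_wick (p : Fin n → ℂ) (hħ : 0 < ħ) : T1Space (WickA p ħ) := by
  refine (withSeminorms_sup p hħ).T1_of_separating fun f hf => ⟨0, fun h0 => hf ?_⟩
  refine WickA.ext (analytic_eq_zero_of_wpow (f.isWickFn hħ).1 (p := p) fun α => ?_)
  have := norm_wpow_le_supSeminorm hħ 0 f α
  rw [h0, mul_zero] at this
  exact norm_le_zero_iff.1 this

/-! ### Change of base point and continuity of derivatives -/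

theorem exists_supSeminorm_translate_le (p p' : Fin n → ℂ) (hħ : 0 < ħ) (k : ℕ) :
    ∃ (j : ℕ) (C : ℝ≥0), ∀ (f : WickA p ħ) (g : WickA p' ħ), f.toFun = g.toFun →
      supSeminorm p' hħ k g ≤ C * supSeminorm p hħ j f := by
  set ε : ℝ := min (1 / ((k : ℝ) + 1)) (1 / 2) / 2 with hε
  have hpos : 0 < ε := half_pos (lt_min (one_div_nat_pos k) (by norm_num))
  obtain ⟨C, hC, h⟩ := IsWickFn.aq_jet_le (n := n) hpos
    (by linarith [min_le_right (1 / ((k : ℝ) + 1)) (1 / 2)]) p p'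
  obtain ⟨j, hj⟩ := exists_nat_one_div_le hpos
  refine ⟨j, C.toNNReal, fun f g hfg => supSeminorm_le_of_aq_le hħ (by positivity) ?_⟩
  rw [ENNReal.ofReal_mul (by positivity), ofReal_supSeminorm, ENNReal.ofReal_coe_nnreal,
    ENNReal.coe_toNNReal hC]
  calc _ ≤ aq (2 * ε) (jet p' f.toFun) := by
        rw [hfg]
        exact aq_anti (by linarith [min_le_left (1 / ((k : ℝ) + 1)) (1 / 2)]) _
    _ ≤ C * aq ε (jet p f.toFun) := h _ (f.isWickFn hħ)
    _ ≤ _ := by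
        gcongr
        exact aq_anti hj _

/-- The identity of functions as a linear map from `A_{p,ħ}` to `A_{p',ħ}`. -/
def translateLM (p p' : Fin n → ℂ) (hħ : 0 < ħ) : WickA p ħ →ₗ[ℂ] WickA p' ħ where
  toFun f := WickA.of p' hħ f.toFun (f.isWickFn hħ)
  map_add' f g := WickA.ext <| by
    rw [WickA.toFun_of, WickA.toFun_add, WickA.toFun_add, WickA.toFun_of, WickA.toFun_of]
  map_smul' a f := WickA.ext <| by
    rw [WickA.toFun_of, WickA.toFun_smul, RingHom.id_apply, WickA.toFun_smul, WickA.toFun_of]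

theorem toFun_translateLM (p p' : Fin n → ℂ) (hħ : 0 < ħ) (f : WickA p ħ) :
    (translateLM p p' hħ f).toFun = f.toFun := WickA.toFun_of hħ f.toFun (f.isWickFn hħ)

theorem continuous_translateLM (p p' : Fin n → ℂ) (hħ : 0 < ħ) :
    Continuous (translateLM p p' hħ) := by
  refine WithSeminorms.continuous_of_isBounded (withSeminorms_sup p hħ) (withSeminorms_sup p' hħ)
    _ (isBounded_of_forall_exists _ fun k => ?_)
  obtain ⟨j, C, h⟩ := exists_supSeminorm_translate_le p p' hħ k
  exact ⟨j, C, fun f => h f _ (toFun_translateLM p p' hħ f).symm⟩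

/-- The identification of `A_{p,ħ}` and `A_{p',ħ}`. -/
def translate (p p' : Fin n → ℂ) (hħ : 0 < ħ) : WickA p ħ ≃L[ℂ] WickA p' ħ where
  toLinearMap := translateLM p p' hħ
  invFun := translateLM p' p hħ
  left_inv f := WickA.ext <| (toFun_translateLM p' p hħ _).trans (toFun_translateLM p p' hħ f)
  right_inv f := WickA.ext <| (toFun_translateLM p p' hħ _).trans (toFun_translateLM p' p hħ f)
  continuous_toFun := continuous_translateLM p p' hħ
  continuous_invFun := continuous_translateLM p' p hħ

theorem toFun_translate (p p' : Fin n → ℂ) (hħ : 0 < ħ) (f : WickA p ħ) :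
    (translate p p' hħ f).toFun = f.toFun := toFun_translateLM p p' hħ f

/-- Wirtinger derivatives at a point as linear functionals. -/
def wpowLM (p : Fin n → ℂ) (hħ : 0 < ħ) (α : Fin n ⊕ Fin n → ℕ) (z : Fin n → ℂ) :
    WickA p ħ →ₗ[ℂ] ℂ where
  toFun f := wpow α f.toFun z
  map_add' f g := by
    rw [WickA.toFun_add,
      (wpow_smoothLin α).add _ _ (f.isWickFn hħ).smooth (g.isWickFn hħ).smooth]
    rfl
  map_smul' a f := by
    rw [WickA.toFun_smul, (wpow_smoothLin α).smul _ _ (f.isWickFn hħ).smooth]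
    rfl

theorem continuous_wpowLM (p : Fin n → ℂ) (hħ : 0 < ħ) (α : Fin n ⊕ Fin n → ℕ)
    (z : Fin n → ℂ) : Continuous (wpowLM p hħ α z) := by
  refine WithSeminorms.continuous_of_isBounded (withSeminorms_sup p hħ)
    (norm_withSeminorms ℂ ℂ) _ (isBounded_of_forall_exists _ fun _ => ?_)
  obtain ⟨j, C, h⟩ := exists_supSeminorm_translate_le p z hħ 0
  refine ⟨j, (wt (1 / ((0 : ℕ) + 1)) α).toNNReal * C, fun f => ?_⟩
  have h1 := norm_wpow_le_supSeminorm hħ 0 (translate p z hħ f) α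
  rw [toFun_translate] at h1
  refine h1.trans ?_
  rw [NNReal.coe_mul, mul_assoc]
  exact mul_le_mul_of_nonneg_left (h f _ (toFun_translate p z hħ f).symm) ENNReal.toReal_nonneg

/-! ### Completeness, metrizability and absolute summability -/

/-- Each derivative at `p` converges, and the uniform Cauchy estimates pass to the limit array. That
array is therefore of the class, and its Taylor series is the limit function. -/
theorem exists_limit_of_cauchy (hħ : 0 < ħ) (u : ℕ → WickA p ħ)
    (hu : ∀ k, ∀ r : ℝ, 0 < r → ∃ N, ∀ a, N ≤ a → ∀ b, N ≤ b →
      supSeminorm p hħ k (u a - u b) ≤ r) : ∃ v, Filter.Tendsto u Filter.atTop (𝓝 v) := by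
  have hsub : ∀ a b α, wpow α (u a - u b).toFun p = wpow α (u a).toFun p - wpow α (u b).toFun p :=
    fun a b α => map_sub (wpowLM p hħ α p) (u a) (u b)
  have hc : ∀ α, CauchySeq fun a => wpow α (u a).toFun p := by
    intro α
    refine Metric.cauchySeq_iff.2 fun r hr => ?_
    have hw : 0 ≤ (wt (1 / ((0 : ℕ) + 1)) α).toReal := ENNReal.toReal_nonneg
    obtain ⟨N, hN⟩ := hu 0 (r / 2 / ((wt (1 / ((0 : ℕ) + 1)) α).toReal + 1)) (by positivity)
    refine ⟨N, fun a ha b hb => ?_⟩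
    rw [dist_eq_norm, ← hsub]
    refine (norm_wpow_le_supSeminorm hħ 0 _ α).trans_lt ?_
    calc _ ≤ ((wt (1 / ((0 : ℕ) + 1)) α).toReal + 1) *
          (r / 2 / ((wt (1 / ((0 : ℕ) + 1)) α).toReal + 1)) := by
          gcongr
          · linarith
          · exact hN a ha b hb
      _ = r / 2 := by field_simp
      _ < r := by linarith
  choose b hb using fun α => cauchySeq_tendsto_of_complete (hc α)
  have key : ∀ k : ℕ, ∀ r : ℝ, 0 < r → ∃ N, ∀ a, N ≤ a →
      aq (1 / (k + 1)) (jet p (u a).toFun - b) ≤ ENNReal.ofReal r := by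
    intro k r hr
    obtain ⟨N, hN⟩ := hu k r hr
    refine ⟨N, fun a ha => aq_le fun α => ?_⟩
    have ht : Filter.Tendsto (fun l => ‖wpow α (u a).toFun p - wpow α (u l).toFun p‖ₑ)
        Filter.atTop (𝓝 ‖wpow α (u a).toFun p - b α‖ₑ) :=
      (tendsto_const_nhds.sub (hb α)).enorm
    refine le_of_tendsto ht (Filter.eventually_atTop.2 ⟨N, fun l hl => ?_⟩)
    rw [← hsub]
    refine (enorm_le_aq (1 / (k + 1)) (jet p (u a - u l).toFun) α).trans ?_
    rw [← ofReal_supSeminorm hħ]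
    gcongr
    exact hN a ha l hl
  have hbfin : ∀ ε : ℝ, 0 < ε → aq ε b ≠ ⊤ := by
    intro ε hε
    obtain ⟨k, hk⟩ := exists_nat_one_div_le hε
    obtain ⟨N, hN⟩ := key k 1 one_pos
    refine ne_top_of_le_ne_top ?_ (aq_anti hk b)
    have e : b = jet p (u N).toFun + (-1 : ℂ) • (jet p (u N).toFun - b) := by
      simp
    rw [e]
    refine ne_top_of_le_ne_top ?_ (aq_add_le _ _ _)
    rw [aq_smul]
    exact ENNReal.add_ne_top.2 ⟨((u N).isWickFn hħ).2 p _ (one_div_nat_pos k),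
      ENNReal.mul_ne_top enorm_ne_top (ne_top_of_le_ne_top ENNReal.ofReal_ne_top (hN N le_rfl))⟩
  let v : WickA p ħ := WickA.of p hħ (pser p b) (isWickFn_pser hbfin p)
  have hv : jet p v.toFun = b := jet_pser (ent_of_aq (hbfin _ (by norm_num))) p
  refine ⟨v, ((withSeminorms_sup p hħ).tendsto_nhds u v).2 fun k r hr => ?_⟩
  obtain ⟨N, hN⟩ := key k (r / 2) (by positivity)
  refine Filter.eventually_atTop.2 ⟨N, fun a ha => ?_⟩
  have hj : jet p (u a - v).toFun = jet p (u a).toFun - b := by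
    rw [← hv]
    exact funext fun α => map_sub (wpowLM p hħ α p) (u a) v
  have := supSeminorm_le_of_aq_le hħ (k := k) (f := u a - v) (r := r / 2) (by positivity)
    (hj ▸ hN a ha)
  linarith

theorem completeSpace_wick (p : Fin n → ℂ) (hħ : 0 < ħ) :
    @CompleteSpace (WickA p ħ) (IsTopologicalAddGroup.rightUniformSpace (WickA p ħ)) := by
  let _ : UniformSpace (WickA p ħ) := IsTopologicalAddGroup.rightUniformSpace (WickA p ħ)
  have : IsUniformAddGroup (WickA p ħ) := isUniformAddGroup_of_addCommGroup
  have := firstCountable_wick p hħ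
  have : (uniformity (WickA p ħ)).IsCountablyGenerated :=
    IsUniformAddGroup.uniformity_countably_generated
  refine UniformSpace.complete_of_cauchySeq_tendsto fun u hu => exists_limit_of_cauchy hħ u ?_
  intro k r hr
  have hU : {x : WickA p ħ | supSeminorm p hħ k x < r} ∈ 𝓝 (0 : WickA p ħ) :=
    ((withSeminorms_sup p hħ).continuous_seminorm k).continuousAt.eventually
      (Iio_mem_nhds (by rwa [map_zero]))
  have hV : {x : WickA p ħ × WickA p ħ | supSeminorm p hħ k (x.2 - x.1) < r} ∈
      uniformity (WickA p ħ) := by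
    rw [uniformity_eq_comap_nhds_zero]
    exact Filter.preimage_mem_comap hU
  obtain ⟨N, hN⟩ := cauchySeq_iff.1 hu _ hV
  exact ⟨N, fun a ha b hb => (hN b hb a ha).le⟩

theorem metrizableSpace_wick (p : Fin n → ℂ) (hħ : 0 < ħ) :
    TopologicalSpace.MetrizableSpace (WickA p ħ) := by
  let _ : UniformSpace (WickA p ħ) := IsTopologicalAddGroup.rightUniformSpace (WickA p ħ)
  have : IsUniformAddGroup (WickA p ħ) := isUniformAddGroup_of_addCommGroup
  have := firstCountable_wick p hħ
  have : (uniformity (WickA p ħ)).IsCountablyGenerated :=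
    IsUniformAddGroup.uniformity_countably_generated
  have := t1Space_wick p hħ
  exact UniformSpace.metrizableSpace

theorem summable_wick (hħ : 0 < ħ) {ι : Type*} (t : ι → WickA p ħ)
    (ht : ∀ k, Summable fun i => supSeminorm p hħ k (t i)) : Summable t := by
  let _ : UniformSpace (WickA p ħ) := IsTopologicalAddGroup.rightUniformSpace (WickA p ħ)
  have : IsUniformAddGroup (WickA p ħ) := isUniformAddGroup_of_addCommGroup
  have := completeSpace_wick p hħ
  classical
  rw [summable_iff_vanishing]
  intro U hU
  obtain ⟨s, r, hr, hs⟩ := ((withSeminorms_sup p hħ).mem_nhds_iff 0 U).1 hU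
  -- A neighbourhood of 0 involves finitely many seminorms, so the union of their exceptional finite
  -- sets serves for all of them.
  choose F hF using fun k => summable_iff_vanishing_norm.1 (ht k) r hr
  refine ⟨s.sup F, fun T hT => hs ?_⟩
  rw [Seminorm.mem_ball_zero]
  refine Seminorm.finset_sup_apply_lt hr fun k hk => ?_
  have h1 := hF k T (hT.mono_right (Finset.le_sup (f := F) hk))
  refine lt_of_le_of_lt ?_ ((le_abs_self _).trans_lt h1)
  exact Finset.le_sum_of_subadditive _ (map_zero (supSeminorm p hħ k)).le
    (map_add_le_add _) T t

end WickSpace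

/-! ### The Wick star product on `A_{p,ħ}` -/

section StarProduct

open scoped ENNReal NNReal Topology

variable {p : Fin n → ℂ} {ħ : ℝ}

/-- The terms of the Wick star product as elements of `A_{p,ħ}`. -/
def termA (hħ : 0 < ħ) (f g : WickA p ħ) (N : MI n) : WickA p ħ :=
  WickA.of p hħ (wickTerm ħ f.toFun g.toFun N)
    (isWickFn_wickTerm hħ (f.isWickFn hħ) (g.isWickFn hħ) N)

theorem toFun_termA (hħ : 0 < ħ) (f g : WickA p ħ) (N : MI n) :
    (termA hħ f g N).toFun = wickTerm ħ f.toFun g.toFun N := rfl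

theorem exists_supSeminorm_termA_le (p : Fin n → ℂ) (hħ : 0 < ħ) (k : ℕ) :
    ∃ (j : ℕ) (u : MI n → ℝ), Summable u ∧ ∀ (f g : WickA p ħ) (N : MI n),
      supSeminorm p hħ k (termA hħ f g N) ≤
        u N * (supSeminorm p hħ j f * supSeminorm p hħ j g) := by
  set ε : ℝ := min (1 / ((k : ℝ) + 1)) (1 / 2) / 4 with hε
  have hm : 0 < min (1 / ((k : ℝ) + 1)) (1 / 2) := lt_min (one_div_nat_pos k) (by norm_num)
  have hpos : 0 < ε := by linarith
  obtain ⟨u, hu, h⟩ := aq_termArray_le (n := n) hħ hpos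
    (by linarith [min_le_right (1 / ((k : ℝ) + 1)) (1 / 2)])
  obtain ⟨j, hj⟩ := exists_nat_one_div_le hpos
  refine ⟨j, fun N => (u N).toReal, ENNReal.summable_toReal hu, fun f g N =>
    supSeminorm_le_of_aq_le hħ (mul_nonneg ENNReal.toReal_nonneg
      (mul_nonneg (apply_nonneg _ _) (apply_nonneg _ _))) ?_⟩
  rw [ENNReal.ofReal_mul ENNReal.toReal_nonneg, ENNReal.ofReal_mul (apply_nonneg _ _),
    ofReal_supSeminorm, ofReal_supSeminorm,
    ENNReal.ofReal_toReal (ENNReal.ne_top_of_tsum_ne_top hu N), toFun_termA,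
    jet_wickTerm hħ (f.isWickFn hħ) (g.isWickFn hħ)]
  calc _ ≤ aq (4 * ε) (termArray ħ (jet p f.toFun) (jet p g.toFun) N) :=
        aq_anti (by linarith [min_le_left (1 / ((k : ℝ) + 1)) (1 / 2)]) _
    _ ≤ u N * (aq ε (jet p f.toFun) * aq ε (jet p g.toFun)) := h _ _ N
    _ ≤ _ := by
        gcongr
        · exact aq_anti hj _
        · exact aq_anti hj _

theorem summable_supSeminorm_termA (hħ : 0 < ħ) (f g : WickA p ħ) (k : ℕ) :
    Summable fun N => supSeminorm p hħ k (termA hħ f g N) := by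
  obtain ⟨j, u, hu, h⟩ := exists_supSeminorm_termA_le p hħ k
  exact (hu.mul_right _).of_nonneg_of_le (fun _ => apply_nonneg _ _) (h f g)

/-- The Wick star product on `A_{p,ħ}`. -/
def starMul (hħ : 0 < ħ) (f g : WickA p ħ) : WickA p ħ := ∑' N, termA hħ f g N

theorem hasSum_starMul (hħ : 0 < ħ) (f g : WickA p ħ) :
    HasSum (termA hħ f g) (starMul hħ f g) :=
  (summable_wick hħ _ (summable_supSeminorm_termA hħ f g)).hasSum

theorem isWickProduct_starMul (hħ : 0 < ħ) (f g : WickA p ħ) :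
    IsWickProduct f g (starMul hħ f g) := by
  refine ⟨termA hħ f g, fun N => rfl, fun i => ?_, hasSum_starMul hħ f g⟩
  obtain ⟨k, C, h⟩ := exists_wickSeminorm_le (n := n) hħ i
  exact ((summable_supSeminorm_termA hħ f g k).mul_left (C : ℝ)).of_nonneg_of_le
    (fun _ => apply_nonneg _ _) fun N => h p _

/-- Derivatives at any point are continuous functionals, so they may be taken term by term. -/
theorem hasSum_wpow_starMul (hħ : 0 < ħ) (f g : WickA p ħ) (α : Fin n ⊕ Fin n → ℕ)
    (z : Fin n → ℂ) : HasSum (fun N => wpow α (wickTerm ħ f.toFun g.toFun N) z)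
      (wpow α (starMul hħ f g).toFun z) :=
  (hasSum_starMul hħ f g).map (wpowLM p hħ α z) (continuous_wpowLM p hħ α z)

theorem hasSum_starMul_apply (hħ : 0 < ħ) (f g : WickA p ħ) (z : Fin n → ℂ) :
    HasSum (fun N => wickTerm ħ f.toFun g.toFun N z) ((starMul hħ f g).toFun z) := by
  simpa only [wpow_zero] using hasSum_wpow_starMul hħ f g 0 z

/-- Pointwise sums determine the product, so algebraic identities, and the comparison between base
points, reduce to numerical series. -/
theorem starMul_ext (hħ : 0 < ħ) (f g : WickA p ħ) {h : WickA p ħ}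
    (H : ∀ z, HasSum (fun N => wickTerm ħ f.toFun g.toFun N z) (h.toFun z)) :
    starMul hħ f g = h :=
  WickA.ext (funext fun z => (hasSum_starMul_apply hħ f g z).unique (H z))

theorem wickTerm_apply (ħ : ℝ) (f g : (Fin n → ℂ) → ℂ) (N : MI n) (z : Fin n → ℂ) :
    wickTerm ħ f g N z =
      wickCoeff ħ N * (wpow (Sum.elim N 0) f z * wpow (Sum.elim 0 N) g z) := by
  rw [wickTerm, dzPow_eq_wpow, dzbarPow_eq_wpow]
  rfl

theorem exists_supSeminorm_starMul_le (p : Fin n → ℂ) (hħ : 0 < ħ) (k : ℕ) :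
    ∃ (j : ℕ) (C : ℝ), ∀ f g : WickA p ħ, supSeminorm p hħ k (starMul hħ f g) ≤
      C * (supSeminorm p hħ j f * supSeminorm p hħ j g) := by
  obtain ⟨j, u, hu, h⟩ := exists_supSeminorm_termA_le p hħ k
  refine ⟨j, ∑' N, u N, fun f g => ?_⟩
  have hc := ((withSeminorms_sup p hħ).continuous_seminorm k).continuousAt.tendsto.comp
    (hasSum_starMul hħ f g)
  refine le_of_tendsto_of_tendsto' hc (hu.hasSum.mul_right _) fun s => ?_
  exact (Finset.le_sum_of_subadditive _ (map_zero (supSeminorm p hħ k)).le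
    (map_add_le_add _) s _).trans (Finset.sum_le_sum fun N _ => h f g N)

/-- The Wick star product as a bilinear map. -/
def starMulLM (p : Fin n → ℂ) (hħ : 0 < ħ) : WickA p ħ →ₗ[ℂ] WickA p ħ →ₗ[ℂ] WickA p ħ :=
  LinearMap.mk₂ ℂ (starMul hħ)
    (fun f f' g => starMul_ext hħ _ _ fun z => by
      refine ((hasSum_starMul_apply hħ f g z).add (hasSum_starMul_apply hħ f' g z)).congr_fun
        fun N => ?_
      simp only [wickTerm_apply, WickA.toFun_add,
        (wpow_smoothLin _).add _ _ (f.isWickFn hħ).smooth (f'.isWickFn hħ).smooth, Pi.add_apply]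
      ring)
    (fun a f g => starMul_ext hħ _ _ fun z => by
      refine ((hasSum_starMul_apply hħ f g z).mul_left a).congr_fun fun N => ?_
      simp only [wickTerm_apply, WickA.toFun_smul,
        (wpow_smoothLin _).smul _ _ (f.isWickFn hħ).smooth, Pi.smul_apply, smul_eq_mul]
      ring)
    (fun f g g' => starMul_ext hħ _ _ fun z => by
      refine ((hasSum_starMul_apply hħ f g z).add (hasSum_starMul_apply hħ f g' z)).congr_fun
        fun N => ?_
      simp only [wickTerm_apply, WickA.toFun_add,
        (wpow_smoothLin _).add _ _ (g.isWickFn hħ).smooth (g'.isWickFn hħ).smooth, Pi.add_apply]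
      ring)
    (fun a f g => starMul_ext hħ _ _ fun z => by
      refine ((hasSum_starMul_apply hħ f g z).mul_left a).congr_fun fun N => ?_
      simp only [wickTerm_apply, WickA.toFun_smul,
        (wpow_smoothLin _).smul _ _ (g.isWickFn hħ).smooth, Pi.smul_apply, smul_eq_mul]
      ring)

theorem starMulLM_apply (hħ : 0 < ħ) (f g : WickA p ħ) :
    starMulLM p hħ f g = starMul hħ f g := rfl

theorem continuous_starMul (p : Fin n → ℂ) (hħ : 0 < ħ) :
    Continuous fun x : WickA p ħ × WickA p ħ => starMul hħ x.1 x.2 := by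
  refine continuous_iff_continuousAt.2 fun y => ?_
  refine ((withSeminorms_sup p hħ).tendsto_nhds _ _).2 fun k r hr => ?_
  obtain ⟨j, C, h⟩ := exists_supSeminorm_starMul_le p hħ k
  have hS := (withSeminorms_sup p hħ).continuous_seminorm j
  let φ : WickA p ħ × WickA p ħ → ℝ := fun x =>
    C * (supSeminorm p hħ j (x.1 - y.1) * supSeminorm p hħ j (x.2 - y.2)) +
      C * (supSeminorm p hħ j (x.1 - y.1) * supSeminorm p hħ j y.2) +
      C * (supSeminorm p hħ j y.1 * supSeminorm p hħ j (x.2 - y.2))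
  have hφ : Continuous φ := by
    have h1 : Continuous fun x : WickA p ħ × WickA p ħ => supSeminorm p hħ j (x.1 - y.1) :=
      hS.comp (continuous_fst.sub continuous_const)
    have h2 : Continuous fun x : WickA p ħ × WickA p ħ => supSeminorm p hħ j (x.2 - y.2) :=
      hS.comp (continuous_snd.sub continuous_const)
    fun_prop
  have hφ0 : φ y = 0 := by simp [φ]
  filter_upwards [hφ.continuousAt.eventually (Iio_mem_nhds (show φ y < r by rwa [hφ0]))] with x hx
  refine lt_of_le_of_lt ?_ hx
  -- Bilinearity expands the difference into terms that each contain a factor tending to 0; `φ` is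
  -- the resulting bound.
  have e : starMul hħ x.1 x.2 - starMul hħ y.1 y.2 =
      starMul hħ (x.1 - y.1) (x.2 - y.2) + starMul hħ (x.1 - y.1) y.2 +
        starMul hħ y.1 (x.2 - y.2) := by
    simp only [← starMulLM_apply, map_sub, LinearMap.sub_apply]
    abel
  rw [e]
  refine (map_add_le_add _ _ _).trans (add_le_add ((map_add_le_add _ _ _).trans
    (add_le_add (h _ _) (h _ _))) (h _ _))

theorem starMul_assoc (hħ : 0 < ħ) (f g h : WickA p ħ) :
    starMul hħ (starMul hħ f g) h = starMul hħ f (starMul hħ g h) := by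
  refine WickA.ext (funext fun z => ?_)
  have hf := f.isWickFn hħ
  have hg := g.isWickFn hħ
  have hh := h.isWickFn hħ
  have key : ∀ (f g : WickA p ħ) (α : Fin n ⊕ Fin n → ℕ), wpow α (starMul hħ f g).toFun z =
      ∑' M, termArray ħ (jet z f.toFun) (jet z g.toFun) M α := fun f g α => by
    rw [← (hasSum_wpow_starMul hħ f g α z).tsum_eq]
    exact tsum_congr fun M =>
      congrFun (jet_wickTerm hħ (f.isWickFn hħ) (g.isWickFn hħ) M z) α
  rw [← (hasSum_starMul_apply hħ _ _ z).tsum_eq, ← (hasSum_starMul_apply hħ f _ z).tsum_eq]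
  simp only [wickTerm_apply, key]
  exact tsum_termArray_assoc hħ (hf.2 z _ (by norm_num)) (hg.2 z _ (by norm_num))
    (hh.2 z _ (by norm_num))

/-! ### Complex conjugation -/

/-- Pointwise complex conjugation on `A_{p,ħ}`. -/
def conjA (hħ : 0 < ħ) (f : WickA p ħ) : WickA p ħ :=
  WickA.of p hħ (fun z => (starRingEnd ℂ) (f.toFun z)) (f.isWickFn hħ).conj

theorem toFun_conjA (hħ : 0 < ħ) (f : WickA p ħ) :
    (conjA hħ f).toFun = fun z => (starRingEnd ℂ) (f.toFun z) := rfl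

/-- Pointwise complex conjugation as an antilinear map. -/
def conjLM (p : Fin n → ℂ) (hħ : 0 < ħ) : WickA p ħ →ₛₗ[starRingEnd ℂ] WickA p ħ where
  toFun := conjA hħ
  map_add' f g := WickA.ext (funext fun z => by
    simp [toFun_conjA, WickA.toFun_add])
  map_smul' a f := WickA.ext (funext fun z => by
    simp [toFun_conjA, WickA.toFun_smul])

theorem continuous_conjA (p : Fin n → ℂ) (hħ : 0 < ħ) :
    Continuous (conjA hħ : WickA p ħ → WickA p ħ) := by
  refine WithSeminorms.continuous_of_isBounded (withSeminorms_sup p hħ) (withSeminorms_sup p hħ)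
    (conjLM p hħ) (isBounded_of_forall_exists _ fun k => ⟨k, 1, fun f => ?_⟩)
  rw [NNReal.coe_one, one_mul]
  refine supSeminorm_le_of_aq_le hħ (apply_nonneg _ _) ?_
  rw [ofReal_supSeminorm]
  exact aq_jet_conj_le _ p (f.isWickFn hħ).smooth

theorem conj_wickCoeff (ħ : ℝ) (N : MI n) : (starRingEnd ℂ) (wickCoeff ħ N) = wickCoeff ħ N := by
  rw [wickCoeff, map_div₀, map_pow, Complex.conj_ofReal, map_natCast]

/-- Conjugation exchanges ∂_z and ∂_z̄ while the coefficients are real, so it reverses the two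
factors term by term. -/
theorem conjA_starMul (hħ : 0 < ħ) (f g : WickA p ħ) :
    conjA hħ (starMul hħ f g) = starMul hħ (conjA hħ g) (conjA hħ f) := by
  symm
  refine starMul_ext hħ _ _ fun z => ?_
  refine ((hasSum_starMul_apply hħ f g z).map (starRingEnd ℂ) Complex.continuous_conj).congr_fun
    fun N => ?_
  have e1 : Sum.elim N (0 : MI n) ∘ Sum.swap = Sum.elim (0 : MI n) N := by
    funext i
    rcases i with i | i <;> rfl
  have e2 : Sum.elim (0 : MI n) N ∘ Sum.swap = Sum.elim N (0 : MI n) := by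
    funext i
    rcases i with i | i <;> rfl
  simp only [Function.comp_apply, wickTerm_apply, toFun_conjA,
    wpow_conj _ (f.isWickFn hħ).smooth, wpow_conj _ (g.isWickFn hħ).smooth, e1, e2, map_mul,
    conj_wickCoeff]
  ring

theorem isFrechetStarAlgebra_wick (p : Fin n → ℂ) (hħ : 0 < ħ) :
    IsFrechetStarAlgebra (WickA p ħ) (starMul hħ) (conjA hħ) where
  isTopologicalAddGroup := inferInstance
  continuousSMul := (withSeminorms_wick p ħ).continuousSMul
  locallyConvexSpace := (withSeminorms_wick p ħ).toLocallyConvexSpace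
  metrizableSpace := metrizableSpace_wick p hħ
  completeSpace := completeSpace_wick p hħ
  add_mul a b c := (starMulLM p hħ).map_add₂ a b c
  mul_add a b c := (starMulLM p hħ a).map_add b c
  smul_mul r a b := (starMulLM p hħ).map_smul₂ r a b
  mul_smul r a b := (starMulLM p hħ a).map_smul r b
  mul_assoc := starMul_assoc hħ
  continuous_mul := continuous_starMul p hħ
  str_add := (conjLM p hħ).map_add
  str_smul r a := (conjLM p hħ).map_smulₛₗ r a
  str_str a := WickA.ext (funext fun z => by simp [toFun_conjA])
  str_mul := conjA_starMul hħ
  continuous_str := continuous_conjA p hħ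

/-! ### The quotient by the functions with vanishing jet -/

theorem hph_congr_jet {f g : (Fin n → ℂ) → ℂ} (h : jet p f = jet p g) (m ℓ : ℕ) (R S : MI n) :
    hph p ħ f m ℓ R S = hph p ħ g m ℓ R S := by
  induction m generalizing ℓ R S with
  | zero =>
    rw [hph, hph]
    have : ∀ R S : MI n, wirt R S f p = wirt R S g p := fun R S => congrFun h (Sum.elim R S)
    simp only [this]
  | succ m ih =>
    rw [hph, hph]
    simp only [ih]

theorem TildeA.jet_ne_top (hħ : 0 < ħ) (f : TildeA p ħ) (ε : ℝ) (hε : 0 < ε) :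
    aq ε (jet p f.toFun) ≠ ⊤ := jet_ne_top_of_tilde hħ f.2 ε hε

theorem TildeA.smooth (f : TildeA p ħ) : ContDiff ℝ ∞ f.toFun := f.2.1

theorem TildeA.ent (hħ : 0 < ħ) (f : TildeA p ħ) : Ent (jet p f.toFun) :=
  ent_of_aq (f.jet_ne_top hħ _ (by norm_num))

/-- The real-analytic function with the same `∞`-jet at `p`. -/
def analyticRep (hħ : 0 < ħ) (f : TildeA p ħ) : WickA p ħ :=
  WickA.of p hħ (pser p (jet p f.toFun)) (isWickFn_pser (f.jet_ne_top hħ) p)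

theorem jet_analyticRep (hħ : 0 < ħ) (f : TildeA p ħ) :
    jet p (analyticRep hħ f).toFun = jet p f.toFun := jet_pser (f.ent hħ) p

theorem WickA.ext_jet (hħ : 0 < ħ) {f g : WickA p ħ} (h : jet p f.toFun = jet p g.toFun) :
    f = g :=
  WickA.ext (analytic_ext_wpow (f.isWickFn hħ).1 (g.isWickFn hħ).1 (congrFun h))

/-- The map to the real-analytic representatives. -/
def analyticRepLM (p : Fin n → ℂ) (hħ : 0 < ħ) : TildeA p ħ →ₗ[ℂ] WickA p ħ where
  toFun := analyticRep hħ
  map_add' f g := WickA.ext_jet hħ <| by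
    rw [WickA.toFun_add, jet_add p ((analyticRep hħ f).isWickFn hħ).smooth
      ((analyticRep hħ g).isWickFn hħ).smooth, jet_analyticRep, jet_analyticRep, jet_analyticRep]
    exact jet_add p f.smooth g.smooth
  map_smul' a f := WickA.ext_jet hħ <| by
    rw [RingHom.id_apply, WickA.toFun_smul,
      jet_smul p a ((analyticRep hħ f).isWickFn hħ).smooth, jet_analyticRep, jet_analyticRep]
    exact jet_smul p a f.smooth

theorem wickSeminorm_analyticRep (hħ : 0 < ħ) (i : Label n) (f : TildeA p ħ) :
    wickSeminorm p ħ i (analyticRep hħ f) = tildeSeminorm p ħ i f := by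
  have h : normph p ħ i.1.1 i.1.2 i.2.1 i.2.2 (analyticRep hħ f).toFun =
      normph p ħ i.1.1 i.1.2 i.2.1 i.2.2 f.toFun := by
    rw [normph, normph, hph_congr_jet (jet_analyticRep hħ f)]
  exact congrArg ENNReal.toReal h

theorem continuous_analyticRepLM (p : Fin n → ℂ) (hħ : 0 < ħ) :
    Continuous (analyticRepLM p hħ) := by
  refine WithSeminorms.continuous_of_isBounded (withSeminorms_tilde p ħ) (withSeminorms_wick p ħ)
    _ (isBounded_of_forall_exists _ fun i => ⟨i, 1, fun f => ?_⟩)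
  rw [NNReal.coe_one, one_mul]
  exact (wickSeminorm_analyticRep hħ i f).le

theorem continuous_incl (p : Fin n → ℂ) (ħ : ℝ) : Continuous (incl p ħ) := by
  refine WithSeminorms.continuous_of_isBounded (withSeminorms_wick p ħ) (withSeminorms_tilde p ħ)
    _ (isBounded_of_forall_exists _ fun i => ⟨i, 1, fun f => ?_⟩)
  rw [NNReal.coe_one, one_mul]
  exact le_rfl

theorem mem_flat_iff (f : TildeA p ħ) : f ∈ flat p ħ ↔ jet p f.toFun = 0 :=
  ⟨fun h => funext fun α => wpow_eq_zero_of_iteratedFDeriv f.smooth h α,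
    fun h => iteratedFDeriv_eq_zero_of_wpow f.smooth (congrFun h)⟩

theorem flat_le_ker (p : Fin n → ℂ) (hħ : 0 < ħ) :
    flat p ħ ≤ LinearMap.ker (analyticRepLM p hħ) := fun f hf => by
  refine LinearMap.mem_ker.2 (WickA.ext ?_)
  change pser p (jet p f.toFun) = fun _ => 0
  rw [(mem_flat_iff f).1 hf]
  funext z
  simp [pser]

theorem analyticRep_incl (hħ : 0 < ħ) (f : WickA p ħ) : analyticRep hħ (incl p ħ f) = f :=
  WickA.ext_jet hħ (jet_analyticRep hħ _)

theorem incl_analyticRep_sub_mem_flat (hħ : 0 < ħ) (f : TildeA p ħ) :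
    incl p ħ (analyticRep hħ f) - f ∈ flat p ħ := by
  have e : incl p ħ (analyticRep hħ f) - f = incl p ħ (analyticRep hħ f) + (-1 : ℂ) • f := by
    rw [neg_one_smul, sub_eq_add_neg]
  rw [mem_flat_iff, e]
  have h1 := jet_add p ((analyticRep hħ f).isWickFn hħ).smooth
    (g := (-1 : ℂ) • f.toFun) (f.smooth.const_smul (-1 : ℂ))
  rw [jet_smul p _ f.smooth, jet_analyticRep] at h1
  exact h1.trans (by simp)

/-- The inverse is `analyticRepLM` descended to the quotient; it is continuous because taking the
analytic representative preserves every seminorm. -/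
theorem isHomeomorph_toQuotient (p : Fin n → ℂ) (hħ : 0 < ħ) :
    IsHomeomorph (toQuotient p ħ) := by
  refine isHomeomorph_iff_exists_inverse.2
    ⟨continuous_quot_mk.comp (continuous_incl p ħ),
      (flat p ħ).liftQ (analyticRepLM p hħ) (flat_le_ker p hħ), fun f => analyticRep_incl hħ f,
      fun x => ?_, ?_⟩
  · induction x using Submodule.Quotient.induction_on with
    | H f => exact (Submodule.Quotient.eq _).2 (incl_analyticRep_sub_mem_flat hħ f)
  · exact continuous_quot_lift _ (continuous_analyticRepLM p hħ)

end StarProduct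

end Wick

end

/-- For every `p`, the quotient space `A_{p,ħ}` is identified with a space of real-analytic
functions, and is a Fréchet `*`-algebra with the (convergent) Wick star product and the complex
conjugation; for any two points `p, p'` these Fréchet `*`-algebras coincide. -/
theorem mainTheorem6 (n : ℕ) (ħ : ℝ) (hħ : 0 < ħ) :
    (∀ p : Fin n → ℂ, IsHomeomorph (Wick.toQuotient p ħ)) ∧
    ∃ (mul : ∀ p : Fin n → ℂ, Wick.WickA p ħ → Wick.WickA p ħ → Wick.WickA p ħ)
      (str : ∀ p : Fin n → ℂ, Wick.WickA p ħ → Wick.WickA p ħ),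
      (∀ p f g, Wick.IsWickProduct f g (mul p f g)) ∧
      (∀ p f z, str p f z = (starRingEnd ℂ) (f z)) ∧
      (∀ p, Wick.IsFrechetStarAlgebra (Wick.WickA p ħ) (mul p) (str p)) ∧
      ∀ p p' : Fin n → ℂ,
        Wick.wickSubmodule p ħ = Wick.wickSubmodule p' ħ ∧
        ∃ e : Wick.WickA p ħ ≃L[ℂ] Wick.WickA p' ħ,
          (∀ f z, e f z = f z) ∧
          (∀ f g, e (mul p f g) = mul p' (e f) (e g)) ∧
          (∀ f, e (str p f) = str p' (e f)) := by
  refine ⟨fun p => Wick.isHomeomorph_toQuotient p hħ, fun p => Wick.starMul hħ,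
    fun p => Wick.conjA hħ, fun p => Wick.isWickProduct_starMul hħ, fun p f z => rfl,
    fun p => Wick.isFrechetStarAlgebra_wick p hħ, fun p p' => ⟨?_, Wick.translate p p' hħ, ?_⟩⟩
  · exact Submodule.ext fun f =>
      (Wick.mem_wickSubmodule_iff hħ).trans (Wick.mem_wickSubmodule_iff hħ).symm
  · have h := Wick.toFun_translate p p' hħ
    refine ⟨fun f z => congrFun (h f) z, fun f g => ?_, fun f => ?_⟩
    · refine (Wick.starMul_ext hħ _ _ fun z => ?_).symm
      rw [h, h, h]
      exact Wick.hasSum_starMul_apply hħ f g z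
    · refine Wick.WickA.ext ?_
      rw [h, Wick.toFun_conjA, Wick.toFun_conjA, h]
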